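/- **Setting.** Let $\Theta\subset\mathbb R^p$, $\Theta'\subset\mathbb R^q$ be compact with positive Lebesgue measure, $T>0$, and $D=\Theta\times\Theta'\times[0,T]$. Let $\mathbb G\in\mathbb R^{N_h\times N_h}$ be symmetric positive definite, $\|v\|=\sqrt{v^T\mathbb Gv}$, and let $u:D\to\mathbb R^{N_h}$, $(\mu,\nu,t)\mapsto u^{\mu,\nu,t}$, satisfy $m:=\operatorname{ess\,inf}_D\|u\|>0$ and $\|u^{\mu,\nu,t}-u^{\mu',\nu',t'}\|\le L(|\mu-\mu'|+|\nu-\nu'|+|t-t'|)$. Let $N_A=N_h$, so that $\mathbb A\in\mathbb R^{N_h\times N_h}$ is any $\mathbb G$-orthonormal matrix ($\mathbb A^T\mathbb G\mathbb A=I$), e.g. a POD matrix; it may depend on the sample. Let $\nu_1,\dots,\nu_{N_{s_2}}$ be independent and uniformly distributed on $\Theta'$, with joint law $\mathbb P_\nu$. For a sample put $$K(\mu,t)=\tfrac{|\Theta'|}{N_{s_2}}\sum_j w_jw_j^T,\quad w_j=\mathbb A^T\mathbb G u^{\mu,\nu_j,t},\qquad \hat J(\mu,t,\mathbb V)=\tfrac{|\Theta'|}{N_{s_2}}\sum_j\|u^{\mu,\nu_j,t}-\mathbb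 V\mathbb V^T\mathbb Gu^{\mu,\nu_j,t}\|^2,$$ let $\sigma(\mu,t)_1^2\ge\sigma(\mu,t)_2^2\ge\dots$ be the eigenvalues of $K(\mu,t)$, and for $\varepsilon>0$ let $N'$ be the least $r\in\mathbb N$ with $\sup_{(\mu,t)\in\Theta\times[0,T]}\sum_{k>r}\sigma(\mu,t)_k^2\le\frac{m^2}{16|\Theta\times[0,T]|}\varepsilon^2$. **Assumption on the sample.** (i) There is an optimal DOD $\mathsf s:\Theta\times[0,T]\to[-1,1]^{N_A\times N'}$, i.e. for all $(\mu,t)$ the matrix $\mathbb A\mathsf s(\mu,t)$ is $\mathbb G$-orthonormal and $\mathsf s(\mu,t)$ minimizes $W\mapsto\hat J(\mu,t,\mathbb AW)$ over $[-1,1]^{N_A\times N'}$, that is $\hat L$-Lipschitz: $|\mathsf s(\mu,t)-\mathsf s(\mu',t')|_F\le\hat L(|\mu-\mu'|+|t-t'|)$. (ii) There are $\chi\in C^s(\mathbb R^n;\mathbb R^{N'})$ and $\chi'\in C^{s'}(\mathbb R^{N'};\mathbb R^n)$, $s\ge s'\ge2$, with $|D^\alpha\chi|\le C_1$ for $|\alpha|\le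 s$, $|D^\alpha\chi'|\le C_2$ for $|\alpha|\le s'$, and $\chi(\chi'(q))=q$ for all $q=(\mathbb A\mathsf s(\mu,t))^T\mathbb Gu^{\mu,\nu,t}$, $(\mu,\nu,t)\in D$. **Networks.** A ReLU network with $\ell$ layers computes $x_l=\rho(A_l(x_0,\dots,x_{l-1})+b_l)$ for $1\le l<\ell$ and $x_\ell=A_\ell(x_0,\dots,x_{\ell-1})+b_\ell$ from the input $x_0$, with $\rho(x)=\max(x,0)$ entrywise. Its architecture prescribes $\ell$, the layer widths and the positions at which the $A_l,b_l$ may be non-zero (the active weights). An inner DOD module $\tilde{\mathbb V}$ consists of a seed network $\mathbb R^{p+1}\to\mathbb R^l$ and $N'$ root networks $\mathbb R^l\to\mathbb R^{N_A}$; the roots applied to the seed's output at $(\mu,t)$ are the columns of a matrix, which is orthonormalized by the Gram–Schmidt process to give $\tilde{\mathbb V}_{\mu,t}\in\mathbb R^{N_A\times N'}$. Its layers are those of the seed plus those of the deepest root; its active weights are $\sum_{j=1}^{N'}(\omega_{\mathrm{root}_j}+\omega_{\mathrm{seed}})$. With a decoder network $\psi:\mathbb R^n\to\mathbb R^{N'}$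 and a feedforward network $\phi:\mathbb R^{p+q+1}\to\mathbb R^n$, the DOD-DL-ROM is $\hat u^{\mu,\nu,t}=\mathbb A\tilde{\mathbb V}_{\mu,t}\,\psi(\phi(\mu,\nu,t))$, with relative error $$\mathcal E_R=\Big(\int_D\frac{\|u^{\mu,\nu,t}-\hat u^{\mu,\nu,t}\|^2}{\|u^{\mu,\nu,t}\|^2}\,d(\mu,\nu,t)\Big)^{1/2}.$$ **Theorem.** Let $\varepsilon_0<1$. There is a constant $c>0$ depending only on $\Theta,\Theta',T,L,\hat L,C_1,C_2,m,p,q,n,s,s',\varepsilon_0$ such that for all $N_h,\mathbb G,u$ as above, all $0<\varepsilon\le\varepsilon_0$ and $0<\delta<1$ there is $N_0$ such that for every $N_{s_2}\ge N_0$ the following holds. There are architectures (depending on the sample only through the value of $N'$) with at most * $c\log(\varepsilon^{-1})$ layers and $c\,N_AN'\varepsilon^{-(p+1)}\log(\varepsilon^{-1})$ active weights for the inner DOD module, * $c\log(\varepsilon^{-1})$ layers and $c\,N'\varepsilon^{-n/(s-1)}\log(\varepsilon^{-1})$ active weights for the decoder, * $c\log(\varepsilon^{-1})$ layers and $c\,n\,\varepsilon^{-(p+q+1)}\log(\varepsilon^{-1})$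 active weights for the feedforward network, and an event of probability greater than $1-\delta$ such that for every sample in this event and every $\mathbb A$ for which (i) and (ii) hold there are weights of these architectures with $\mathcal E_R<\varepsilon$. In particular, if (i) and (ii) hold for almost every sample, the weights can be chosen so that $\mathbb P_\nu[\mathcal E_R<\varepsilon]>1-\delta$ (in the sense that $\{\mathcal E_R<\varepsilon\}$ contains an event of probability greater than $1-\delta$). -/

import Mathlib

open MeasureTheory
open scoped ENNReal Matrix ContDiff

noncomputable section

/-! ### ReLU networks -/

/-- A network architecture with input dimension `d` and output dimension `e`. Layer `0` is the
input, and the layers `1, …, depth` are computed; layer `l` may read all the layers `k < l`.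
`maskA l` and `maskB l` are the positions of the non-zero entries of the `l`-th matrix and of the
`l`-th bias; the columns of the `l`-th matrix are indexed by pairs (layer `k < l`, neuron of `k`). -/
structure ReLUArch (d e : ℕ) where
  depth : ℕ
  depth_pos : 0 < depth
  width : ℕ → ℕ
  width_zero : width 0 = d
  width_depth : width depth = e
  maskA : (l : ℕ) → Finset (Fin (width l) × (Σ k : Fin l, Fin (width k)))
  maskB : (l : ℕ) → Finset (Fin (width l))

namespace ReLUArch

variable {d e : ℕ}

/-- The number of active weights. -/
def activeWeights (Φ : ReLUArch d e) : ℕ :=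
  ∑ l ∈ Finset.Icc 1 Φ.depth, ((Φ.maskA l).card + (Φ.maskB l).card)

/-- The admissible weights of an architecture: one real number for each position of the masks. -/
structure Weights (Φ : ReLUArch d e) where
  A : (l : ℕ) → Φ.maskA l → ℝ
  b : (l : ℕ) → Φ.maskB l → ℝ

/-- The `l`-th matrix, lifted from the mask by zero. -/
def Weights.mat {Φ : ReLUArch d e} (θ : Φ.Weights) (l : ℕ) :
    Matrix (Fin (Φ.width l)) (Σ k : Fin l, Fin (Φ.width k)) ℝ :=
  fun i j => if h : (i, j) ∈ Φ.maskA l then θ.A l ⟨(i, j), h⟩ else 0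

/-- The `l`-th bias, lifted from the mask by zero. -/
def Weights.bias {Φ : ReLUArch d e} (θ : Φ.Weights) (l : ℕ) : Fin (Φ.width l) → ℝ :=
  fun i => if h : i ∈ Φ.maskB l then θ.b l ⟨i, h⟩ else 0

/-- The vector computed by layer `l` on the input `x`; the ReLU function acts on all the layers
but the last one. -/
def layer {Φ : ReLUArch d e} (θ : Φ.Weights) (x : Fin d → ℝ) : (l : ℕ) → Fin (Φ.width l) → ℝ
  | 0 => fun i => x (Fin.cast Φ.width_zero i)
  | l + 1 => fun i =>
      let y := ∑ j : (Σ k : Fin (l + 1), Fin (Φ.width k)),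
        θ.mat (l + 1) i j * layer θ x j.1 j.2 + θ.bias (l + 1) i
      if l + 1 = Φ.depth then y else max y 0
termination_by l => l
decreasing_by exact j.1.isLt

/-- The realization of a network. -/
def realize {Φ : ReLUArch d e} (θ : Φ.Weights) (x : Fin d → ℝ) : Fin e → ℝ :=
  fun i => layer θ x Φ.depth (Fin.cast Φ.width_depth.symm i)

end ReLUArch

/-! ### The inner DOD module -/

/-- Architecture of the inner DOD module: a seed network with some output dimension `l`, and `r`
root networks with output dimension `NA`. -/
structure DODArch (p NA r : ℕ) where
  l : ℕ
  seed : ReLUArch (p + 1) l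
  root : Fin r → ReLUArch l NA

namespace DODArch

variable {p NA r : ℕ}

/-- The number of layers: those of the seed followed by those of the deepest root. -/
def layers (Φ : DODArch p NA r) : ℕ :=
  Φ.seed.depth + Finset.univ.sup fun j => (Φ.root j).depth

/-- The number of active weights of the parallelization of the `r` concatenations of a root with
the seed (so the seed counts `r` times). -/
def activeWeights (Φ : DODArch p NA r) : ℕ :=
  ∑ j, ((Φ.root j).activeWeights + Φ.seed.activeWeights)

structure Weights (Φ : DODArch p NA r) where
  seed : Φ.seed.Weights
  root : (j : Fin r) → (Φ.root j).Weights

/-- The stacked output of the root networks, then orthonormalized by the Gram-Schmidt process (the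
orthogonal factor of the QR decomposition); the outputs of the roots are the columns. -/
def realize {Φ : DODArch p NA r} (θ : Φ.Weights) (x : Fin (p + 1) → ℝ) :
    Matrix (Fin NA) (Fin r) ℝ :=
  fun i j => InnerProductSpace.gramSchmidtNormed ℝ
    (fun j : Fin r => WithLp.toLp 2 (ReLUArch.realize (θ.root j) (ReLUArch.realize θ.seed x))) j i

end DODArch

/-! ### The full order problem and the sample -/

/-- The norm of coefficient vectors that belongs to the mass matrix `G`. -/
def gNorm {Nh : ℕ} (G : Matrix (Fin Nh) (Fin Nh) ℝ) (v : Fin Nh → ℝ) : ℝ :=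
  √(v ⬝ᵥ (G *ᵥ v))

/-- Lebesgue measure on `Θ × Θ' × [0, T]`. -/
def domainMeasure {p q : ℕ} (Θ : Set (EuclideanSpace ℝ (Fin p)))
    (Θ' : Set (EuclideanSpace ℝ (Fin q))) (T : ℝ) :
    Measure (EuclideanSpace ℝ (Fin p) × EuclideanSpace ℝ (Fin q) × ℝ) :=
  volume.restrict (Θ ×ˢ Θ' ×ˢ Set.Icc 0 T)

/-- `u` is a parameter-to-solution map: the essential infimum of its norm is `m`, and it is
`L`-Lipschitz. (Its essential supremum is then finite, as the domain is bounded.) -/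
structure IsSolutionMap {p q Nh : ℕ} (Θ : Set (EuclideanSpace ℝ (Fin p)))
    (Θ' : Set (EuclideanSpace ℝ (Fin q))) (T : ℝ) (G : Matrix (Fin Nh) (Fin Nh) ℝ)
    (u : EuclideanSpace ℝ (Fin p) → EuclideanSpace ℝ (Fin q) → ℝ → Fin Nh → ℝ)
    (m L : ℝ) : Prop where
  essInf_eq : essInf (fun x => gNorm G (u x.1 x.2.1 x.2.2)) (domainMeasure Θ Θ' T) = m
  lipschitz : ∀ μ ∈ Θ, ∀ μ' ∈ Θ, ∀ ν ∈ Θ', ∀ ν' ∈ Θ', ∀ t ∈ Set.Icc 0 T, ∀ t' ∈ Set.Icc 0 T,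
    gNorm G (u μ ν t - u μ' ν' t') ≤ L * (‖μ - μ'‖ + ‖ν - ν'‖ + |t - t'|)

/-- The law of `N` independent samples that are uniformly distributed on `Θ'`. -/
def sampleLaw {q : ℕ} (Θ' : Set (EuclideanSpace ℝ (Fin q))) (N : ℕ) :
    Measure (Fin N → EuclideanSpace ℝ (Fin q)) :=
  Measure.pi fun _ => ProbabilityTheory.cond volume Θ'

/-- The correlation matrix `(|Θ'| / N) ∑ j, w j * (w j)ᵀ` of the pre-reduced snapshots
`w j = Aᵀ G u(μ, ν j, t)`, for fixed `(μ, t)`. -/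
def corrMatrix {p q Nh NA N : ℕ} (Θ' : Set (EuclideanSpace ℝ (Fin q)))
    (G : Matrix (Fin Nh) (Fin Nh) ℝ)
    (u : EuclideanSpace ℝ (Fin p) → EuclideanSpace ℝ (Fin q) → ℝ → Fin Nh → ℝ)
    (A : Matrix (Fin Nh) (Fin NA) ℝ) (ν : Fin N → EuclideanSpace ℝ (Fin q))
    (μ : EuclideanSpace ℝ (Fin p)) (t : ℝ) : Matrix (Fin NA) (Fin NA) ℝ :=
  (volume.real Θ' / N) •
    ∑ j, Matrix.vecMulVec (Aᵀ *ᵥ (G *ᵥ u μ (ν j) t)) (Aᵀ *ᵥ (G *ᵥ u μ (ν j) t))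

theorem corrMatrix_isHermitian {p q Nh NA N : ℕ} (Θ' : Set (EuclideanSpace ℝ (Fin q)))
    (G : Matrix (Fin Nh) (Fin Nh) ℝ)
    (u : EuclideanSpace ℝ (Fin p) → EuclideanSpace ℝ (Fin q) → ℝ → Fin Nh → ℝ)
    (A : Matrix (Fin Nh) (Fin NA) ℝ) (ν : Fin N → EuclideanSpace ℝ (Fin q))
    (μ : EuclideanSpace ℝ (Fin p)) (t : ℝ) : (corrMatrix Θ' G u A ν μ t).IsHermitian := by
  ext i j
  simp only [corrMatrix, Matrix.conjTranspose_apply, Matrix.smul_apply, Matrix.sum_apply,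
    Matrix.vecMulVec_apply, star_trivial, mul_comm]

/-- `∑ k > r, σ_k(μ, t)²`: the sum of all but the `r` largest eigenvalues of the correlation
matrix, with multiplicity (`eigenvalues₀` is decreasing and counts from `0`). -/
def eigenTail {p q Nh NA N : ℕ} (Θ' : Set (EuclideanSpace ℝ (Fin q)))
    (G : Matrix (Fin Nh) (Fin Nh) ℝ)
    (u : EuclideanSpace ℝ (Fin p) → EuclideanSpace ℝ (Fin q) → ℝ → Fin Nh → ℝ)
    (A : Matrix (Fin Nh) (Fin NA) ℝ) (ν : Fin N → EuclideanSpace ℝ (Fin q)) (r : ℕ)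
    (μ : EuclideanSpace ℝ (Fin p)) (t : ℝ) : ℝ :=
  ∑ k with r ≤ k.val, (corrMatrix_isHermitian Θ' G u A ν μ t).eigenvalues₀ k

/-- The DOD dimension `N'`: the least `r` for which the eigenvalue tails are at most
`m² ε² / (16 |Θ × [0, T]|)` for all `(μ, t)`. -/
def dodDim {p q Nh NA N : ℕ} (Θ : Set (EuclideanSpace ℝ (Fin p)))
    (Θ' : Set (EuclideanSpace ℝ (Fin q))) (T : ℝ) (G : Matrix (Fin Nh) (Fin Nh) ℝ)
    (u : EuclideanSpace ℝ (Fin p) → EuclideanSpace ℝ (Fin q) → ℝ → Fin Nh → ℝ)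
    (m ε : ℝ) (A : Matrix (Fin Nh) (Fin NA) ℝ) (ν : Fin N → EuclideanSpace ℝ (Fin q)) : ℕ :=
  sInf {r : ℕ | ∀ μ ∈ Θ, ∀ t ∈ Set.Icc 0 T,
    eigenTail Θ' G u A ν r μ t ≤ m ^ 2 / (16 * (volume.real Θ * T)) * ε ^ 2}

/-- The objective DOD functional of the sample,
`(|Θ'| / N) ∑ j, ‖u(μ, ν j, t) - V Vᵀ G u(μ, ν j, t)‖²`. -/
def dodFunctional {p q Nh N r : ℕ} (Θ' : Set (EuclideanSpace ℝ (Fin q)))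
    (G : Matrix (Fin Nh) (Fin Nh) ℝ)
    (u : EuclideanSpace ℝ (Fin p) → EuclideanSpace ℝ (Fin q) → ℝ → Fin Nh → ℝ)
    (ν : Fin N → EuclideanSpace ℝ (Fin q)) (μ : EuclideanSpace ℝ (Fin p)) (t : ℝ)
    (V : Matrix (Fin Nh) (Fin r) ℝ) : ℝ :=
  volume.real Θ' / N *
    ∑ j, gNorm G (u μ (ν j) t - V *ᵥ (Vᵀ *ᵥ (G *ᵥ u μ (ν j) t))) ^ 2

/-- `σ` is an `L̂`-Lipschitz optimal DOD of the sample: for all `(μ, t)`, the matrix `A * σ(μ, t)`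
is `G`-orthonormal, `σ(μ, t)` minimizes the objective DOD functional `W ↦ J(μ, t, A * W)` among
the matrices with entries in `[-1, 1]`, and `σ` is `L̂`-Lipschitz in the Frobenius norm. -/
structure IsLipschitzOptimalDOD {p q Nh NA N r : ℕ} (Θ : Set (EuclideanSpace ℝ (Fin p)))
    (Θ' : Set (EuclideanSpace ℝ (Fin q))) (T : ℝ) (G : Matrix (Fin Nh) (Fin Nh) ℝ)
    (u : EuclideanSpace ℝ (Fin p) → EuclideanSpace ℝ (Fin q) → ℝ → Fin Nh → ℝ)
    (A : Matrix (Fin Nh) (Fin NA) ℝ) (ν : Fin N → EuclideanSpace ℝ (Fin q)) (Lhat : ℝ)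
    (σ : EuclideanSpace ℝ (Fin p) → ℝ → Matrix (Fin NA) (Fin r) ℝ) : Prop where
  orthonormal : ∀ μ ∈ Θ, ∀ t ∈ Set.Icc 0 T, (A * σ μ t)ᵀ * G * (A * σ μ t) = 1
  mem_cube : ∀ μ ∈ Θ, ∀ t ∈ Set.Icc 0 T, ∀ i j, σ μ t i j ∈ Set.Icc (-1) 1
  isMin : ∀ μ ∈ Θ, ∀ t ∈ Set.Icc 0 T, ∀ W : Matrix (Fin NA) (Fin r) ℝ,
    (∀ i j, W i j ∈ Set.Icc (-1) 1) →
      dodFunctional Θ' G u ν μ t (A * σ μ t) ≤ dodFunctional Θ' G u ν μ t (A * W)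
  lipschitz : ∀ μ ∈ Θ, ∀ μ' ∈ Θ, ∀ t ∈ Set.Icc 0 T, ∀ t' ∈ Set.Icc 0 T,
    √(∑ i, ∑ j, (σ μ t i j - σ μ' t' i j) ^ 2) ≤ Lhat * (‖μ - μ'‖ + |t - t'|)

/-- `f` is of class `C^k`, and all its partial derivatives of order at most `k` are bounded by `C`
in the Euclidean norm. -/
def HasBoundedPartials {a b : ℕ} (k : ℕ) (C : ℝ)
    (f : EuclideanSpace ℝ (Fin a) → EuclideanSpace ℝ (Fin b)) : Prop :=
  ContDiff ℝ k f ∧ ∀ i ≤ k, ∀ (α : Fin i → Fin a) (v : EuclideanSpace ℝ (Fin a)),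
    ‖iteratedFDeriv ℝ i f v (fun j => EuclideanSpace.single (α j) 1)‖ ≤ C

/-- `χ` and `χ'` attain a perfect embedding of the reduced solution manifold
`{V(μ, t)ᵀ G u(μ, ν, t)}`, where `V(μ, t) = A * σ(μ, t)`. -/
def IsPerfectEmbedding {p q Nh NA n r : ℕ} (Θ : Set (EuclideanSpace ℝ (Fin p)))
    (Θ' : Set (EuclideanSpace ℝ (Fin q))) (T : ℝ) (G : Matrix (Fin Nh) (Fin Nh) ℝ)
    (u : EuclideanSpace ℝ (Fin p) → EuclideanSpace ℝ (Fin q) → ℝ → Fin Nh → ℝ)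
    (A : Matrix (Fin Nh) (Fin NA) ℝ)
    (σ : EuclideanSpace ℝ (Fin p) → ℝ → Matrix (Fin NA) (Fin r) ℝ)
    (χ : EuclideanSpace ℝ (Fin n) → EuclideanSpace ℝ (Fin r))
    (χ' : EuclideanSpace ℝ (Fin r) → EuclideanSpace ℝ (Fin n)) : Prop :=
  ∀ μ ∈ Θ, ∀ ν ∈ Θ', ∀ t ∈ Set.Icc 0 T,
    χ (χ' (WithLp.toLp 2 ((A * σ μ t)ᵀ *ᵥ (G *ᵥ u μ ν t)))) =
      WithLp.toLp 2 ((A * σ μ t)ᵀ *ᵥ (G *ᵥ u μ ν t))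

/-! ### The DOD-DL-ROM and its error -/

/-- The DOD-DL-ROM map `(μ, ν, t) ↦ A Ṽ(μ, t) (ψ ∘ φ)(μ, ν, t)`. -/
def dodDlRom {p q Nh NA n r : ℕ} (A : Matrix (Fin Nh) (Fin NA) ℝ)
    {ΦV : DODArch p NA r} {Ψ : ReLUArch n r} {Φ : ReLUArch (p + q + 1) n}
    (θV : ΦV.Weights) (θΨ : Ψ.Weights) (θΦ : Φ.Weights)
    (μ : EuclideanSpace ℝ (Fin p)) (ν : EuclideanSpace ℝ (Fin q)) (t : ℝ) : Fin Nh → ℝ :=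
  (A * DODArch.realize θV (Fin.append (fun i => μ i) ![t])) *ᵥ
    ReLUArch.realize θΨ
      (ReLUArch.realize θΦ (Fin.append (Fin.append (fun i => μ i) (fun i => ν i)) ![t]))

/-- The relative error `(∫ ‖u - û‖² / ‖u‖² d(μ, ν, t))^(1/2)` over `Θ × Θ' × [0, T]`, as an
extended non-negative real number. -/
def relativeError {p q Nh : ℕ} (Θ : Set (EuclideanSpace ℝ (Fin p)))
    (Θ' : Set (EuclideanSpace ℝ (Fin q))) (T : ℝ) (G : Matrix (Fin Nh) (Fin Nh) ℝ)
    (u uhat : EuclideanSpace ℝ (Fin p) → EuclideanSpace ℝ (Fin q) → ℝ → Fin Nh → ℝ) : ℝ≥0∞ :=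
  (∫⁻ x, ENNReal.ofReal (gNorm G (u x.1 x.2.1 x.2.2 - uhat x.1 x.2.1 x.2.2) ^ 2 /
    gNorm G (u x.1 x.2.1 x.2.2) ^ 2) ∂(domainMeasure Θ Θ' T)) ^ (1 / 2 : ℝ)

end

/-!
The networks read off tables, and the decoder carries the regularity of `χ`.

Cut the parameter box into cells of width `O(ε)`. In the coordinates of the basis `A`, the snapshot
and the optimal DOD `σ` are Lipschitz, so that they may be replaced by their values at a
representative of the cell, with an error `O(ε)`. A ReLU network computes the index of the cell by
ramps (`rampIdx`); it is exact except where a coordinate lies in one of finitely many intervals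
whose width is free (`rampIdx_eq_cellIdx`). The measure of this exceptional set tends to zero with
the width, while the outputs of all networks stay bounded independently of it, so the set
contributes as little to the error as is wished (`exists_measure_Ioo_preimage_le`,
`relativeError_lt`).

The seed computes the index of the cell of `(μ, t)`, and the roots are tables of the columns of `σ`
at the representatives (`lookup`). These columns are orthonormal, and so the Gram-Schmidt process
returns them unchanged (`lookupDOD_exists_weights`). For the reduced coordinates, the feedforward
network maps the cell of `(μ, ν, t)` to a real number which encodes the point
`χ' (Vᵀ G u)`: the index of a cell of width `O(ε ^ (1 / (s - 1)))` around it, and `O(log ε⁻¹)` binary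
digits of each monomial of degree less than `s - 1` in its position within the cell. The decoder
extracts these data bit by bit, and multiplies the monomials by Taylor coefficients of `χ`, which it
looks up by the index of the cell (`HasBoundedPartials.exists_decoder`,
`HasBoundedPartials.exists_reduced_weights`). As `χ (χ' w) = w` on the reduced manifold, this
returns the coordinates `Vᵀ G u` up to `O(ε)`. The architectures depend on `N'` and on the numbers
of cells and digits only. The number of digits is the only source of logarithmic factors; elsewhere
`log ε⁻¹` merely absorbs constants, as it is bounded away from zero (`exists_architecture_size`).

What remains is the projection error of the optimal DOD. Its mean over the sample is bounded by the
eigenvalue tail of the correlation matrix, since the leading eigenvectors are competitors in the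
minimization (`IsLipschitzOptimalDOD.mean_projResidual_le`). The integral over `Θ'` exceeds this
mean by as little as is wished, simultaneously for all `(μ, t)`, all `A` and all `σ`: by Chebyshev's
inequality, there is one event of large probability on which no cell of a fine partition of `Θ'` is
sampled much less often than expected, and this suffices for all functions with given bound and
Lipschitz constant (`exists_sample_event`).
-/

/-! ### Fully connected networks -/

/-- An affine functional of a real vector. -/
def IsAffineFun {ι : Type} [Fintype ι] (f : (ι → ℝ) → ℝ) : Prop :=
  ∃ (c : ι → ℝ) (b : ℝ), ∀ x, f x = ∑ j, c j * x j + b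

namespace IsAffineFun

variable {ι : Type} [Fintype ι]

theorem const (b : ℝ) : IsAffineFun (fun _ : ι → ℝ => b) :=
  ⟨0, b, fun x => by simp⟩

theorem coord (i : ι) : IsAffineFun (fun x : ι → ℝ => x i) := by
  classical
  exact ⟨Pi.single i 1, 0, fun x => by simp [Pi.single_apply]⟩

theorem add {f g : (ι → ℝ) → ℝ} (hf : IsAffineFun f) (hg : IsAffineFun g) :
    IsAffineFun (fun x => f x + g x) := by
  obtain ⟨c, b, h⟩ := hf
  obtain ⟨c', b', h'⟩ := hg
  refine ⟨c + c', b + b', fun x => ?_⟩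
  simp only [h, h', Pi.add_apply, add_mul, Finset.sum_add_distrib]
  ring

theorem const_mul {f : (ι → ℝ) → ℝ} (a : ℝ) (hf : IsAffineFun f) :
    IsAffineFun (fun x => a * f x) := by
  obtain ⟨c, b, h⟩ := hf
  refine ⟨a • c, a * b, fun x => ?_⟩
  simp only [h, Pi.smul_apply, smul_eq_mul, mul_add, Finset.mul_sum, mul_assoc]

theorem mul_const {f : (ι → ℝ) → ℝ} (hf : IsAffineFun f) (a : ℝ) :
    IsAffineFun (fun x => f x * a) := by
  simpa only [mul_comm] using hf.const_mul a

theorem sub {f g : (ι → ℝ) → ℝ} (hf : IsAffineFun f) (hg : IsAffineFun g) :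
    IsAffineFun (fun x => f x - g x) := by
  simpa [sub_eq_add_neg] using hf.add (hg.const_mul (-1))

theorem sum {α : Type} (s : Finset α) {f : α → (ι → ℝ) → ℝ} (hf : ∀ a, IsAffineFun (f a)) :
    IsAffineFun (fun x => ∑ a ∈ s, f a x) := by
  classical
  induction s using Finset.induction_on with
  | empty => simpa using const 0
  | insert a s ha ih => simpa only [Finset.sum_insert ha] using (hf a).add ih

theorem comp {η : Type} [Fintype η] {f : (η → ℝ) → ℝ} (hf : IsAffineFun f)
    {a : (ι → ℝ) → η → ℝ} (ha : ∀ i, IsAffineFun (fun x => a x i)) :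
    IsAffineFun (fun x => f (a x)) := by
  obtain ⟨c, b, h⟩ := hf
  simp only [h]
  exact (sum _ fun j => (ha j).const_mul (c j)).add (const b)

theorem continuous {f : (ι → ℝ) → ℝ} (hf : IsAffineFun f) : Continuous f := by
  obtain ⟨c, b, h⟩ := hf
  rw [funext h]
  fun_prop

end IsAffineFun

/-- `f` is the realization of a fully connected ReLU network in which every layer reads the
preceding one only and whose hidden layers have the widths `hs`. The neurons of a layer are indexed
by an arbitrary finite type. -/
def IsMLP : List ℕ → {ι κ : Type} → [Fintype ι] → ((ι → ℝ) → κ → ℝ) → Prop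
  | [], _, _, _, f => ∀ i, IsAffineFun (fun x => f x i)
  | h :: hs, ι, κ, _, f =>
    ∃ (η : Type) (_ : Fintype η) (a : (ι → ℝ) → η → ℝ) (g : (η → ℝ) → κ → ℝ),
      Fintype.card η = h ∧ (∀ i, IsAffineFun (fun x => a x i)) ∧ IsMLP hs g ∧
        ∀ x, f x = g (fun i => max (a x i) 0)

namespace IsMLP

variable {ι κ η : Type} [Fintype ι] [Fintype η]

theorem comp_affine {hs : List ℕ} {f : (η → ℝ) → κ → ℝ} (hf : IsMLP hs f)
    {a : (ι → ℝ) → η → ℝ} (ha : ∀ i, IsAffineFun (fun x => a x i)) :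
    IsMLP hs (fun x => f (a x)) := by
  cases hs with
  | nil => exact fun i => (hf i).comp ha
  | cons h hs =>
    obtain ⟨ξ, _, b, g, hc, hb, hg, h⟩ := hf
    exact ⟨ξ, _, fun x => b (a x), g, hc, fun i => (hb i).comp ha, hg, fun x => h _⟩

theorem continuous {hs : List ℕ} {f : (ι → ℝ) → κ → ℝ} (hf : IsMLP hs f) : Continuous f := by
  induction hs generalizing ι with
  | nil => exact continuous_pi fun i => (hf i).continuous
  | cons h hs ih =>
    obtain ⟨ξ, _, a, g, -, ha, hg, h⟩ := hf
    rw [funext h]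
    exact (ih hg).comp (continuous_pi fun i => (ha i).continuous.max continuous_const)

end IsMLP

/-- The width of layer `l` of the network with input dimension `d`, hidden widths `hs` and output
dimension `e`. -/
abbrev mlpWidth (d : ℕ) (hs : List ℕ) (e : ℕ) (l : ℕ) : ℕ :=
  match l with
  | 0 => d
  | l + 1 => match hs with
    | [] => e
    | h :: hs => mlpWidth h hs e l

theorem mlpWidth_length (d : ℕ) (hs : List ℕ) (e : ℕ) : mlpWidth d hs e (hs.length + 1) = e := by
  induction hs generalizing d with
  | nil => rfl
  | cons h hs ih => exact ih h

/-- The fully connected architecture with input dimension `d`, hidden widths `hs` and output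
dimension `e`, without skip connections. -/
abbrev mlpArch (d : ℕ) (hs : List ℕ) (e : ℕ) : ReLUArch d e where
  depth := hs.length + 1
  depth_pos := Nat.succ_pos _
  width := mlpWidth d hs e
  width_zero := rfl
  width_depth := mlpWidth_length d hs e
  maskA
    | 0 => ∅
    | l + 1 => Finset.univ.image
        fun ij : Fin (mlpWidth d hs e (l + 1)) × Fin (mlpWidth d hs e l) =>
          (ij.1, ⟨Fin.last l, ij.2⟩)
  maskB _ := Finset.univ

/-- The number of entries of the matrices and of the biases of `mlpArch d hs e`. -/
def mlpCount : ℕ → List ℕ → ℕ → ℕ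
  | d, [], e => e * d + e
  | d, h :: hs, e => (h * d + h) + mlpCount h hs e

theorem sum_mlpWidth (d : ℕ) (hs : List ℕ) (e : ℕ) :
    ∑ l ∈ Finset.range (hs.length + 1),
      (mlpWidth d hs e (l + 1) * mlpWidth d hs e l + mlpWidth d hs e (l + 1)) =
        mlpCount d hs e := by
  induction hs generalizing d with
  | nil => simp [mlpWidth, mlpCount]
  | cons h hs ih =>
    rw [List.length_cons, Finset.sum_range_succ', mlpCount, ← ih h, add_comm]

theorem mlpArch_activeWeights_le (d : ℕ) (hs : List ℕ) (e : ℕ) :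
    (mlpArch d hs e).activeWeights ≤ mlpCount d hs e := by
  have hI : ∀ k : ℕ, Finset.Icc 1 k = Finset.Ico (0 + 1) (k + 1) := fun k => by ext; simp
  rw [← sum_mlpWidth, ReLUArch.activeWeights, hI, ← Finset.sum_Ico_add', Finset.range_eq_Ico]
  refine Finset.sum_le_sum fun l _ => Nat.add_le_add ?_ ?_
  · refine Finset.card_image_le.trans (le_of_eq ?_)
    simp
  · exact (Finset.card_le_univ _).trans (le_of_eq (Fintype.card_fin _))

/-- The hidden layer `l` of a fully connected network, without the exception for the output
layer. -/
def denseHidden {w : ℕ → ℕ} (M : ∀ l, Matrix (Fin (w (l + 1))) (Fin (w l)) ℝ)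
    (b : ∀ l, Fin (w (l + 1)) → ℝ) (x : Fin (w 0) → ℝ) : (l : ℕ) → Fin (w l) → ℝ
  | 0 => x
  | l + 1 => fun i => max (∑ j, M l i j * denseHidden M b x l j + b l i) 0

theorem denseHidden_succ {w : ℕ → ℕ} (M : ∀ l, Matrix (Fin (w (l + 1))) (Fin (w l)) ℝ)
    (b : ∀ l, Fin (w (l + 1)) → ℝ) (x : Fin (w 0) → ℝ) (l : ℕ) :
    denseHidden M b x (l + 1) = denseHidden (w := fun l => w (l + 1)) (fun l => M (l + 1))
      (fun l => b (l + 1)) (denseHidden M b x 1) l := by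
  induction l with
  | zero => rfl
  | succ l ih =>
    rw [denseHidden, ih]
    rfl

theorem IsMLP.exists_dense {ι κ : Type} [Fintype ι] {hs : List ℕ} {f : (ι → ℝ) → κ → ℝ}
    (hf : IsMLP hs f) {d e : ℕ} (eι : ι ≃ Fin d) (eκ : Fin e ≃ κ) :
    ∃ (M : ∀ l, Matrix (Fin (mlpWidth d hs e (l + 1))) (Fin (mlpWidth d hs e l)) ℝ)
      (b : ∀ l, Fin (mlpWidth d hs e (l + 1)) → ℝ),
      ∀ (x : Fin d → ℝ) (i : Fin (mlpWidth d hs e (hs.length + 1))),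
        ∑ j, M hs.length i j * denseHidden M b x hs.length j + b hs.length i =
          f (fun j => x (eι j)) (eκ (Fin.cast (mlpWidth_length d hs e) i)) := by
  induction hs generalizing d ι with
  | nil =>
    choose c b h using hf
    refine ⟨fun l => match l with
      | 0 => fun i j => c (eκ i) (eι.symm j)
      | l + 1 => 0, fun l => match l with
      | 0 => fun i => b (eκ i)
      | l + 1 => 0, fun x i => ?_⟩
    refine Eq.trans ?_ (h _ _).symm
    refine congrArg₂ (· + ·) ?_ rfl
    refine Fintype.sum_equiv eι.symm _ _ fun j => ?_
    change c (eκ i) (eι.symm j) * x j = _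
    simp only [Equiv.apply_symm_apply]
    rfl
  | cons h hs ih =>
    obtain ⟨η, _, a, g, hc, ha, hg, hfg⟩ := hf
    choose c b h' using ha
    let eη : η ≃ Fin h := Fintype.equivFinOfCardEq hc
    obtain ⟨M', b', hM⟩ := ih hg eη
    refine ⟨fun l => match l with
      | 0 => fun i j => c (eη.symm i) (eι.symm j)
      | l + 1 => M' l, fun l => match l with
      | 0 => fun i => b (eη.symm i)
      | l + 1 => b' l, fun x i => ?_⟩
    rw [hfg]
    have key := hM (fun i => max (a (fun j => x (eι j)) (eη.symm i)) 0) i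
    simp only [Equiv.symm_apply_apply] at key
    refine Eq.trans ?_ key
    refine congrArg₂ (· + ·) (Finset.sum_congr rfl fun j _ => congrArg (M' hs.length i j * ·) ?_) rfl
    refine (congrFun (denseHidden_succ _ _ x hs.length) j).trans ?_
    have hx : denseHidden (w := mlpWidth d (h :: hs) e) (fun l => match l with
      | 0 => fun i j => c (eη.symm i) (eι.symm j)
      | l + 1 => M' l) (fun l => match l with
      | 0 => fun i => b (eη.symm i)
      | l + 1 => b' l) x 1 = fun i => max (a (fun j => x (eι j)) (eη.symm i)) 0 := by
      funext k
      refine Eq.trans ?_ (congrArg (max · 0) (h' _ _).symm)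
      change max (∑ j, c (eη.symm k) (eι.symm j) * x j + b (eη.symm k)) 0 = _
      congr 2
      exact Fintype.sum_equiv eι.symm _ _ fun j => by simp
    rw [hx]

/-- Every fully connected network is realized by the weights of `mlpArch`. -/
theorem IsMLP.exists_weights {ι κ : Type} [Fintype ι] {hs : List ℕ} {f : (ι → ℝ) → κ → ℝ}
    (hf : IsMLP hs f) {d e : ℕ} (eι : ι ≃ Fin d) (eκ : Fin e ≃ κ) :
    ∃ θ : (mlpArch d hs e).Weights, ∀ (x : Fin d → ℝ) (i : Fin e),
      ReLUArch.realize θ x i = f (fun j => x (eι j)) (eκ i) := by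
  obtain ⟨M, b, h⟩ := hf.exists_dense eι eκ
  let row (l : ℕ) (i : Fin (mlpWidth d hs e (l + 1))) (k : Fin (l + 1)) :
      Fin (mlpWidth d hs e k) → ℝ :=
    Fin.lastCases (motive := fun k : Fin (l + 1) => Fin (mlpWidth d hs e k) → ℝ) (M l i)
      (fun _ _ => 0) k
  let θ : (mlpArch d hs e).Weights :=
    { A := fun l => match l with
        | 0 => fun _ => 0
        | l + 1 => fun ij => row l ij.1.1 ij.1.2.1 ij.1.2.2
      b := fun l => match l with
        | 0 => fun _ => 0
        | l + 1 => fun i => b l i.1 }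
  have hmat : ∀ (l : ℕ) (i : Fin (mlpWidth d hs e (l + 1)))
      (v : ∀ k, Fin (mlpWidth d hs e k) → ℝ),
      ∑ j : (Σ k : Fin (l + 1), Fin (mlpWidth d hs e k)), θ.mat (l + 1) i j * v j.1 j.2 =
        ∑ j, M l i j * v l j := by
    intro l i v
    rw [Fintype.sum_sigma, Fin.sum_univ_castSucc]
    have hlast : ∀ j, θ.mat (l + 1) i ⟨Fin.last l, j⟩ = M l i j := by
      intro j
      have hmem : (i, (⟨Fin.last l, j⟩ : Σ k : Fin (l + 1), Fin (mlpWidth d hs e k))) ∈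
          (mlpArch d hs e).maskA (l + 1) :=
        Finset.mem_image.2 ⟨(i, j), Finset.mem_univ _, rfl⟩
      refine (dif_pos hmem).trans ?_
      change row l i (Fin.last l) j = _
      simp only [row, Fin.lastCases_last]
    have hrest : ∀ (k : Fin l) (j), θ.mat (l + 1) i ⟨k.castSucc, j⟩ = 0 := by
      intro k j
      unfold ReLUArch.Weights.mat
      split_ifs with hk
      · change row l i k.castSucc j = _
        simp only [row, Fin.lastCases_castSucc]
      · rfl
    simp only [hlast, hrest, zero_mul, Finset.sum_const_zero, zero_add]
    rfl
  have hbias : ∀ (l : ℕ) (i : Fin (mlpWidth d hs e (l + 1))), θ.bias (l + 1) i = b l i :=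
    fun l i => dif_pos (Finset.mem_univ _)
  have hlayer : ∀ (x : Fin d → ℝ) (l : ℕ), l < hs.length + 1 →
      ReLUArch.layer θ x l = denseHidden M b x l := by
    intro x l
    induction l with
    | zero =>
      intro _
      rw [ReLUArch.layer]
      rfl
    | succ l ih =>
      intro hl
      rw [ReLUArch.layer]
      funext i
      have hne : ¬ (l + 1 = (mlpArch d hs e).depth) := hl.ne
      simp only [if_neg hne]
      rw [hbias, hmat l i (ReLUArch.layer θ x), ih (by omega)]
      rfl
  refine ⟨θ, fun x i => ?_⟩
  have key := h x (Fin.cast (mlpWidth_length d hs e).symm i)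
  rw [Fin.cast_cast, Fin.cast_eq_self] at key
  rw [← key]
  change ReLUArch.layer θ x (hs.length + 1) _ = _
  rw [ReLUArch.layer]
  refine (if_pos rfl).trans ?_
  rw [hbias, hmat hs.length _ (ReLUArch.layer θ x), hlayer x hs.length (Nat.lt_succ_self _)]

/-! ### Grid cells and their approximate index -/

/-- The position of `y ∈ [-R, R]` in units of the width of one of `K + 1` equal cells. -/
noncomputable def gridPos (K : ℕ) (R y : ℝ) : ℝ := (y + R) * (K + 1) / (2 * R)

/-- The number of the cell that contains `y`, among the `K + 1` equal cells of `[-R, R]`. -/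
noncomputable def cellCoord (K : ℕ) (R y : ℝ) : Fin (K + 1) :=
  ⟨min K ⌊gridPos K R y⌋₊, Nat.lt_succ_of_le (min_le_left _ _)⟩

/-- The number of the cell that contains `x`, among the `(K + 1) ^ d` cells of `[-R, R]^d`. -/
noncomputable def cellIdx {d : ℕ} (K : ℕ) (R : ℝ) (x : Fin d → ℝ) : Fin ((K + 1) ^ d) :=
  finFunctionFinEquiv fun i => cellCoord K R (x i)

/-- A continuous piecewise linear function that agrees with the indicator function of `[0, ∞)`
outside of `(-τ, 0)`. -/
noncomputable def ramp (τ y : ℝ) : ℝ := max (y / τ + 1) 0 - max (y / τ) 0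

/-- `cellIdx`, with the jumps replaced by ramps of width `τ`. -/
noncomputable def rampIdx {d : ℕ} (K : ℕ) (R τ : ℝ) (x : Fin d → ℝ) : ℝ :=
  ∑ i, (∑ k : Fin K, ramp τ (gridPos K R (x i) - (k + 1))) * ((K : ℝ) + 1) ^ (i : ℕ)

theorem ramp_nonneg (τ y : ℝ) : 0 ≤ ramp τ y :=
  sub_nonneg.2 (max_le_max_right _ (by linarith))

theorem ramp_le_one (τ y : ℝ) : ramp τ y ≤ 1 := by
  unfold ramp
  rcases max_cases (y / τ + 1) 0 with h | h <;> rcases max_cases (y / τ) 0 with h' | h' <;> linarith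

theorem ramp_of_nonneg {τ y : ℝ} (hτ : 0 < τ) (hy : 0 ≤ y) : ramp τ y = 1 := by
  have : 0 ≤ y / τ := by positivity
  rw [ramp, max_eq_left this, max_eq_left (by linarith)]
  ring

theorem ramp_of_le {τ y : ℝ} (hτ : 0 < τ) (hy : y ≤ -τ) : ramp τ y = 0 := by
  have : y / τ ≤ -1 := by
    rw [div_le_iff₀ hτ]
    linarith
  rw [ramp, max_eq_right (by linarith), max_eq_right (by linarith), sub_zero]

theorem cellCoord_eq_sum (K : ℕ) (R y : ℝ) :
    ((cellCoord K R y : ℕ) : ℝ) = ∑ k : Fin K, if (0 : ℝ) ≤ gridPos K R y - (k + 1) then 1 else 0 := by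
  rw [Fin.sum_univ_eq_sum_range (fun k : ℕ => if (0 : ℝ) ≤ gridPos K R y - (k + 1) then (1 : ℝ) else 0),
    Finset.sum_boole]
  have : (Finset.range K).filter (fun k : ℕ => (0 : ℝ) ≤ gridPos K R y - (k + 1)) =
      Finset.range (min K ⌊gridPos K R y⌋₊) := by
    ext k
    simp only [Finset.mem_filter, Finset.mem_range, lt_min_iff, sub_nonneg]
    refine and_congr_right fun _ => ?_
    rw [← Nat.succ_le_iff, Nat.le_floor_iff' (Nat.succ_ne_zero k)]
    push_cast
    rfl
  rw [this, Finset.card_range]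
  rfl

theorem gridPos_mem {K : ℕ} {R y : ℝ} (hR : 0 < R) (hy : |y| ≤ R) :
    gridPos K R y ∈ Set.Icc 0 ((K : ℝ) + 1) := by
  rw [abs_le] at hy
  have hK : (0 : ℝ) ≤ K := K.cast_nonneg
  constructor
  · exact div_nonneg (mul_nonneg (by linarith) (by linarith)) (by linarith)
  · rw [gridPos, div_le_iff₀ (by linarith)]
    nlinarith

theorem gridPos_sub_cellCoord_mem {K : ℕ} {R y : ℝ} (hR : 0 < R) (hy : |y| ≤ R) :
    gridPos K R y - (cellCoord K R y : ℕ) ∈ Set.Icc (0 : ℝ) 1 := by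
  obtain ⟨h0, h1⟩ := gridPos_mem (K := K) hR hy
  have hf := Nat.floor_le h0
  have hf' := Nat.lt_floor_add_one (gridPos K R y)
  change gridPos K R y - (min K ⌊gridPos K R y⌋₊ : ℕ) ∈ _
  rcases le_total K ⌊gridPos K R y⌋₊ with h | h
  · rw [min_eq_left h]
    have : (K : ℝ) ≤ ⌊gridPos K R y⌋₊ := by exact_mod_cast h
    exact ⟨by linarith, by linarith⟩
  · rw [min_eq_right h]
    exact ⟨by linarith, by linarith⟩

theorem abs_sub_le_of_cellIdx_eq {d K : ℕ} {R : ℝ} (hR : 0 < R) {x y : Fin d → ℝ}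
    (hx : ∀ i, |x i| ≤ R) (hy : ∀ i, |y i| ≤ R) (h : cellIdx K R x = cellIdx K R y) (i : Fin d) :
    |x i - y i| ≤ 2 * R / (K + 1) := by
  have hi : cellCoord K R (x i) = cellCoord K R (y i) :=
    congrFun (finFunctionFinEquiv.injective h) i
  obtain ⟨h1, h2⟩ := gridPos_sub_cellCoord_mem (K := K) hR (hx i)
  obtain ⟨h3, h4⟩ := gridPos_sub_cellCoord_mem (K := K) hR (hy i)
  rw [hi] at h1 h2
  have hK : (0 : ℝ) < K + 1 := by positivity
  have key : x i - y i = (gridPos K R (x i) - gridPos K R (y i)) * (2 * R / (K + 1)) := by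
    simp only [gridPos]
    field_simp
    ring
  have hh : 0 ≤ 2 * R / (K + 1) := by positivity
  rw [key, abs_mul, abs_of_nonneg hh]
  exact mul_le_of_le_one_left hh (abs_le.2 ⟨by linarith, by linarith⟩)

theorem rampIdx_nonneg {d : ℕ} (K : ℕ) (R τ : ℝ) (x : Fin d → ℝ) : 0 ≤ rampIdx K R τ x :=
  Finset.sum_nonneg fun _ _ => mul_nonneg (Finset.sum_nonneg fun _ _ => ramp_nonneg _ _)
    (by positivity)

theorem rampIdx_le {d : ℕ} (K : ℕ) (R τ : ℝ) (x : Fin d → ℝ) :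
    rampIdx K R τ x ≤ ∑ i : Fin d, (K : ℝ) * ((K : ℝ) + 1) ^ (i : ℕ) := by
  refine Finset.sum_le_sum fun i _ => mul_le_mul_of_nonneg_right ?_ (by positivity)
  refine (Finset.sum_le_sum fun k _ => ramp_le_one _ _).trans (le_of_eq ?_)
  simp

theorem rampIdx_eq_cellIdx {d K : ℕ} {R τ : ℝ} (hτ : 0 < τ) {x : Fin d → ℝ}
    (h : ∀ (i : Fin d) (k : Fin K), gridPos K R (x i) - (k + 1) ∉ Set.Ioo (-τ) 0) :
    rampIdx K R τ x = (cellIdx K R x : ℕ) := by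
  rw [cellIdx, finFunctionFinEquiv_apply]
  push_cast
  refine Finset.sum_congr rfl fun i _ => ?_
  rw [cellCoord_eq_sum]
  congr 1
  refine Finset.sum_congr rfl fun k _ => ?_
  split_ifs with h0
  · exact ramp_of_nonneg hτ h0
  · refine ramp_of_le hτ (not_lt.1 fun hlt => h i k ⟨hlt, not_le.1 h0⟩)

theorem isMLP_rampIdx (d K : ℕ) (R τ : ℝ) :
    IsMLP [2 * (d * K)] (fun (x : Fin d → ℝ) (_ : Fin 1) => rampIdx K R τ x) := by
  refine ⟨(Fin d × Fin K) ⊕ (Fin d × Fin K), inferInstance,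
    fun x => Sum.elim (fun ik => (gridPos K R (x ik.1) - (ik.2 + 1)) / τ + 1)
      (fun ik => (gridPos K R (x ik.1) - (ik.2 + 1)) / τ),
    fun y _ => ∑ i, (∑ k, (y (Sum.inl (i, k)) - y (Sum.inr (i, k)))) * ((K : ℝ) + 1) ^ (i : ℕ),
    by simp [two_mul], ?_, ?_, fun x => rfl⟩
  · have hg : ∀ ik : Fin d × Fin K, IsAffineFun
        (fun x : Fin d → ℝ => (gridPos K R (x ik.1) - (ik.2 + 1)) / τ) := fun ik =>
      (((((IsAffineFun.coord ik.1).add (.const R)).mul_const _).mul_const (2 * R)⁻¹).sub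
        (.const _)).mul_const τ⁻¹
    rintro (ik | ik)
    · exact (hg ik).add (.const 1)
    · exact hg ik
  · exact fun _ => .sum _ fun i =>
      (IsAffineFun.sum _ fun k => (IsAffineFun.coord _).sub (.coord _)).mul_const _

/-! ### Look-up tables -/

/-- The piecewise linear interpolation of the values `f 0, …, f M` at the points `0, …, M`. -/
noncomputable def lookup {κ : Type} (M : ℕ) (f : ℕ → κ → ℝ) (y : ℝ) : κ → ℝ := fun i =>
  f 0 i + ∑ b : Fin M, (f (b + 1) i - f b i) * (max (y - b) 0 - max (y - b - 1) 0)

theorem lookup_add {κ : Type} {M : ℕ} (f : ℕ → κ → ℝ) {j : ℕ} (hj : j < M) {θ : ℝ}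
    (h0 : 0 ≤ θ) (h1 : θ ≤ 1) (i : κ) :
    lookup M f (j + θ) i = f j i + θ * (f (j + 1) i - f j i) := by
  have hsum : ∀ m : ℕ, ∑ b ∈ Finset.range m,
      (f (b + 1) i - f b i) * (max ((j : ℝ) + θ - b) 0 - max ((j : ℝ) + θ - b - 1) 0) =
      if m ≤ j then f m i - f 0 i else f j i - f 0 i + θ * (f (j + 1) i - f j i) := by
    intro m
    induction m with
    | zero => simp
    | succ m ih =>
      rw [Finset.sum_range_succ, ih]
      rcases lt_trichotomy m j with h | h | h
      · have : (m : ℝ) + 1 ≤ j := by exact_mod_cast h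
        rw [if_pos h.le, if_pos (Nat.succ_le_of_lt h), max_eq_left (by linarith),
          max_eq_left (by linarith)]
        ring
      · subst h
        rw [if_pos le_rfl, if_neg (by omega), max_eq_left (by linarith),
          max_eq_right (by linarith)]
        ring
      · have : (j : ℝ) + 1 ≤ m := by exact_mod_cast h
        rw [if_neg (by omega), if_neg (by omega), max_eq_right (by linarith),
          max_eq_right (by linarith)]
        ring
  rw [lookup, Fin.sum_univ_eq_sum_range (fun b : ℕ =>
    (f (b + 1) i - f b i) * (max ((j : ℝ) + θ - b) 0 - max ((j : ℝ) + θ - b - 1) 0)), hsum,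
    if_neg (by omega)]
  ring

theorem lookup_natCast {κ : Type} {M : ℕ} (f : ℕ → κ → ℝ) {j : ℕ} (hj : j < M) :
    lookup M f j = f j := by
  funext i
  simpa using lookup_add f hj le_rfl zero_le_one i

theorem isMLP_sum_lookup {A κ : Type} [Fintype A] (M : ℕ) (f : A → ℕ → κ → ℝ) :
    IsMLP [2 * (Fintype.card A * M)] (fun (v : A → ℝ) i => ∑ a, lookup M (f a) (v a) i) := by
  refine ⟨(A × Fin M) ⊕ (A × Fin M), inferInstance,
    fun v => Sum.elim (fun ab => v ab.1 - ab.2) (fun ab => v ab.1 - ab.2 - 1),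
    fun y i => ∑ a, (f a 0 i + ∑ b : Fin M, (f a (b + 1) i - f a b i) *
      (y (Sum.inl (a, b)) - y (Sum.inr (a, b)))),
    by simp [two_mul], ?_, ?_, fun x => rfl⟩
  · rintro (ab | ab)
    · exact (IsAffineFun.coord _).sub (.const _)
    · exact ((IsAffineFun.coord _).sub (.const _)).sub (.const _)
  · exact fun i => .sum _ fun a => (IsAffineFun.const _).add
      (.sum _ fun b => ((IsAffineFun.coord _).sub (.coord _)).const_mul _)

theorem isMLP_lookup {κ : Type} (M : ℕ) (f : ℕ → κ → ℝ) :
    IsMLP [2 * M] (fun (y : Fin 1 → ℝ) => lookup M f (y 0)) := by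
  simpa using isMLP_sum_lookup (A := Fin 1) M (fun _ => f)

theorem continuous_lookup {κ : Type} (M : ℕ) (f : ℕ → κ → ℝ) : Continuous (lookup M f) := by
  unfold lookup
  fun_prop

theorem isMLP_lookup_rampIdx {κ : Type} (d K : ℕ) (R τ : ℝ) (M : ℕ) (f : ℕ → κ → ℝ) :
    IsMLP [2 * (d * K), 1, 2 * M] (fun x : Fin d → ℝ => lookup M f (rampIdx K R τ x)) := by
  obtain ⟨η, _, a, g, hc, ha, hg, h⟩ := isMLP_rampIdx d K R τ
  refine ⟨η, _, a, fun y => lookup M f (max (g y 0) 0), hc, ha, ?_, fun x => ?_⟩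
  · exact ⟨Fin 1, inferInstance, g, fun y => lookup M f (y 0), rfl, hg, isMLP_lookup M f,
      fun _ => rfl⟩
  · have h0 : rampIdx K R τ x = g (fun i => max (a x i) 0) 0 := congrFun (h x) 0
    change lookup M f (rampIdx K R τ x) = lookup M f (max (g (fun i => max (a x i) 0) 0) 0)
    rw [← h0, max_eq_left (rampIdx_nonneg K R τ x)]

/-! ### Bit extraction -/

theorem sum_bits_lt (β : ℕ → ℕ) (hβ : ∀ i, β i ≤ 1) (Q : ℕ) :
    ∑ i ∈ Finset.range Q, β i * 2 ^ i < 2 ^ Q := by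
  induction Q with
  | zero => simp
  | succ Q ih =>
    rw [Finset.sum_range_succ, pow_succ]
    have : β Q * 2 ^ Q ≤ 2 ^ Q := by simpa using Nat.mul_le_mul_right (2 ^ Q) (hβ Q)
    omega

/-- A network of depth `Q` and constant width reads the `Q` binary digits of an integer one after
the other, starting with the leading one, and adds up prescribed nonnegative multiples of them. -/
theorem IsMLP.exists_bitDecode {A κ : Type} [Fintype A] {hs : List ℕ}
    {F : (A ⊕ Unit → ℝ) → κ → ℝ} (hF : IsMLP hs F) (w : A → ℕ → ℝ) (hw : ∀ a i, 0 ≤ w a i)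
    (Q : ℕ) :
    ∃ G : (A ⊕ Unit → ℝ) → κ → ℝ,
      IsMLP (List.replicate Q (Fintype.card A + 3) ++ hs) G ∧
      ∀ (β : ℕ → ℕ), (∀ i, β i ≤ 1) → ∀ acc : A → ℝ, (∀ a, 0 ≤ acc a) →
        G (Sum.elim acc fun _ => ((∑ i ∈ Finset.range Q, β i * 2 ^ i : ℕ) : ℝ)) =
          F (Sum.elim (fun a => acc a + ∑ i ∈ Finset.range Q, w a i * β i) fun _ => 0) := by
  induction Q with
  | zero =>
    refine ⟨F, hF, fun β _ acc _ => ?_⟩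
    simp
  | succ Q ih =>
    obtain ⟨G, hG, hGF⟩ := ih
    -- The neurons of a layer hold the accumulators, the integer `t`, and two ramps whose difference
    -- is the leading digit of `t`.
    refine ⟨fun x => G (fun s : A ⊕ Unit => Sum.elim
        (fun a => max (x (Sum.inl a)) 0 + w a Q *
          (max (x (Sum.inr ()) - 2 ^ Q + 1) 0 - max (x (Sum.inr ()) - 2 ^ Q) 0))
        (fun _ => max (x (Sum.inr ())) 0 - 2 ^ Q *
          (max (x (Sum.inr ()) - 2 ^ Q + 1) 0 - max (x (Sum.inr ()) - 2 ^ Q) 0)) s), ?_, ?_⟩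
    · refine ⟨A ⊕ Fin 3, inferInstance, fun x => Sum.elim (fun a => x (Sum.inl a))
        ![x (Sum.inr ()), x (Sum.inr ()) - 2 ^ Q + 1, x (Sum.inr ()) - 2 ^ Q],
        fun y => G (fun s : A ⊕ Unit => Sum.elim
          (fun a => y (Sum.inl a) + w a Q * (y (Sum.inr 1) - y (Sum.inr 2)))
          (fun _ => y (Sum.inr 0) - 2 ^ Q * (y (Sum.inr 1) - y (Sum.inr 2))) s),
        by simp, ?_, hG.comp_affine ?_, fun x => rfl⟩
      · rintro (a | k)
        · exact .coord _
        · fin_cases k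
          · exact .coord _
          · exact ((IsAffineFun.coord _).sub (.const _)).add (.const _)
          · exact (IsAffineFun.coord _).sub (.const _)
      · rintro (a | k)
        · exact (IsAffineFun.coord _).add (((IsAffineFun.coord _).sub (.coord _)).const_mul _)
        · exact (IsAffineFun.coord _).sub (((IsAffineFun.coord _).sub (.coord _)).const_mul _)
    · intro β hβ acc hacc
      have hlt := sum_bits_lt β hβ Q
      set t : ℕ := ∑ i ∈ Finset.range Q, β i * 2 ^ i with ht
      have hlt' : (t : ℝ) + 1 ≤ 2 ^ Q := by exact_mod_cast hlt
      have ht0 : (0 : ℝ) ≤ t := t.cast_nonneg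
      have hbit : max (((t + β Q * 2 ^ Q : ℕ) : ℝ) - 2 ^ Q + 1) 0 -
          max (((t + β Q * 2 ^ Q : ℕ) : ℝ) - 2 ^ Q) 0 = β Q := by
        push_cast
        rcases Nat.le_one_iff_eq_zero_or_eq_one.1 (hβ Q) with h | h
        · rw [h, max_eq_right (by push_cast; linarith), max_eq_right (by push_cast; linarith)]
          simp
        · rw [h, max_eq_left (by push_cast; linarith), max_eq_left (by push_cast; linarith)]
          push_cast
          ring
      have key := hGF β hβ (fun a => acc a + w a Q * β Q)
        (fun a => add_nonneg (hacc a) (mul_nonneg (hw a Q) (Nat.cast_nonneg _)))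
      rw [Finset.sum_range_succ, ← ht]
      simp only [Sum.elim_inl, Sum.elim_inr, hbit, max_eq_left (hacc _),
        max_eq_left (Nat.cast_nonneg (α := ℝ) _)]
      rw [← ht] at key
      have harg : ((t + β Q * 2 ^ Q : ℕ) : ℝ) - 2 ^ Q * β Q = t := by
        push_cast
        ring
      simp only [harg, key, Finset.sum_range_succ]
      congr 2
      funext a
      ring

/-! ### Taylor polynomials with bounded partial derivatives -/

theorem multilinear_apply_const_eq_sum {a k : ℕ} {F : Type*} [NormedAddCommGroup F]
    [NormedSpace ℝ F]
    (f : ContinuousMultilinearMap ℝ (fun _ : Fin k => EuclideanSpace ℝ (Fin a)) F)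
    (v : EuclideanSpace ℝ (Fin a)) :
    f (fun _ => v) =
      ∑ α : Fin k → Fin a, (∏ j, v (α j)) • f (fun j => EuclideanSpace.single (α j) 1) := by
  have hv : v = ∑ i, v i • EuclideanSpace.single i (1 : ℝ) := by
    ext j
    simp [Pi.single_apply]
  conv_lhs => rw [hv]
  rw [f.map_sum]
  exact Finset.sum_congr rfl fun α _ => f.map_smul_univ _ _

theorem HasBoundedPartials.norm_iteratedFDeriv_const_le {a b s k : ℕ} {C h : ℝ}
    {f : EuclideanSpace ℝ (Fin a) → EuclideanSpace ℝ (Fin b)} (hf : HasBoundedPartials s C f)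
    (hk : k ≤ s) {v : EuclideanSpace ℝ (Fin a)} (hv : ∀ i, |v i| ≤ h)
    (x : EuclideanSpace ℝ (Fin a)) :
    ‖iteratedFDeriv ℝ k f x (fun _ => v)‖ ≤ C * (a * h) ^ k := by
  rw [multilinear_apply_const_eq_sum]
  refine (norm_sum_le _ _).trans ?_
  have : ∀ α : Fin k → Fin a, ‖(∏ j, v (α j)) •
      iteratedFDeriv ℝ k f x (fun j => EuclideanSpace.single (α j) 1)‖ ≤ h ^ k * C := by
    intro α
    rw [norm_smul, Real.norm_eq_abs, Finset.abs_prod]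
    refine mul_le_mul ?_ (hf.2 k hk α x) (norm_nonneg _) ?_
    · exact (Finset.prod_le_prod (fun _ _ => abs_nonneg _) fun j _ => hv (α j)).trans
        (le_of_eq (by simp))
    · rcases Nat.eq_zero_or_pos k with rfl | hk0
      · simp
      · exact pow_nonneg ((abs_nonneg _).trans (hv (α ⟨0, hk0⟩))) _
  refine (Finset.sum_le_sum fun α _ => this α).trans (le_of_eq ?_)
  simp
  ring

theorem HasBoundedPartials.norm_sub_taylor_le {a b s k : ℕ} {C h : ℝ}
    {f : EuclideanSpace ℝ (Fin a) → EuclideanSpace ℝ (Fin b)} (hf : HasBoundedPartials s C f)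
    (hk : k + 1 ≤ s) {v : EuclideanSpace ℝ (Fin a)} (hv : ∀ i, |v i| ≤ h)
    (x : EuclideanSpace ℝ (Fin a)) :
    ‖f (x + v) - ∑ j ∈ Finset.range (k + 1),
      ((j.factorial : ℝ)⁻¹) • iteratedFDeriv ℝ j f x (fun _ => v)‖ ≤ C * (a * h) ^ (k + 1) := by
  have hcd : ContDiff ℝ (k + 1 : ℕ) f := hf.1.of_le (by exact_mod_cast hk)
  rw [map_add_eq_sum_add_integral_iteratedFDeriv (f := f) (x := x) (y := v) (n := k) fun t _ => by
    simpa using hcd.contDiffAt, add_sub_cancel_left, norm_smul]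
  have hint : ‖∫ t in (0 : ℝ)..1, (1 - t) ^ k •
      iteratedFDeriv ℝ (k + 1) f (x + t • v) (fun _ => v)‖ ≤ C * (a * h) ^ (k + 1) * |1 - 0| := by
    refine intervalIntegral.norm_integral_le_of_norm_le_const fun t ht => ?_
    rw [Set.uIoc_of_le zero_le_one] at ht
    rw [norm_smul, Real.norm_eq_abs, abs_pow, abs_of_nonneg (by linarith [ht.2])]
    refine (mul_le_of_le_one_left (norm_nonneg _) (pow_le_one₀ (by linarith [ht.2])
      (by linarith [ht.1]))).trans (hf.norm_iteratedFDeriv_const_le hk hv _)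
  rw [sub_zero, abs_one, mul_one] at hint
  refine (mul_le_of_le_one_left (norm_nonneg _) ?_).trans hint
  rw [norm_inv, Real.norm_natCast]
  exact inv_le_one_of_one_le₀ (by exact_mod_cast k.factorial_pos)

/-! ### The decoder -/

/-- The index set of the monomials of degree less than `s - 1` in `n` variables; a monomial is
given by the list of its factors. -/
abbrev MonomialIdx (n s : ℕ) : Type := Σ k : Fin (s - 1), (Fin k → Fin n)

/-- The hidden widths of the decoder: `Q` layers of bit extraction, and a layer of look-up tables
with two entries for each of the `(K + 1) ^ n` cells and each monomial. Here `Qi` digits number the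
cell, and `Kb` digits describe each of the monomials. -/
def decoderWidths (n s K Qi Kb : ℕ) : List ℕ :=
  List.replicate (Qi + Fintype.card (MonomialIdx n s) * Kb) (Fintype.card (MonomialIdx n s) + 3) ++
    [2 * (Fintype.card (MonomialIdx n s) * (2 * (K + 1) ^ n))]

theorem sum_digits_eq {k Q : ℕ} (hk : k < 2 ^ Q) :
    ∑ i : Fin Q, k / 2 ^ (i : ℕ) % 2 * 2 ^ (i : ℕ) = k := by
  have h : ∀ q, ∑ i ∈ Finset.range q, k / 2 ^ i % 2 * 2 ^ i = k % 2 ^ q := by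
    intro q
    induction q with
    | zero => simp [Nat.mod_one]
    | succ q ih => rw [Finset.sum_range_succ, ih, Nat.mod_pow_succ, mul_comm (2 ^ q)]
  rw [Fin.sum_univ_eq_sum_range (fun i => k / 2 ^ i % 2 * 2 ^ i), h, Nat.mod_eq_of_lt hk]

/-- A single real number can carry the number `k` of a cell and an approximate value `m a / 2 ^ Kb`
for each of finitely many quantities, in such a way that a network of constant width and of depth
equal to the number of binary digits recovers `2 * k + m a / 2 ^ Kb` for all `a`. -/
theorem IsMLP.exists_unpack {A κ : Type} [Fintype A] {hs : List ℕ}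
    {F : (A → ℝ) → κ → ℝ} (hF : IsMLP hs F) (Qi Kb : ℕ) :
    ∃ G : (Fin 1 → ℝ) → κ → ℝ,
      IsMLP (List.replicate (Qi + Fintype.card A * Kb) (Fintype.card A + 3) ++ hs) G ∧
      ∀ k : ℕ, k < 2 ^ Qi → ∀ m : A → ℕ, (∀ a, m a < 2 ^ Kb) → ∃ t : ℝ,
        G (fun _ => t) = F (fun a => 2 * (k : ℝ) + m a / 2 ^ Kb) := by
  classical
  have hcard : Fintype.card (Fin Qi ⊕ (A × Fin Kb)) = Qi + Fintype.card A * Kb := by simp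
  rw [← hcard]
  set I := Fin Qi ⊕ (A × Fin Kb) with hI
  let e : I ≃ Fin (Fintype.card I) := Fintype.equivFin I
  let w : A → I → ℝ := fun a => Sum.elim (fun i => 2 * 2 ^ (i : ℕ))
    (fun bi => if a = bi.1 then 2 ^ (bi.2 : ℕ) / 2 ^ Kb else 0)
  let w' : A → ℕ → ℝ := fun a i => if h : i < Fintype.card I then w a (e.symm ⟨i, h⟩) else 0
  have hw : ∀ a i, 0 ≤ w a i := by
    rintro a (i | i)
    · simp only [w, Sum.elim_inl]
      positivity
    · simp only [w, Sum.elim_inr]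
      split_ifs <;> positivity
  have hw' : ∀ a i, 0 ≤ w' a i := by
    intro a i
    simp only [w']
    split_ifs
    · exact hw _ _
    · exact le_rfl
  obtain ⟨G, hG, hGF⟩ := IsMLP.exists_bitDecode (A := A)
    (F := fun x => F (fun a => x (Sum.inl a)))
    (hF.comp_affine fun a => IsAffineFun.coord (Sum.inl a)) w' hw' (Fintype.card I)
  refine ⟨fun y => G (Sum.elim (fun _ => 0) fun _ => y 0), hG.comp_affine ?_, ?_⟩
  · rintro (a | u)
    · exact .const 0
    · exact .coord 0
  intro k hk m hm
  let β : I → ℕ := Sum.elim (fun i => k / 2 ^ (i : ℕ) % 2) (fun bi => m bi.1 / 2 ^ (bi.2 : ℕ) % 2)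
  let β' : ℕ → ℕ := fun i => if h : i < Fintype.card I then β (e.symm ⟨i, h⟩) else 0
  have hβ : ∀ i, β i ≤ 1 := by
    rintro (i | i)
    · exact Nat.le_of_lt_succ (Nat.mod_lt _ two_pos)
    · exact Nat.le_of_lt_succ (Nat.mod_lt _ two_pos)
  have hβ' : ∀ i, β' i ≤ 1 := by
    intro i
    simp only [β']
    split_ifs
    · exact hβ _
    · exact zero_le_one
  refine ⟨_, (hGF β' hβ' (fun _ => 0) fun _ => le_rfl).trans ?_⟩
  congr 1
  funext a
  simp only [Sum.elim_inl, zero_add]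
  rw [← Fin.sum_univ_eq_sum_range (fun i => w' a i * (β' i : ℝ))]
  have h1 : ∀ i : Fin (Fintype.card I), w' a i * (β' i : ℝ) = w a (e.symm i) * β (e.symm i) := by
    intro i
    simp [w', β']
  simp only [h1]
  rw [Equiv.sum_comp e.symm (fun i => w a i * (β i : ℝ)), Fintype.sum_sum_type,
    Fintype.sum_prod_type]
  have hk' : (k : ℝ) = ∑ i : Fin Qi, (((k / 2 ^ (i : ℕ) % 2 : ℕ) : ℝ)) * 2 ^ (i : ℕ) := by
    conv_lhs => rw [← sum_digits_eq hk]
    push_cast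
    rfl
  have hm' : (m a : ℝ) = ∑ i : Fin Kb, (((m a / 2 ^ (i : ℕ) % 2 : ℕ) : ℝ)) * 2 ^ (i : ℕ) := by
    conv_lhs => rw [← sum_digits_eq (hm a)]
    push_cast
    rfl
  congr 1
  · rw [hk', Finset.mul_sum]
    refine Finset.sum_congr rfl fun i _ => ?_
    simp only [w, β, Sum.elim_inl]
    ring
  · rw [hm', Finset.sum_div, Finset.sum_eq_single a]
    · refine Finset.sum_congr rfl fun i _ => ?_
      simp only [w, β, Sum.elim_inr, if_true]
      ring
    · intro b _ hb
      simp [w, Ne.symm hb]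
    · simp

/-- A number in `[0, 1]` has a binary approximation with `Kb` digits. -/
theorem exists_nat_abs_sub_div_le {x : ℝ} (h0 : 0 ≤ x) (h1 : x ≤ 1) (Kb : ℕ) :
    ∃ m : ℕ, m < 2 ^ Kb ∧ |x - m / 2 ^ Kb| ≤ 1 / 2 ^ Kb := by
  have hp : (0 : ℝ) < 2 ^ Kb := by positivity
  have hf := Nat.floor_le (mul_nonneg h0 hp.le)
  have hf' := Nat.lt_floor_add_one (x * 2 ^ Kb)
  rcases lt_or_ge ⌊x * 2 ^ Kb⌋₊ (2 ^ Kb) with h | h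
  · refine ⟨_, h, ?_⟩
    rw [abs_le, neg_le, neg_sub, sub_le_iff_le_add, sub_le_iff_le_add, ← add_div,
      le_div_iff₀ hp, div_le_iff₀ hp, add_mul, div_mul_cancel₀ _ hp.ne']
    constructor <;> linarith
  · have h2 : (1 : ℕ) ≤ 2 ^ Kb := Nat.one_le_two_pow
    refine ⟨2 ^ Kb - 1, Nat.sub_lt h2 one_pos, ?_⟩
    have h' : (2 : ℝ) ^ Kb ≤ ⌊x * 2 ^ Kb⌋₊ := by exact_mod_cast h
    have hx : x = 1 := le_antisymm h1 (by
      by_contra hlt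
      nlinarith)
    rw [hx, Nat.cast_sub h2]
    push_cast
    rw [sub_div, div_self hp.ne']
    have : (0 : ℝ) ≤ 1 / 2 ^ Kb := by positivity
    rw [sub_sub_cancel, abs_of_nonneg this]

/-- The decoder evaluates the Taylor polynomial of `χ` about the corner of the cell that contains
`z`; the cell and the approximate values of the monomials are read off the digits of `t`. -/
theorem HasBoundedPartials.exists_decoder {n r s : ℕ} (hn : 0 < n) (hs : 2 ≤ s) {C R : ℝ}
    (hC : 0 ≤ C) (hR : 0 < R) {χ : EuclideanSpace ℝ (Fin n) → EuclideanSpace ℝ (Fin r)}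
    (hχ : HasBoundedPartials s C χ) (K Kb : ℕ) {Qi : ℕ} (hQ : (K + 1) ^ n ≤ 2 ^ Qi) :
    ∃ G : (Fin n → ℝ) → Fin r → ℝ, IsMLP (decoderWidths n s K Qi Kb) G ∧
      ∀ z : EuclideanSpace ℝ (Fin n), (∀ i, |z i| ≤ R) → ∃ t : ℝ,
        ‖χ z - WithLp.toLp 2 (G fun _ => t)‖ ≤
          C * (n * (2 * R / (K + 1))) ^ (s - 1) +
            Fintype.card (MonomialIdx n s) * (C * (1 + 2 * R) ^ s / 2 ^ Kb) := by
  set h : ℝ := 2 * R / (K + 1) with hh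
  have hK : (0 : ℝ) < (K : ℝ) + 1 := by positivity
  have hh0 : 0 < h := by positivity
  have hhR : h ≤ 1 + 2 * R := by
    have : h ≤ 2 * R := div_le_self (by positivity) (by linarith [K.cast_nonneg (α := ℝ)])
    linarith
  let corner : Fin ((K + 1) ^ n) → EuclideanSpace ℝ (Fin n) := fun k =>
    WithLp.toLp 2 fun i => -R + h * (finFunctionFinEquiv.symm k i : ℕ)
  let c : Fin ((K + 1) ^ n) → MonomialIdx n s → EuclideanSpace ℝ (Fin r) := fun k α =>
    (((α.1 : ℕ).factorial : ℝ)⁻¹ * h ^ (α.1 : ℕ)) • iteratedFDeriv ℝ (α.1 : ℕ) χ (corner k)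
      (fun j => EuclideanSpace.single (α.2 j) 1)
  let f : MonomialIdx n s → ℕ → Fin r → ℝ := fun α b i =>
    if hb : b % 2 = 1 ∧ b / 2 < (K + 1) ^ n then c ⟨b / 2, hb.2⟩ α i else 0
  have hlook : ∀ (k : Fin ((K + 1) ^ n)) (α : MonomialIdx n s) (θ : ℝ), 0 ≤ θ → θ ≤ 1 → ∀ i,
      lookup (2 * (K + 1) ^ n) (f α) (2 * (k : ℕ) + θ) i = θ * c k α i := by
    intro k α θ h0 h1 i
    have hk := k.2
    have := lookup_add (M := 2 * (K + 1) ^ n) (f α) (j := 2 * (k : ℕ)) (by omega) h0 h1 i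
    push_cast at this
    rw [this]
    have e0 : f α (2 * (k : ℕ)) i = 0 := dif_neg (by omega)
    have e1 : f α (2 * (k : ℕ) + 1) i = c k α i := by
      have hd : (2 * (k : ℕ) + 1) / 2 = k := by omega
      have hd' : (⟨(2 * (k : ℕ) + 1) / 2, by omega⟩ : Fin ((K + 1) ^ n)) = k := Fin.ext hd
      refine (dif_pos ⟨by omega, by omega⟩).trans ?_
      rw [hd']
    rw [e0, e1]
    ring
  obtain ⟨G, hG, hGF⟩ := (isMLP_sum_lookup (2 * (K + 1) ^ n) f).exists_unpack Qi Kb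
  refine ⟨fun y => G fun _ => y ⟨0, hn⟩, hG.comp_affine fun _ => .coord _, fun z hz => ?_⟩
  set k := cellIdx K R (fun i => z i) with hk
  have hkey : ∀ i, z i = corner k i + h * (gridPos K R (z i) - (cellCoord K R (z i) : ℕ)) := by
    intro i
    have : (finFunctionFinEquiv.symm k i) = cellCoord K R (z i) := by
      rw [hk, cellIdx, Equiv.symm_apply_apply]
    simp only [corner, this, gridPos, hh]
    field_simp
    ring
  set μ : Fin n → ℝ := fun i => gridPos K R (z i) - (cellCoord K R (z i) : ℕ) with hμ
  have hμ01 : ∀ i, 0 ≤ μ i ∧ μ i ≤ 1 := fun i => gridPos_sub_cellCoord_mem hR (hz i)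
  let mono : MonomialIdx n s → ℝ := fun α => ∏ j, μ (α.2 j)
  have hmono : ∀ α, ∃ m : ℕ, m < 2 ^ Kb ∧ |mono α - m / 2 ^ Kb| ≤ 1 / 2 ^ Kb := fun α =>
    exists_nat_abs_sub_div_le (Finset.prod_nonneg fun j _ => (hμ01 _).1)
      (Finset.prod_le_one (fun j _ => (hμ01 _).1) fun j _ => (hμ01 _).2) Kb
  choose m hm hmm using hmono
  obtain ⟨t, ht⟩ := hGF k (k.2.trans_le hQ) m hm
  refine ⟨t, ?_⟩
  have hp : (0 : ℝ) < 2 ^ Kb := by positivity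
  have hG' : WithLp.toLp 2 (G fun _ => t) = ∑ α, ((m α : ℝ) / 2 ^ Kb) • c k α := by
    rw [ht]
    ext i
    simp only [WithLp.ofLp_sum, Finset.sum_apply, WithLp.ofLp_smul, Pi.smul_apply, smul_eq_mul]
    refine Finset.sum_congr rfl fun α _ => hlook k α _ (by positivity) ?_ i
    rw [div_le_one hp]
    exact_mod_cast (hm α).le
  set v : EuclideanSpace ℝ (Fin n) := WithLp.toLp 2 fun i => h * μ i with hv
  have hzv : z = corner k + v := by
    ext i
    exact hkey i
  have hvh : ∀ i, |v i| ≤ h := by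
    intro i
    change |h * μ i| ≤ h
    rw [abs_of_nonneg (mul_nonneg hh0.le (hμ01 i).1)]
    exact mul_le_of_le_one_right hh0.le (hμ01 i).2
  obtain ⟨s', rfl⟩ : ∃ s', s = s' + 2 := ⟨s - 2, by omega⟩
  have hT := hχ.norm_sub_taylor_le (k := s') (by omega) hvh (corner k)
  rw [← hzv] at hT
  have hTc : ∑ j ∈ Finset.range (s' + 1),
      ((j.factorial : ℝ)⁻¹) • iteratedFDeriv ℝ j χ (corner k) (fun _ => v) =
      ∑ α : MonomialIdx n (s' + 2), mono α • c k α := by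
    rw [Fintype.sum_sigma, ← Fin.sum_univ_eq_sum_range (fun j =>
      ((j.factorial : ℝ)⁻¹) • iteratedFDeriv ℝ j χ (corner k) (fun _ => v))]
    refine Finset.sum_congr rfl fun j _ => ?_
    rw [multilinear_apply_const_eq_sum, Finset.smul_sum]
    refine Finset.sum_congr rfl fun α _ => ?_
    simp only [c, mono, smul_smul]
    congr 1
    have : ∏ i, v (α i) = h ^ (j : ℕ) * ∏ i, μ (α i) := by
      change ∏ i, h * μ (α i) = _
      rw [Finset.prod_mul_distrib]
      simp
    rw [this]
    ring
  rw [hTc] at hT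
  have hq : ‖∑ α : MonomialIdx n (s' + 2), mono α • c k α -
      WithLp.toLp 2 (G fun _ => t)‖ ≤
      Fintype.card (MonomialIdx n (s' + 2)) * (C * (1 + 2 * R) ^ (s' + 2) / 2 ^ Kb) := by
    rw [hG', ← Finset.sum_sub_distrib]
    refine (norm_sum_le _ _).trans ?_
    rw [← nsmul_eq_mul, ← Finset.card_univ]
    refine Finset.sum_le_card_nsmul _ _ _ fun α _ => ?_
    rw [← sub_smul, norm_smul, Real.norm_eq_abs]
    have hα : (α.1 : ℕ) ≤ s' + 2 := by have := α.1.2; omega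
    have hcn : ‖c k α‖ ≤ C * (1 + 2 * R) ^ (s' + 2) := by
      simp only [c]
      rw [norm_smul, Real.norm_eq_abs, abs_of_nonneg (by positivity), mul_comm]
      refine mul_le_mul (hχ.2 _ hα _ _) ?_ (by positivity) hC
      refine (mul_le_of_le_one_left (by positivity)
        (inv_le_one_of_one_le₀ (by exact_mod_cast (α.1 : ℕ).factorial_pos))).trans ?_
      exact (pow_le_pow_left₀ hh0.le hhR _).trans
        (pow_le_pow_right₀ (by linarith) hα)
    calc |mono α - m α / 2 ^ Kb| * ‖c k α‖
        ≤ 1 / 2 ^ Kb * (C * (1 + 2 * R) ^ (s' + 2)) :=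
          mul_le_mul (hmm α) hcn (norm_nonneg _) (by positivity)
      _ = _ := by ring
  have := norm_add_le_of_le hT hq
  rw [sub_add_sub_cancel] at this
  exact this

/-! ### Empirical means of Lipschitz functions -/

theorem measurableSet_cellIdx_eq {q : ℕ} (K : ℕ) (R : ℝ) (k : Fin ((K + 1) ^ q)) :
    MeasurableSet {x : EuclideanSpace ℝ (Fin q) | cellIdx K R (fun i => x i) = k} := by
  have : {x : EuclideanSpace ℝ (Fin q) | cellIdx K R (fun i => x i) = k} =
      ⋂ i, {x | min K ⌊gridPos K R (x i)⌋₊ = (finFunctionFinEquiv.symm k i : ℕ)} := by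
    ext x
    simp only [Set.mem_ofPred_eq, Set.mem_iInter, cellIdx, ← Equiv.eq_symm_apply, funext_iff,
      Fin.ext_iff]
    rfl
  rw [this]
  refine MeasurableSet.iInter fun i => measurableSet_eq_fun ?_ measurable_const
  refine measurable_const.min (Nat.measurable_floor.comp ?_)
  unfold gridPos
  fun_prop

theorem norm_le_sum_abs {q : ℕ} (x : EuclideanSpace ℝ (Fin q)) : ‖x‖ ≤ ∑ i, |x i| := by
  have hx : x = ∑ i, x i • EuclideanSpace.single i (1 : ℝ) := by
    ext j
    simp [Pi.single_apply]
  conv_lhs => rw [hx]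
  refine (norm_sum_le _ _).trans (le_of_eq ?_)
  simp [norm_smul]

theorem norm_sub_le_of_cellIdx_eq {q K : ℕ} {R : ℝ} (hR : 0 < R) {x y : EuclideanSpace ℝ (Fin q)}
    (hx : ∀ i, |x i| ≤ R) (hy : ∀ i, |y i| ≤ R)
    (h : cellIdx K R (fun i => x i) = cellIdx K R fun i => y i) :
    ‖x - y‖ ≤ q * (2 * R / (K + 1)) := by
  refine (norm_le_sum_abs _).trans ?_
  refine (Finset.sum_le_sum fun i _ => abs_sub_le_of_cellIdx_eq hR hx hy h i).trans
    (le_of_eq (by simp))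

theorem exists_forall_abs_coord_le {q : ℕ} {S : Set (EuclideanSpace ℝ (Fin q))}
    (hS : IsCompact S) : ∃ R : ℝ, 0 < R ∧ ∀ x ∈ S, ∀ i, |x i| ≤ R := by
  obtain ⟨R, hR⟩ := hS.isBounded.exists_norm_le
  refine ⟨max R 1, lt_max_of_lt_right one_pos, fun x hx i => ?_⟩
  exact ((PiLp.norm_apply_le x i).trans (hR x hx)).trans (le_max_left _ _)

/-- Chebyshev's inequality for the frequency of an event in `N` independent trials. -/
theorem pi_frequency_le {X : Type*} [MeasurableSpace X] (P : Measure X) [IsProbabilityMeasure P]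
    {B : Set X} (hB : MeasurableSet B) {N : ℕ} (hN : 0 < N) {η : ℝ} (hη : 0 < η) :
    (Measure.pi fun _ : Fin N => P)
        {ν | ∑ j, B.indicator (fun _ => (1 : ℝ)) (ν j) ≤ N * (P.real B - η)} ≤
      ENNReal.ofReal (1 / (N * η ^ 2)) := by
  set X₁ : X → ℝ := B.indicator fun _ => 1 with hX₁
  have hmeas : Measurable X₁ := measurable_const.indicator hB
  have hmem : MemLp X₁ 2 P := memLp_indicator_const 2 hB 1 (Or.inr (measure_ne_top _ _))
  set Y : (Fin N → X) → ℝ := ∑ j : Fin N, fun ν => X₁ (ν j) with hY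
  have hYmem : MemLp Y 2 (Measure.pi fun _ : Fin N => P) :=
    memLp_finsetSum' _ fun j _ => hmem.comp_measurePreserving (measurePreserving_eval _ j)
  have hmean : ∫ ν, Y ν ∂(Measure.pi fun _ : Fin N => P) = N * P.real B := by
    have hj : ∀ j : Fin N, ∫ ν, X₁ (ν j) ∂(Measure.pi fun _ : Fin N => P) = P.real B := by
      intro j
      have := integral_map (μ := Measure.pi fun _ : Fin N => P) (φ := Function.eval j)
        (measurable_pi_apply j).aemeasurable (f := X₁) hmeas.aestronglyMeasurable
      rw [(measurePreserving_eval _ j).map_eq] at this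
      refine this.symm.trans ?_
      rw [hX₁, integral_indicator_const _ hB, smul_eq_mul, mul_one]
    simp only [hY, Finset.sum_apply]
    have hint : ∀ j ∈ (Finset.univ : Finset (Fin N)), Integrable (fun ν : Fin N → X => X₁ (ν j))
        (Measure.pi fun _ : Fin N => P) := fun j _ =>
      (hmem.comp_measurePreserving (measurePreserving_eval _ j)).integrable one_le_two
    rw [integral_finsetSum _ hint]
    refine (Finset.sum_congr rfl fun j _ => hj j).trans ?_
    simp
  have hvar : ProbabilityTheory.variance Y (Measure.pi fun _ : Fin N => P) ≤ N := by
    rw [hY, ProbabilityTheory.variance_sum_pi fun _ => hmem]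
    have : ProbabilityTheory.variance X₁ P ≤ ((1 - 0) / 2) ^ 2 := by
      refine ProbabilityTheory.variance_le_sq_of_bounded (ae_of_all _ fun x => ?_)
        hmeas.aemeasurable
      by_cases hx : x ∈ B <;> simp [hX₁, hx]
    refine (Finset.sum_le_sum fun _ _ => this).trans ?_
    simp
    norm_num
    linarith [N.cast_nonneg (α := ℝ)]
  have hN' : (0 : ℝ) < N := by exact_mod_cast hN
  have hcheb := ProbabilityTheory.meas_ge_le_variance_div_sq hYmem (c := N * η) (by positivity)
  refine (measure_mono fun ν hν => ?_).trans (hcheb.trans (ENNReal.ofReal_le_ofReal ?_))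
  · rw [Set.mem_ofPred_eq] at hν ⊢
    rw [hmean, abs_sub_comm]
    refine le_trans ?_ (le_abs_self _)
    simp only [hY, Finset.sum_apply]
    linarith
  · calc _ ≤ (N : ℝ) / (N * η) ^ 2 := by gcongr
      _ = _ := by field_simp

/-- If the empirical frequency of every cell is not much smaller than its probability, then the
mean of a Lipschitz function is not much larger than its empirical mean. -/
theorem lintegral_le_of_frequencies {q K N : ℕ} {Θ' : Set (EuclideanSpace ℝ (Fin q))}
    (hΘ' : MeasurableSet Θ') (hfin : volume Θ' ≠ ⊤) (h0 : volume Θ' ≠ 0) {R Λ B η : ℝ}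
    (hR : 0 < R) (hΘR : ∀ x ∈ Θ', ∀ i, |x i| ≤ R) (hΛ : 0 ≤ Λ) (hB : 0 ≤ B) (hη : 0 ≤ η)
    (hN : 0 < N) {ν : Fin N → EuclideanSpace ℝ (Fin q)} (hν : ∀ j, ν j ∈ Θ')
    (hfreq : ∀ k : Fin ((K + 1) ^ q), N * ((ProbabilityTheory.cond volume Θ').real
        {x | cellIdx K R (fun i => x i) = k} - η) ≤
      ∑ j, {x : EuclideanSpace ℝ (Fin q) | cellIdx K R (fun i => x i) = k}.indicator
        (fun _ => (1 : ℝ)) (ν j))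
    {f : EuclideanSpace ℝ (Fin q) → ℝ} (hf0 : ∀ x ∈ Θ', 0 ≤ f x) (hfB : ∀ x ∈ Θ', f x ≤ B)
    (hfΛ : ∀ x ∈ Θ', ∀ y ∈ Θ', f x - f y ≤ Λ * ‖x - y‖) :
    ∫⁻ x in Θ', ENNReal.ofReal (f x) ≤ ENNReal.ofReal (volume.real Θ' / N * ∑ j, f (ν j) +
      volume.real Θ' * (2 * (Λ * (q * (2 * R / (K + 1)))) +
        (K + 1) ^ q * ((B + Λ * (q * (2 * R / (K + 1)))) * η))) := by
  classical
  set ρ : ℝ := Λ * (q * (2 * R / (K + 1))) with hρ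
  have hρ0 : 0 ≤ ρ := by positivity
  have hosc : ∀ x ∈ Θ', ∀ y ∈ Θ', cellIdx K R (fun i => x i) = cellIdx K R (fun i => y i) →
      f x ≤ f y + ρ := fun x hx y hy h => by
    have h1 := hfΛ x hx y hy
    have h2 := mul_le_mul_of_nonneg_left
      (norm_sub_le_of_cellIdx_eq (K := K) hR (hΘR x hx) (hΘR y hy) h) hΛ
    linarith
  let cell : Fin ((K + 1) ^ q) → Set (EuclideanSpace ℝ (Fin q)) := fun k =>
    {x | cellIdx K R (fun i => x i) = k}
  have hcell : ∀ k, MeasurableSet (cell k) := measurableSet_cellIdx_eq K R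
  have hS : ∀ k, ∃ S : ℝ, 0 ≤ S ∧ S ≤ B + ρ ∧ (∀ x ∈ Θ', x ∈ cell k → f x ≤ S) ∧
      ∀ x ∈ Θ', x ∈ cell k → S ≤ f x + 2 * ρ := by
    intro k
    by_cases hne : ∃ x ∈ Θ', x ∈ cell k
    · obtain ⟨y, hy, hyk⟩ := hne
      refine ⟨f y + ρ, add_nonneg (hf0 y hy) hρ0, by linarith [hfB y hy],
        fun x hx hxk => hosc x hx y hy (hxk.trans hyk.symm), fun x hx hxk => ?_⟩
      linarith [hosc y hy x hx (hyk.trans hxk.symm)]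
    · push Not at hne
      exact ⟨0, le_rfl, by linarith, fun x hx hxk => absurd hxk (hne x hx),
        fun x hx hxk => absurd hxk (hne x hx)⟩
  choose S hS0 hSB hfS hSf using hS
  have hV0 : 0 < volume.real Θ' := ENNReal.toReal_pos h0 hfin
  have hN' : (0 : ℝ) < N := by exact_mod_cast hN
  have hvol : ∀ k, volume.real (Θ' ∩ cell k) =
      volume.real Θ' * (ProbabilityTheory.cond volume Θ').real (cell k) := by
    intro k
    rw [measureReal_def, measureReal_def, measureReal_def, ProbabilityTheory.cond_apply hΘ',
      ENNReal.toReal_mul, ENNReal.toReal_inv, mul_inv_cancel_left₀]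
    exact hV0.ne'
  have hpart : ∫⁻ x in Θ', ENNReal.ofReal (f x) =
      ∑ k, ∫⁻ x in Θ' ∩ cell k, ENNReal.ofReal (f x) := by
    have hU : Θ' = ⋃ k, Θ' ∩ cell k := by
      ext x
      simp [cell]
    conv_lhs => rw [hU]
    rw [lintegral_iUnion (fun k => hΘ'.inter (hcell k)) ?_, tsum_fintype]
    intro k l hkl
    refine Set.disjoint_left.2 fun x hx hx' => hkl ?_
    exact hx.2.symm.trans hx'.2
  have hterm : ∀ k, ∫⁻ x in Θ' ∩ cell k, ENNReal.ofReal (f x) ≤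
      ENNReal.ofReal (volume.real Θ' / N * ∑ j, (cell k).indicator (fun _ => (1 : ℝ)) (ν j) *
        (f (ν j) + 2 * ρ) + volume.real Θ' * ((B + ρ) * η)) := by
    intro k
    have h1 : ∫⁻ x in Θ' ∩ cell k, ENNReal.ofReal (f x) ≤
        ENNReal.ofReal (S k) * volume (Θ' ∩ cell k) := by
      rw [← setLIntegral_const]
      exact setLIntegral_mono measurable_const fun x hx =>
        ENNReal.ofReal_le_ofReal (hfS k x hx.1 hx.2)
    have hfink : volume (Θ' ∩ cell k) ≠ ⊤ := measure_ne_top_of_subset Set.inter_subset_left hfin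
    rw [← ENNReal.ofReal_toReal hfink, ← ENNReal.ofReal_mul (hS0 k), ← measureReal_def, hvol] at h1
    refine h1.trans (ENNReal.ofReal_le_ofReal ?_)
    have h2 : (ProbabilityTheory.cond volume Θ').real (cell k) ≤
        (∑ j, (cell k).indicator (fun _ => (1 : ℝ)) (ν j)) / N + η := by
      have := hfreq k
      rw [← sub_le_iff_le_add, le_div_iff₀ hN', mul_comm]
      exact this
    have h3 : S k * ∑ j, (cell k).indicator (fun _ => (1 : ℝ)) (ν j) ≤
        ∑ j, (cell k).indicator (fun _ => (1 : ℝ)) (ν j) * (f (ν j) + 2 * ρ) := by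
      rw [Finset.mul_sum]
      refine Finset.sum_le_sum fun j _ => ?_
      by_cases hj : ν j ∈ cell k
      · simpa [hj] using hSf k (ν j) (hν j) hj
      · simp [hj]
    calc S k * (volume.real Θ' * (ProbabilityTheory.cond volume Θ').real (cell k))
        ≤ S k * (volume.real Θ' *
            ((∑ j, (cell k).indicator (fun _ => (1 : ℝ)) (ν j)) / N + η)) := by
          gcongr
          exact hS0 k
      _ = volume.real Θ' / N * (S k * ∑ j, (cell k).indicator (fun _ => (1 : ℝ)) (ν j)) +
            volume.real Θ' * (S k * η) := by ring
      _ ≤ _ := by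
          have := hSB k
          gcongr
  have hnn : ∀ k, 0 ≤ volume.real Θ' / N *
      ∑ j, (cell k).indicator (fun _ => (1 : ℝ)) (ν j) * (f (ν j) + 2 * ρ) +
        volume.real Θ' * ((B + ρ) * η) := fun k =>
    add_nonneg (mul_nonneg (by positivity) (Finset.sum_nonneg fun j _ =>
      mul_nonneg (Set.indicator_nonneg (fun _ _ => zero_le_one) _)
        (add_nonneg (hf0 _ (hν j)) (by positivity)))) (by positivity)
  rw [hpart]
  refine (Finset.sum_le_sum fun k _ => hterm k).trans ?_
  rw [← ENNReal.ofReal_sum_of_nonneg fun k _ => hnn k]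
  refine ENNReal.ofReal_le_ofReal (le_of_eq ?_)
  rw [Finset.sum_add_distrib, ← Finset.mul_sum, Finset.sum_comm]
  have hone : ∀ j, ∑ k, (cell k).indicator (fun _ => (1 : ℝ)) (ν j) * (f (ν j) + 2 * ρ) =
      f (ν j) + 2 * ρ := by
    intro j
    rw [← Finset.sum_mul]
    have : ∑ k, (cell k).indicator (fun _ => (1 : ℝ)) (ν j) = 1 := by
      rw [Finset.sum_eq_single (cellIdx K R fun i => ν j i)]
      · exact Set.indicator_of_mem (by rfl) _
      · intro k _ hk
        exact Set.indicator_of_notMem (fun h => hk h.symm) _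
      · simp
    rw [this, one_mul]
  rw [Finset.sum_congr rfl fun j _ => hone j, Finset.sum_add_distrib]
  simp only [Finset.sum_const, Finset.card_univ, Fintype.card_fin, nsmul_eq_mul]
  push_cast
  field_simp
  ring

/-- With high probability the mean over `Θ'` of every function of a bounded, uniformly Lipschitz
class is at most its empirical mean, up to `η`. -/
theorem exists_sample_event {q : ℕ} {Θ' : Set (EuclideanSpace ℝ (Fin q))} (hΘ' : IsCompact Θ')
    (h0 : 0 < volume Θ') {Λ B η δ : ℝ} (hΛ : 0 ≤ Λ) (hB : 0 ≤ B) (hη : 0 < η) (hδ : 0 < δ) :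
    ∃ N₀ : ℕ, ∀ N ≥ N₀, ∃ E : Set (Fin N → EuclideanSpace ℝ (Fin q)), MeasurableSet E ∧
      1 - δ < (sampleLaw Θ' N).real E ∧ ∀ ν ∈ E, ∀ f : EuclideanSpace ℝ (Fin q) → ℝ,
        (∀ x ∈ Θ', 0 ≤ f x) → (∀ x ∈ Θ', f x ≤ B) →
        (∀ x ∈ Θ', ∀ y ∈ Θ', f x - f y ≤ Λ * ‖x - y‖) →
        ∫⁻ x in Θ', ENNReal.ofReal (f x) ≤
          ENNReal.ofReal (volume.real Θ' / N * ∑ j, f (ν j) + η) := by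
  obtain ⟨R, hR, hΘR⟩ := exists_forall_abs_coord_le hΘ'
  have hfin : volume Θ' ≠ ⊤ := hΘ'.measure_lt_top.ne
  have : IsProbabilityMeasure (ProbabilityTheory.cond volume Θ') :=
    ProbabilityTheory.cond_isProbabilityMeasure_of_finite h0.ne' hfin
  set V : ℝ := volume.real Θ' with hV
  have hV0 : 0 ≤ V := measureReal_nonneg
  obtain ⟨K, hK⟩ := exists_nat_gt (V * (2 * (Λ * (q * (2 * R)))) / (η / 2))
  rw [div_lt_iff₀ (by positivity)] at hK
  set C : ℝ := (K + 1) ^ q * (B + Λ * (q * (2 * R / (K + 1)))) with hC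
  have hC0 : 0 ≤ C := by positivity
  set η' : ℝ := η / 2 / (V * C + 1) with hη'
  have hη'0 : 0 < η' := by positivity
  have hbound : V * (2 * (Λ * (q * (2 * R / (K + 1)))) +
        (K + 1) ^ q * ((B + Λ * (q * (2 * R / (K + 1)))) * η')) ≤ η := by
    have h1 : V * (2 * (Λ * (q * (2 * R / (K + 1))))) ≤ η / 2 := by
      have : V * (2 * (Λ * (q * (2 * R / (K + 1))))) = V * (2 * (Λ * (q * (2 * R)))) / (K + 1) := by
        ring
      rw [this, div_le_iff₀ (by positivity)]
      nlinarith
    have h2 : V * C * η' ≤ η / 2 := by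
      rw [hη', ← mul_div_assoc, div_le_iff₀ (by positivity)]
      nlinarith [mul_nonneg hV0 hC0]
    have h3 : (K + 1) ^ q * ((B + Λ * (q * (2 * R / (K + 1)))) * η') = C * η' := by
      rw [hC]
      ring
    rw [h3, mul_add, ← mul_assoc V C]
    linarith
  obtain ⟨N₀, hN₀⟩ := exists_nat_gt (((K + 1) ^ q : ℕ) / (η' ^ 2 * δ))
  refine ⟨N₀ + 1, fun N hN => ?_⟩
  have hNpos : 0 < N := by omega
  have hN' : (0 : ℝ) < N := by exact_mod_cast hNpos
  have hNδ : ((K + 1) ^ q : ℕ) * (1 / (N * η' ^ 2)) < δ := by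
    have hle : (N₀ : ℝ) ≤ N := by exact_mod_cast (by omega : N₀ ≤ N)
    have := hN₀.trans_le hle
    rw [div_lt_iff₀ (by positivity)] at this
    rw [mul_one_div, div_lt_iff₀ (by positivity)]
    linarith
  let cell : Fin ((K + 1) ^ q) → Set (EuclideanSpace ℝ (Fin q)) := fun k =>
    {x | cellIdx K R (fun i => x i) = k}
  have hcell : ∀ k, MeasurableSet (cell k) := measurableSet_cellIdx_eq K R
  let P := ProbabilityTheory.cond (volume : Measure (EuclideanSpace ℝ (Fin q))) Θ'
  let bad : Fin ((K + 1) ^ q) → Set (Fin N → EuclideanSpace ℝ (Fin q)) := fun k =>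
    {ν | ∑ j, (cell k).indicator (fun _ => (1 : ℝ)) (ν j) ≤ N * (P.real (cell k) - η')}
  let out : Fin N → Set (Fin N → EuclideanSpace ℝ (Fin q)) := fun j => Function.eval j ⁻¹' Θ'ᶜ
  have hbad : ∀ k, MeasurableSet (bad k) := fun k =>
    measurableSet_le (Finset.measurable_sum _ fun j _ =>
      (measurable_const.indicator (hcell k)).comp (measurable_pi_apply j)) measurable_const
  have hout : ∀ j, MeasurableSet (out j) := fun j =>
    measurable_pi_apply j hΘ'.measurableSet.compl
  have hlaw : sampleLaw Θ' N = Measure.pi fun _ => P := rfl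
  have hprob : IsProbabilityMeasure (sampleLaw Θ' N) := by
    rw [hlaw]
    infer_instance
  have hout0 : ∀ j, sampleLaw Θ' N (out j) = 0 := by
    intro j
    rw [hlaw, (measurePreserving_eval (fun _ : Fin N => P) j).measure_preimage
      hΘ'.measurableSet.compl.nullMeasurableSet, ProbabilityTheory.cond_apply hΘ'.measurableSet]
    simp
  set F : Set (Fin N → EuclideanSpace ℝ (Fin q)) := (⋃ k, bad k) ∪ ⋃ j, out j with hF
  have hFm : MeasurableSet F := (MeasurableSet.iUnion hbad).union (MeasurableSet.iUnion hout)
  have hFlt : (sampleLaw Θ' N).real F < δ := by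
    have h1 : sampleLaw Θ' N F ≤ ENNReal.ofReal (((K + 1) ^ q : ℕ) * (1 / (N * η' ^ 2))) := by
      refine (measure_union_le _ _).trans ?_
      rw [measure_iUnion_null hout0, add_zero]
      refine (measure_iUnion_le _).trans ?_
      rw [tsum_fintype]
      refine (Finset.sum_le_sum fun k _ => pi_frequency_le P (hcell k) hNpos hη'0).trans ?_
      rw [Finset.sum_const, Finset.card_univ, Fintype.card_fin, nsmul_eq_mul,
        ENNReal.ofReal_mul (Nat.cast_nonneg _), ENNReal.ofReal_natCast]
    refine lt_of_le_of_lt ?_ hNδ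
    rw [measureReal_def]
    exact ENNReal.toReal_le_of_le_ofReal (by positivity) h1
  refine ⟨Fᶜ, hFm.compl, ?_, fun ν hν f hf0 hfB hfΛ => ?_⟩
  · rw [probReal_compl_eq_one_sub hFm]
    linarith
  · simp only [hF, Set.compl_union, Set.mem_inter_iff, Set.compl_iUnion, Set.mem_iInter] at hν
    refine (lintegral_le_of_frequencies (K := K) hΘ'.measurableSet hfin h0.ne' hR hΘR hΛ hB hη'0.le
      hNpos (fun j => not_not.1 (hν.2 j)) (fun k => ?_) hf0 hfB hfΛ).trans
      (ENNReal.ofReal_le_ofReal (by gcongr))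
    exact (not_le.1 fun h => hν.1 k h).le

/-! ### Matrices acting on Euclidean spaces -/

section Euclidean

variable {a b : ℕ}

theorem norm_toLp_sq (x : Fin a → ℝ) : ‖WithLp.toLp 2 x‖ ^ 2 = x ⬝ᵥ x := by
  rw [EuclideanSpace.real_norm_sq_eq]
  simp [dotProduct, sq]

theorem norm_toLp_mulVec_le (S : Matrix (Fin a) (Fin b) ℝ) (y : Fin b → ℝ) :
    ‖WithLp.toLp 2 (S *ᵥ y)‖ ≤ √(∑ i, ∑ j, S i j ^ 2) * ‖WithLp.toLp 2 y‖ := by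
  rw [EuclideanSpace.norm_eq, EuclideanSpace.norm_eq, ← Real.sqrt_mul (by positivity)]
  refine Real.sqrt_le_sqrt ?_
  rw [Finset.sum_mul]
  refine Finset.sum_le_sum fun i _ => ?_
  simp only [Real.norm_eq_abs, sq_abs]
  exact Finset.sum_mul_sq_le_sq_mul_sq Finset.univ (fun j => S i j) y

theorem norm_toLp_transpose_mulVec_le (S : Matrix (Fin a) (Fin b) ℝ) (y : Fin a → ℝ) :
    ‖WithLp.toLp 2 (Sᵀ *ᵥ y)‖ ≤ √(∑ i, ∑ j, S i j ^ 2) * ‖WithLp.toLp 2 y‖ := by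
  refine (norm_toLp_mulVec_le Sᵀ y).trans (le_of_eq ?_)
  rw [Finset.sum_comm]
  rfl

theorem norm_toLp_mulVec_of_orthonormal {S : Matrix (Fin a) (Fin b) ℝ} (hS : Sᵀ * S = 1)
    (y : Fin b → ℝ) : ‖WithLp.toLp 2 (S *ᵥ y)‖ = ‖WithLp.toLp 2 y‖ := by
  rw [← sq_eq_sq₀ (norm_nonneg _) (norm_nonneg _), norm_toLp_sq, norm_toLp_sq,
    Matrix.dotProduct_mulVec, Matrix.vecMul_mulVec, ← Matrix.mulVec_transpose,
    Matrix.transpose_mul, Matrix.transpose_transpose, hS, Matrix.one_mulVec]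

/-- The residual of the orthogonal projection onto the columns of `S`. -/
def projResidual (S : Matrix (Fin a) (Fin b) ℝ) (x : EuclideanSpace ℝ (Fin a)) :
    EuclideanSpace ℝ (Fin a) :=
  WithLp.toLp 2 (x.ofLp - S *ᵥ (Sᵀ *ᵥ x.ofLp))

theorem projResidual_sub (S : Matrix (Fin a) (Fin b) ℝ) (x y : EuclideanSpace ℝ (Fin a)) :
    projResidual S (x - y) = projResidual S x - projResidual S y := by
  simp only [projResidual, WithLp.ofLp_sub, Matrix.mulVec_sub, ← WithLp.toLp_sub]
  congr 1
  abel

theorem norm_sq_projResidual_add {S : Matrix (Fin a) (Fin b) ℝ} (hS : Sᵀ * S = 1)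
    (x : EuclideanSpace ℝ (Fin a)) :
    ‖projResidual S x‖ ^ 2 + ‖WithLp.toLp 2 (Sᵀ *ᵥ x.ofLp)‖ ^ 2 = ‖x‖ ^ 2 := by
  have h1 : x.ofLp ⬝ᵥ (S *ᵥ (Sᵀ *ᵥ x.ofLp)) = (Sᵀ *ᵥ x.ofLp) ⬝ᵥ (Sᵀ *ᵥ x.ofLp) := by
    rw [Matrix.dotProduct_mulVec, ← Matrix.mulVec_transpose]
  have h2 : (S *ᵥ (Sᵀ *ᵥ x.ofLp)) ⬝ᵥ (S *ᵥ (Sᵀ *ᵥ x.ofLp)) =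
      (Sᵀ *ᵥ x.ofLp) ⬝ᵥ (Sᵀ *ᵥ x.ofLp) := by
    rw [← norm_toLp_sq, norm_toLp_mulVec_of_orthonormal hS, norm_toLp_sq]
  have h3 : ‖x‖ ^ 2 = x.ofLp ⬝ᵥ x.ofLp := norm_toLp_sq x.ofLp
  rw [projResidual, norm_toLp_sq, norm_toLp_sq, h3, sub_dotProduct, dotProduct_sub,
    dotProduct_sub, h2, dotProduct_comm (S *ᵥ _) x.ofLp, h1]
  ring

theorem norm_projResidual_le {S : Matrix (Fin a) (Fin b) ℝ} (hS : Sᵀ * S = 1)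
    (x : EuclideanSpace ℝ (Fin a)) : ‖projResidual S x‖ ≤ ‖x‖ := by
  rw [← sq_le_sq₀ (norm_nonneg _) (norm_nonneg _), ← norm_sq_projResidual_add hS x]
  linarith [sq_nonneg ‖WithLp.toLp 2 (Sᵀ *ᵥ x.ofLp)‖]

theorem norm_toLp_transpose_mulVec_le_of_orthonormal {S : Matrix (Fin a) (Fin b) ℝ}
    (hS : Sᵀ * S = 1) (x : EuclideanSpace ℝ (Fin a)) :
    ‖WithLp.toLp 2 (Sᵀ *ᵥ x.ofLp)‖ ≤ ‖x‖ := by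
  rw [← sq_le_sq₀ (norm_nonneg _) (norm_nonneg _), ← norm_sq_projResidual_add hS x]
  linarith [sq_nonneg ‖projResidual S x‖]

theorem orthonormal_columns {S : Matrix (Fin a) (Fin b) ℝ} (hS : Sᵀ * S = 1) :
    Orthonormal ℝ fun j => WithLp.toLp 2 (fun i => S i j) := by
  rw [orthonormal_iff_ite]
  intro i j
  have := congrFun (congrFun hS i) j
  rw [Matrix.mul_apply, Matrix.one_apply] at this
  rw [← this]
  simp [PiLp.inner_apply, mul_comm]

theorem gramSchmidtNormed_of_orthonormal {E : Type*} [NormedAddCommGroup E]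
    [InnerProductSpace ℝ E] {f : Fin b → E} (hf : Orthonormal ℝ f) (j : Fin b) :
    InnerProductSpace.gramSchmidtNormed ℝ f j = f j := by
  have h : InnerProductSpace.gramSchmidt ℝ f = f :=
    InnerProductSpace.gramSchmidt_of_orthogonal ℝ fun i j hij => hf.2 hij
  rw [InnerProductSpace.gramSchmidtNormed, h, hf.1 j]
  simp

theorem norm_gramSchmidtNormed_le {E : Type*} [NormedAddCommGroup E]
    [InnerProductSpace ℝ E] (f : Fin b → E) (j : Fin b) :
    ‖InnerProductSpace.gramSchmidtNormed ℝ f j‖ ≤ 1 := by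
  by_cases h : InnerProductSpace.gramSchmidtNormed ℝ f j = 0
  · simp [h]
  · rw [InnerProductSpace.gramSchmidtNormed_unit_length' h]

theorem norm_toLp_mulVec_le_of_columns {V : Matrix (Fin a) (Fin b) ℝ}
    (hV : ∀ j, ‖WithLp.toLp 2 (fun i => V i j)‖ ≤ 1) (y : Fin b → ℝ) :
    ‖WithLp.toLp 2 (V *ᵥ y)‖ ≤ ∑ j, |y j| := by
  have h : WithLp.toLp 2 (V *ᵥ y) = ∑ j, y j • WithLp.toLp 2 (fun i => V i j) := by
    ext i
    simp [Matrix.mulVec, dotProduct, mul_comm]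
  rw [h]
  refine (norm_sum_le _ _).trans (Finset.sum_le_sum fun j _ => ?_)
  rw [norm_smul, Real.norm_eq_abs]
  exact mul_le_of_le_one_right (abs_nonneg _) (hV j)

end Euclidean

/-! ### Coordinates with respect to a `G`-orthonormal basis -/

section Coordinates

variable {Nh : ℕ} {G A : Matrix (Fin Nh) (Fin Nh) ℝ}

/-- The coordinates of `v` with respect to the columns of a `G`-orthonormal matrix `A`. -/
def podCoord (G A : Matrix (Fin Nh) (Fin Nh) ℝ) (v : Fin Nh → ℝ) : EuclideanSpace ℝ (Fin Nh) :=
  WithLp.toLp 2 (Aᵀ *ᵥ (G *ᵥ v))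

theorem mulVec_podCoord (hA : Aᵀ * G * A = 1) (v : Fin Nh → ℝ) :
    A *ᵥ (podCoord G A v).ofLp = v := by
  have : A * (Aᵀ * G) = 1 := mul_eq_one_comm.1 hA
  rw [podCoord, Matrix.mulVec_mulVec, Matrix.mulVec_mulVec, Matrix.mul_assoc, this,
    Matrix.one_mulVec]

theorem gNorm_mulVec (hA : Aᵀ * G * A = 1) (x : Fin Nh → ℝ) :
    gNorm G (A *ᵥ x) = ‖WithLp.toLp 2 x‖ := by
  have h : (A *ᵥ x) ⬝ᵥ (G *ᵥ (A *ᵥ x)) = x ⬝ᵥ x := by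
    have h1 : Aᵀ *ᵥ (G *ᵥ (A *ᵥ x)) = x := by
      rw [Matrix.mulVec_mulVec, Matrix.mulVec_mulVec, hA, Matrix.one_mulVec]
    calc (A *ᵥ x) ⬝ᵥ (G *ᵥ (A *ᵥ x)) = x ⬝ᵥ (Aᵀ *ᵥ (G *ᵥ (A *ᵥ x))) := by
          rw [Matrix.dotProduct_mulVec x, Matrix.vecMul_transpose]
      _ = x ⬝ᵥ x := by rw [h1]
  rw [gNorm, h, ← norm_toLp_sq, Real.sqrt_sq (norm_nonneg _)]

theorem gNorm_eq_norm_podCoord (hA : Aᵀ * G * A = 1) (v : Fin Nh → ℝ) :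
    gNorm G v = ‖podCoord G A v‖ := by
  conv_lhs => rw [← mulVec_podCoord hA v, gNorm_mulVec hA]

theorem podCoord_sub (v v' : Fin Nh → ℝ) :
    podCoord G A (v - v') = podCoord G A v - podCoord G A v' := by
  simp only [podCoord, Matrix.mulVec_sub, WithLp.toLp_sub]

theorem transpose_mul_mulVec {r : ℕ} (W : Matrix (Fin Nh) (Fin r) ℝ) (v : Fin Nh → ℝ) :
    (A * W)ᵀ *ᵥ (G *ᵥ v) = Wᵀ *ᵥ (podCoord G A v).ofLp := by
  rw [podCoord, Matrix.transpose_mul, ← Matrix.mulVec_mulVec]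

theorem transpose_mul_self_of_orthonormal {r : ℕ} (hA : Aᵀ * G * A = 1)
    {W : Matrix (Fin Nh) (Fin r) ℝ} (hW : (A * W)ᵀ * G * (A * W) = 1) : Wᵀ * W = 1 := by
  rw [Matrix.transpose_mul] at hW
  calc Wᵀ * W = Wᵀ * (Aᵀ * G * A) * W := by rw [hA, Matrix.mul_one]
    _ = 1 := by rw [← hW]; simp only [Matrix.mul_assoc]

theorem gNorm_sub_eq_norm_projResidual {r : ℕ} (hA : Aᵀ * G * A = 1)
    (W : Matrix (Fin Nh) (Fin r) ℝ) (v : Fin Nh → ℝ) :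
    gNorm G (v - (A * W) *ᵥ ((A * W)ᵀ *ᵥ (G *ᵥ v))) = ‖projResidual W (podCoord G A v)‖ := by
  rw [transpose_mul_mulVec, ← Matrix.mulVec_mulVec]
  conv_lhs => rw [← mulVec_podCoord hA v]
  rw [← Matrix.mulVec_sub, gNorm_mulVec hA, mulVec_podCoord hA]
  rfl

end Coordinates

/-! ### Optimality of the leading eigenvectors -/

section Eigen

variable {p q Nh N : ℕ} {Θ : Set (EuclideanSpace ℝ (Fin p))} {Θ' : Set (EuclideanSpace ℝ (Fin q))}
  {G A : Matrix (Fin Nh) (Fin Nh) ℝ}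
  {u : EuclideanSpace ℝ (Fin p) → EuclideanSpace ℝ (Fin q) → ℝ → Fin Nh → ℝ}
  {ν : Fin N → EuclideanSpace ℝ (Fin q)} {μ : EuclideanSpace ℝ (Fin p)} {t : ℝ}

/-- The leading `r` eigenvectors of the correlation matrix attain the eigenvalue tail. -/
theorem exists_dodFunctional_eq_eigenTail (hA : Aᵀ * G * A = 1) {r : ℕ} (hr : r ≤ Nh) :
    ∃ W : Matrix (Fin Nh) (Fin r) ℝ, (∀ i j, W i j ∈ Set.Icc (-1) 1) ∧
      dodFunctional Θ' G u ν μ t (A * W) = eigenTail Θ' G u A ν r μ t := by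
  set K := corrMatrix Θ' G u A ν μ t with hK
  have hKh : K.IsHermitian := corrMatrix_isHermitian Θ' G u A ν μ t
  let τ : Fin (Fintype.card (Fin Nh)) ≃ Fin Nh := Fintype.equivOfCardEq (Fintype.card_fin _)
  let e : OrthonormalBasis (Fin Nh) ℝ (EuclideanSpace ℝ (Fin Nh)) := hKh.eigenvectorBasis
  let ι : Fin r → Fin Nh := fun j => τ ⟨j, by simpa using j.2.trans_le hr⟩
  let w : Fin N → EuclideanSpace ℝ (Fin Nh) := fun j => podCoord G A (u μ (ν j) t)
  have hinner : ∀ x y : EuclideanSpace ℝ (Fin Nh), inner ℝ x y = x.ofLp ⬝ᵥ y.ofLp := by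
    intro x y
    simp [PiLp.inner_apply, dotProduct, mul_comm]
  let W : Matrix (Fin Nh) (Fin r) ℝ := fun i j => (e (ι j)).ofLp i
  have hWt : ∀ x : EuclideanSpace ℝ (Fin Nh), Wᵀ *ᵥ x.ofLp = fun j => inner ℝ (e (ι j)) x := by
    intro x
    funext j
    rw [hinner]
    rfl
  refine ⟨W, fun i j => ?_, ?_⟩
  · rw [Set.mem_Icc, ← abs_le]
    exact (PiLp.norm_apply_le (e (ι j)) i).trans (e.orthonormal.1 (ι j)).le
  have hres : ∀ (x : EuclideanSpace ℝ (Fin Nh)) (k : Fin (Fintype.card (Fin Nh))),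
      inner ℝ (e (τ k)) (projResidual W x) = if r ≤ k.val then inner ℝ (e (τ k)) x else 0 := by
    intro x k
    have h1 : inner ℝ (e (τ k)) (projResidual W x) = inner ℝ (e (τ k)) x -
        ∑ j, inner ℝ (e (ι j)) (e (τ k)) * inner ℝ (e (ι j)) x := by
      rw [hinner, hinner, projResidual, dotProduct_sub, Matrix.dotProduct_mulVec,
        ← Matrix.mulVec_transpose, hWt, hWt]
      rfl
    rw [h1]
    simp only [orthonormal_iff_ite.1 e.orthonormal]
    have h2 : ∀ j : Fin r, ι j = τ k ↔ (j : ℕ) = k := by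
      intro j
      rw [τ.injective.eq_iff, Fin.ext_iff]
    simp only [h2]
    split_ifs with hk
    · rw [Finset.sum_eq_zero, sub_zero]
      intro j _
      rw [if_neg (by have := j.2; omega), zero_mul]
    · rw [Finset.sum_eq_single ⟨k, not_le.1 hk⟩]
      · simp [ι]
      · intro j _ hj
        rw [if_neg (fun h => hj (Fin.ext h)), zero_mul]
      · simp
  have hnorm : ∀ x : EuclideanSpace ℝ (Fin Nh), ‖projResidual W x‖ ^ 2 =
      ∑ k with r ≤ k.val, inner ℝ (e (τ k)) x ^ 2 := by
    intro x
    rw [← e.sum_sq_norm_inner_right, ← Equiv.sum_comp τ, Finset.sum_filter]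
    refine Finset.sum_congr rfl fun k _ => ?_
    rw [hres, Real.norm_eq_abs, sq_abs]
    split_ifs <;> simp
  have heig : ∀ k, volume.real Θ' / N * ∑ j, inner ℝ (e (τ k)) (w j) ^ 2 =
      hKh.eigenvalues₀ k := by
    intro k
    have h1 : (e (τ k)).ofLp ⬝ᵥ (K *ᵥ (e (τ k)).ofLp) = hKh.eigenvalues₀ k := by
      have := hKh.mulVec_eigenvectorBasis (τ k)
      change K *ᵥ (e (τ k)).ofLp = _ • (e (τ k)).ofLp at this
      rw [this, dotProduct_smul, ← hinner, real_inner_self_eq_norm_sq, e.orthonormal.1]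
      simp [Matrix.IsHermitian.eigenvalues, τ]
    rw [← h1, hK, corrMatrix, Matrix.smul_mulVec, dotProduct_smul, smul_eq_mul]
    congr 1
    rw [Matrix.sum_mulVec, dotProduct_sum]
    refine Finset.sum_congr rfl fun j _ => ?_
    rw [Matrix.vecMulVec_mulVec, hinner]
    simp only [w, podCoord, dotProduct_smul, MulOpposite.smul_eq_mul_unop, MulOpposite.unop_op]
    rw [sq, dotProduct_comm (e (τ k)).ofLp]
  rw [dodFunctional, eigenTail]
  simp only [gNorm_sub_eq_norm_projResidual hA, hnorm]
  rw [Finset.sum_comm, Finset.mul_sum]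
  exact Finset.sum_congr rfl fun k _ => heig k

theorem dodDim_spec {T : ℝ} (hT : 0 ≤ T) (m ε : ℝ) :
    dodDim Θ Θ' T G u m ε A ν ≤ Nh ∧ ∀ μ ∈ Θ, ∀ t ∈ Set.Icc 0 T,
      eigenTail Θ' G u A ν (dodDim Θ Θ' T G u m ε A ν) μ t ≤
        m ^ 2 / (16 * (volume.real Θ * T)) * ε ^ 2 := by
  have hmem : Nh ∈ {r : ℕ | ∀ μ ∈ Θ, ∀ t ∈ Set.Icc 0 T,
      eigenTail Θ' G u A ν r μ t ≤ m ^ 2 / (16 * (volume.real Θ * T)) * ε ^ 2} := by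
    intro μ _ t _
    have : eigenTail Θ' G u A ν Nh μ t = 0 := by
      refine Finset.sum_eq_zero fun k hk => ?_
      have h1 := k.2
      simp only [Finset.mem_filter, Finset.mem_univ, true_and, Fintype.card_fin] at hk h1
      omega
    rw [this]
    positivity
  exact ⟨Nat.sInf_le hmem, Nat.sInf_mem ⟨Nh, hmem⟩⟩

/-- The empirical projection error of an optimal DOD of dimension `dodDim` is small. -/
theorem IsLipschitzOptimalDOD.mean_projResidual_le {T m ε Lhat : ℝ} (hT : 0 ≤ T)
    (hA : Aᵀ * G * A = 1)
    {σ : EuclideanSpace ℝ (Fin p) → ℝ → Matrix (Fin Nh) (Fin (dodDim Θ Θ' T G u m ε A ν)) ℝ}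
    (hσ : IsLipschitzOptimalDOD Θ Θ' T G u A ν Lhat σ) (hμ : μ ∈ Θ) (ht : t ∈ Set.Icc 0 T) :
    volume.real Θ' / N * ∑ j, ‖projResidual (σ μ t) (podCoord G A (u μ (ν j) t))‖ ^ 2 ≤
      m ^ 2 / (16 * (volume.real Θ * T)) * ε ^ 2 := by
  obtain ⟨hr, htail⟩ := dodDim_spec (Θ := Θ) (Θ' := Θ') (G := G) (u := u) (A := A) (ν := ν)
    hT m ε
  obtain ⟨W, hW, hWe⟩ := exists_dodFunctional_eq_eigenTail (Θ' := Θ') (u := u) (ν := ν) (μ := μ)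
    (t := t) hA hr
  have h := (hσ.isMin μ hμ t ht W hW).trans (hWe.le.trans (htail μ hμ t ht))
  simpa only [dodFunctional, gNorm_sub_eq_norm_projResidual hA] using h

end Eigen

/-! ### Growth of the sizes of tables and decoders -/

theorem clog_two_le {x : ℕ} (hx : 1 ≤ x) : (Nat.clog 2 x : ℝ) ≤ 2 * Real.log x + 1 := by
  have hlog : 0 ≤ Real.log x := Real.log_nonneg (by exact_mod_cast hx)
  rcases hx.eq_or_lt with rfl | h
  · simp
  · have h1 : 2 ^ (Nat.clog 2 x).pred < x := Nat.pow_pred_clog_lt_self one_lt_two h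
    have h2 : ((2 : ℝ) ^ (Nat.clog 2 x).pred) ≤ x := by exact_mod_cast h1.le
    have h3 := Real.log_le_log (by positivity) h2
    rw [Real.log_pow] at h3
    have h4 : ((Nat.clog 2 x : ℕ) : ℝ) ≤ ((Nat.clog 2 x).pred : ℕ) + 1 := by
      exact_mod_cast (by simp only [Nat.pred_eq_sub_one]; omega :
        Nat.clog 2 x ≤ (Nat.clog 2 x).pred + 1)
    have h5 : (1 / 2 : ℝ) ≤ Real.log 2 := by linarith [Real.log_two_gt_d9]
    nlinarith [Nat.cast_nonneg (α := ℝ) (Nat.clog 2 x).pred]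

/-- `log (C / ε)` is at most a multiple of `log ε⁻¹`, as `ε` is bounded away from `1`. -/
theorem exists_clog_le {ε₀ C : ℝ} (h0 : 0 < ε₀) (h1 : ε₀ < 1) :
    ∃ c : ℝ, 0 ≤ c ∧ ∀ ε : ℝ, 0 < ε → ε ≤ ε₀ → ∀ x : ℕ, 1 ≤ x → (x : ℝ) ≤ C * ε⁻¹ →
      (Nat.clog 2 x : ℝ) ≤ c * Real.log ε⁻¹ := by
  have hl0 : 0 < Real.log ε₀⁻¹ := Real.log_pos ((one_lt_inv₀ h0).2 h1)
  refine ⟨2 * (|Real.log C| / Real.log ε₀⁻¹ + 1) + 1 / Real.log ε₀⁻¹, by positivity,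
    fun ε hε hεε x hx hxC => ?_⟩
  have hl : Real.log ε₀⁻¹ ≤ Real.log ε⁻¹ :=
    Real.log_le_log (by positivity) (inv_anti₀ hε hεε)
  have hx' : (1 : ℝ) ≤ x := by exact_mod_cast hx
  have hC : 0 < C := by
    by_contra hC
    have : C * ε⁻¹ ≤ 0 := mul_nonpos_of_nonpos_of_nonneg (not_lt.1 hC) (by positivity)
    linarith
  have hlx : Real.log x ≤ |Real.log C| + Real.log ε⁻¹ := by
    have := Real.log_le_log (by linarith) hxC
    rw [Real.log_mul hC.ne' (by positivity)] at this
    linarith [le_abs_self (Real.log C)]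
  have hone : 1 ≤ Real.log ε⁻¹ / Real.log ε₀⁻¹ := (one_le_div hl0).2 hl
  have habs : |Real.log C| ≤ |Real.log C| * (Real.log ε⁻¹ / Real.log ε₀⁻¹) :=
    le_mul_of_one_le_right (abs_nonneg _) hone
  calc (Nat.clog 2 x : ℝ) ≤ 2 * Real.log x + 1 := clog_two_le hx
    _ ≤ 2 * (|Real.log C| * (Real.log ε⁻¹ / Real.log ε₀⁻¹) + Real.log ε⁻¹) +
          Real.log ε⁻¹ / Real.log ε₀⁻¹ := by linarith
    _ = _ := by field_simp

theorem ceil_mul_add_one_le {a x : ℝ} (ha : 0 ≤ a) (hx : 1 ≤ x) :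
    ((⌈a * x⌉₊ : ℝ) + 1) ≤ (a + 2) * x := by
  have := Nat.ceil_lt_add_one (mul_nonneg ha (zero_le_one.trans hx))
  nlinarith

theorem mlpCount_lookup_le {d K e : ℕ} (hd : 1 ≤ d) (he : 1 ≤ e) :
    mlpCount d [2 * (d * K)] 1 + mlpCount 1 [2 * (K + 1) ^ d] e ≤
      (2 * d * d + 4 * d + 8) * (e * (K + 1) ^ d) := by
  have hKM : K + 1 ≤ (K + 1) ^ d := Nat.le_self_pow (by omega) _
  set M := (K + 1) ^ d
  have h1 : K ≤ e * M := by nlinarith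
  have h2 : M ≤ e * M := by nlinarith
  have h3 : e ≤ e * M := by nlinarith
  have h4 : 1 ≤ e * M := by nlinarith
  simp only [mlpCount]
  calc _ = (2 * d * d + 4 * d) * K + 1 + 4 * M + 2 * (e * M) + e := by ring
    _ ≤ (2 * d * d + 4 * d) * (e * M) + e * M + 4 * (e * M) + 2 * (e * M) + e * M := by gcongr
    _ = _ := by ring

theorem mlpCount_three (d a b e : ℕ) :
    mlpCount d [a, 1, b] e = mlpCount d [a] 1 + mlpCount 1 [b] e := by
  simp only [mlpCount]
  ring

theorem mlpCount_replicate_le {w D h e : ℕ} (hw : w ≤ D) (Q : ℕ) {d : ℕ} (hd : d ≤ D) :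
    mlpCount d (List.replicate Q w ++ [h]) e ≤
      Q * (w * D + w) + (h * D + h) + (e * h + e) := by
  induction Q generalizing d with
  | zero =>
    simp only [List.replicate_zero, List.nil_append, mlpCount, zero_mul, zero_add]
    gcongr
  | succ Q ih =>
    rw [List.replicate_succ, List.cons_append, mlpCount]
    have h1 := ih hw
    have h2 : w * d + w ≤ w * D + w := by gcongr
    rw [add_mul, one_mul]
    omega

theorem exists_const_le_log {ε₀ : ℝ} (h0 : 0 < ε₀) (h1 : ε₀ < 1) {a : ℝ} (ha : 0 ≤ a) :
    ∃ c : ℝ, 0 ≤ c ∧ ∀ ε : ℝ, 0 < ε → ε ≤ ε₀ → a ≤ c * Real.log ε⁻¹ := by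
  have hl0 : 0 < Real.log ε₀⁻¹ := Real.log_pos ((one_lt_inv₀ h0).2 h1)
  refine ⟨a / Real.log ε₀⁻¹, by positivity, fun ε hε hεε => ?_⟩
  have hl : Real.log ε₀⁻¹ ≤ Real.log ε⁻¹ :=
    Real.log_le_log (by positivity) (inv_anti₀ hε hεε)
  rw [div_mul_eq_mul_div, le_div_iff₀ hl0]
  gcongr

theorem exists_lookup_size {ε₀ : ℝ} (h0 : 0 < ε₀) (h1 : ε₀ < 1) {d : ℕ} (hd : 1 ≤ d) {c₁ : ℝ}
    (hc₁ : 0 ≤ c₁) :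
    ∃ c : ℝ, 0 ≤ c ∧ ∀ ε : ℝ, 0 < ε → ε ≤ ε₀ → ∀ e : ℕ, 1 ≤ e →
      ((mlpCount d [2 * (d * ⌈c₁ * ε⁻¹⌉₊)] 1 +
        mlpCount 1 [2 * (⌈c₁ * ε⁻¹⌉₊ + 1) ^ d] e : ℕ) : ℝ) ≤
      c * e * ε ^ (-(d : ℝ)) * Real.log ε⁻¹ := by
  obtain ⟨c, hc, hcl⟩ := exists_const_le_log h0 h1
    (a := (2 * d * d + 4 * d + 8) * (c₁ + 2) ^ d) (by positivity)
  refine ⟨c, hc, fun ε hε hεε e he => ?_⟩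
  have hx : 1 ≤ ε⁻¹ := (one_le_inv₀ hε).2 (hεε.trans h1.le)
  have hM : (((⌈c₁ * ε⁻¹⌉₊ + 1) ^ d : ℕ) : ℝ) ≤ (c₁ + 2) ^ d * ε ^ (-(d : ℝ)) := by
    rw [Real.rpow_neg hε.le, Real.rpow_natCast, ← inv_pow, ← mul_pow]
    push_cast
    exact pow_le_pow_left₀ (by positivity) (ceil_mul_add_one_le hc₁ hx) d
  calc ((mlpCount d [2 * (d * ⌈c₁ * ε⁻¹⌉₊)] 1 +
        mlpCount 1 [2 * (⌈c₁ * ε⁻¹⌉₊ + 1) ^ d] e : ℕ) : ℝ)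
      ≤ (((2 * d * d + 4 * d + 8) * (e * (⌈c₁ * ε⁻¹⌉₊ + 1) ^ d) : ℕ) : ℝ) := by
        exact_mod_cast mlpCount_lookup_le hd he
    _ = (2 * d * d + 4 * d + 8) * (e * (((⌈c₁ * ε⁻¹⌉₊ + 1) ^ d : ℕ) : ℝ)) := by push_cast; ring
    _ ≤ (2 * d * d + 4 * d + 8) * (e * ((c₁ + 2) ^ d * ε ^ (-(d : ℝ)))) := by gcongr
    _ = ((2 * d * d + 4 * d + 8) * (c₁ + 2) ^ d) * (e * ε ^ (-(d : ℝ))) := by ring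
    _ ≤ (c * Real.log ε⁻¹) * (e * ε ^ (-(d : ℝ))) := by
        have := hcl ε hε hεε
        gcongr
    _ = _ := by ring

/-- The number of binary digits that number the cells of the decoder. -/
noncomputable def cellDigits (n K : ℕ) : ℕ := n * Nat.clog 2 (K + 1)

theorem pow_le_two_pow_cellDigits (n K : ℕ) : (K + 1) ^ n ≤ 2 ^ cellDigits n K := by
  rw [cellDigits, mul_comm, pow_mul]
  exact Nat.pow_le_pow_left (Nat.le_pow_clog one_lt_two _) n

theorem exists_decoder_size {ε₀ : ℝ} (h0 : 0 < ε₀) (h1 : ε₀ < 1) (n : ℕ) {s : ℕ} (hs : 2 ≤ s)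
    {c₂ c₃ : ℝ} (hc₂ : 0 ≤ c₂) (hc₃ : 0 ≤ c₃) :
    ∃ c : ℝ, 0 ≤ c ∧ ∀ ε : ℝ, 0 < ε → ε ≤ ε₀ → ∀ K Kb : ℕ,
      K = ⌈c₂ * ε ^ (-(1 / ((s : ℝ) - 1)))⌉₊ → Kb = Nat.clog 2 (⌈c₃ * ε⁻¹⌉₊ + 1) →
      (((decoderWidths n s K (cellDigits n K) Kb).length + 1 : ℕ) : ℝ) ≤ c * Real.log ε⁻¹ ∧
      ∀ r : ℕ, 1 ≤ r → (mlpCount n (decoderWidths n s K (cellDigits n K) Kb) r : ℝ) ≤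
        c * r * ε ^ (-((n : ℝ) / ((s : ℝ) - 1))) * Real.log ε⁻¹ := by
  obtain ⟨c, hc, hcl⟩ := exists_clog_le (C := c₂ + 2) h0 h1
  obtain ⟨c', hc', hcl'⟩ := exists_clog_le (C := c₃ + 2) h0 h1
  set B := Fintype.card (MonomialIdx n s) with hB
  set w := B + 3 with hw
  set D := w + n with hD
  obtain ⟨c₀, hc₀, hcl₀⟩ := exists_const_le_log h0 h1 (a := 1) zero_le_one
  set b : ℝ := n * c + B * c' with hb
  have hb0 : 0 ≤ b := by positivity
  set g : ℝ := 4 * B * D + 8 * B + 1 with hg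
  have hg0 : 0 ≤ g := by positivity
  refine ⟨(b + 2 * c₀) + (c₂ + 2) ^ n * (b * (w * D + w) + g * c₀), by positivity,
    fun ε hε hεε K Kb hK hKb => ?_⟩
  have hx : 1 ≤ ε⁻¹ := (one_le_inv₀ hε).2 (hεε.trans h1.le)
  have hlog : 0 ≤ Real.log ε⁻¹ := Real.log_nonneg hx
  have hs1 : (1 : ℝ) ≤ (s : ℝ) - 1 := by
    have : (2 : ℝ) ≤ s := by exact_mod_cast hs
    linarith
  set X : ℝ := ε ^ (-(1 / ((s : ℝ) - 1))) with hX
  have hXinv : X = ε⁻¹ ^ (1 / ((s : ℝ) - 1)) := by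
    rw [hX, Real.rpow_neg hε.le, Real.inv_rpow hε.le]
  have hX1 : 1 ≤ X := by
    rw [hXinv]
    exact Real.one_le_rpow hx (by positivity)
  have hXle : X ≤ ε⁻¹ := by
    rw [hXinv]
    conv_rhs => rw [← Real.rpow_one ε⁻¹]
    exact Real.rpow_le_rpow_of_exponent_le hx ((div_le_one (by linarith)).2 hs1)
  have hK1 : (((K + 1 : ℕ) : ℕ) : ℝ) ≤ (c₂ + 2) * X := by
    rw [hK]
    push_cast
    exact ceil_mul_add_one_le hc₂ hX1
  have hKε : (((K + 1 : ℕ) : ℕ) : ℝ) ≤ (c₂ + 2) * ε⁻¹ := hK1.trans (by gcongr)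
  have hKbε : (((⌈c₃ * ε⁻¹⌉₊ + 1 : ℕ) : ℕ) : ℝ) ≤ (c₃ + 2) * ε⁻¹ := by
    push_cast
    exact ceil_mul_add_one_le hc₃ hx
  have hd1 := hcl ε hε hεε (K + 1) (by omega) hKε
  have hd2 := hcl' ε hε hεε (⌈c₃ * ε⁻¹⌉₊ + 1) (by omega) hKbε
  rw [← hKb] at hd2
  have hone := hcl₀ ε hε hεε
  set Q := cellDigits n K + B * Kb with hQ
  have hQle : (Q : ℝ) ≤ b * Real.log ε⁻¹ := by
    have : (Q : ℝ) = n * (Nat.clog 2 (K + 1) : ℝ) + B * (Kb : ℝ) := by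
      rw [hQ, cellDigits]
      push_cast
      rfl
    rw [this, hb]
    calc _ ≤ n * (c * Real.log ε⁻¹) + B * (c' * Real.log ε⁻¹) := by gcongr
      _ = _ := by ring
  set M := (K + 1) ^ n with hM
  have hM1 : 1 ≤ M := Nat.one_le_pow _ _ (by omega)
  have hMle : (M : ℝ) ≤ (c₂ + 2) ^ n * ε ^ (-((n : ℝ) / ((s : ℝ) - 1))) := by
    have h2 : ε ^ (-((n : ℝ) / ((s : ℝ) - 1))) = X ^ n := by
      rw [hX, ← Real.rpow_natCast, ← Real.rpow_mul hε.le]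
      congr 1
      ring
    rw [h2, ← mul_pow, hM, Nat.cast_pow]
    exact pow_le_pow_left₀ (by positivity) hK1 n
  constructor
  · have : (decoderWidths n s K (cellDigits n K) Kb).length = Q + 1 := by
      simp [decoderWidths, hQ, hB]
    rw [this]
    push_cast
    have h3 : 0 ≤ (c₂ + 2) ^ n * (b * (w * D + w) + g * c₀) * Real.log ε⁻¹ := by positivity
    linarith
  · intro r hr
    have hcount : mlpCount n (decoderWidths n s K (cellDigits n K) Kb) r ≤
        (r * M) * (Q * (w * D + w) + (4 * B * D + 8 * B + 1)) := by
      refine (mlpCount_replicate_le (D := D) (by omega) Q (by omega)).trans ?_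
      have hrM : 1 ≤ r * M := Nat.mul_pos hr hM1
      have hMr : M ≤ r * M := Nat.le_mul_of_pos_left M hr
      have hrr : r ≤ r * M := Nat.le_mul_of_pos_right r hM1
      change Q * (w * D + w) + (2 * (B * (2 * M)) * D + 2 * (B * (2 * M))) +
        (r * (2 * (B * (2 * M))) + r) ≤ _
      calc _ = 1 * (Q * (w * D + w)) + M * (4 * B * D + 4 * B) + (r * M) * (4 * B) + r := by ring
        _ ≤ (r * M) * (Q * (w * D + w)) + (r * M) * (4 * B * D + 4 * B) + (r * M) * (4 * B) +
            r * M := by gcongr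
        _ = _ := by ring
    calc (mlpCount n (decoderWidths n s K (cellDigits n K) Kb) r : ℝ)
        ≤ (((r * M) * (Q * (w * D + w) + (4 * B * D + 8 * B + 1)) : ℕ) : ℝ) := by
          exact_mod_cast hcount
      _ = r * M * (Q * (w * D + w) + g * 1) := by
          rw [hg]
          push_cast
          ring
      _ ≤ r * ((c₂ + 2) ^ n * ε ^ (-((n : ℝ) / ((s : ℝ) - 1)))) *
            (b * Real.log ε⁻¹ * (w * D + w) + g * (c₀ * Real.log ε⁻¹)) := by gcongr
      _ = ((c₂ + 2) ^ n * (b * (w * D + w) + g * c₀)) *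
            (r * ε ^ (-((n : ℝ) / ((s : ℝ) - 1))) * Real.log ε⁻¹) := by ring
      _ ≤ ((b + 2 * c₀) + (c₂ + 2) ^ n * (b * (w * D + w) + g * c₀)) *
            (r * ε ^ (-((n : ℝ) / ((s : ℝ) - 1))) * Real.log ε⁻¹) := by
          gcongr
          linarith
      _ = _ := by ring

/-! ### Bounds for the solution map -/

section SolutionMap

variable {p q Nh : ℕ} {Θ : Set (EuclideanSpace ℝ (Fin p))} {Θ' : Set (EuclideanSpace ℝ (Fin q))}
  {T m L : ℝ} {G A : Matrix (Fin Nh) (Fin Nh) ℝ}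
  {u : EuclideanSpace ℝ (Fin p) → EuclideanSpace ℝ (Fin q) → ℝ → Fin Nh → ℝ}

theorem measurableSet_domain (hΘ : IsCompact Θ) (hΘ' : IsCompact Θ') :
    MeasurableSet (Θ ×ˢ Θ' ×ˢ Set.Icc (0 : ℝ) T) :=
  hΘ.measurableSet.prod (hΘ'.measurableSet.prod measurableSet_Icc)

theorem isFiniteMeasure_domainMeasure (hΘ : IsCompact Θ) (hΘ' : IsCompact Θ') :
    IsFiniteMeasure (domainMeasure Θ Θ' T) :=
  ⟨by
    rw [domainMeasure, Measure.restrict_apply_univ]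
    exact (hΘ.prod (hΘ'.prod isCompact_Icc)).measure_lt_top⟩

theorem domainMeasure_ne_zero (h : 0 < volume Θ) (h' : 0 < volume Θ') (hT : 0 < T) :
    domainMeasure Θ Θ' T ≠ 0 := by
  rw [domainMeasure, Ne, Measure.restrict_eq_zero, Measure.volume_eq_prod, Measure.prod_prod,
    Measure.volume_eq_prod, Measure.prod_prod, Real.volume_Icc]
  simp [h.ne', h'.ne', hT]

namespace IsSolutionMap

theorem ae_le (hu : IsSolutionMap Θ Θ' T G u m L) :
    ∀ᵐ x ∂domainMeasure Θ Θ' T, m ≤ gNorm G (u x.1 x.2.1 x.2.2) := by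
  rw [← hu.essInf_eq]
  refine ae_essInf_le ?_
  exact ⟨0, Filter.eventually_map.2 (ae_of_all _ fun x => Real.sqrt_nonneg _)⟩

theorem norm_podCoord_sub_le (hu : IsSolutionMap Θ Θ' T G u m L) (hA : Aᵀ * G * A = 1)
    {μ μ' : EuclideanSpace ℝ (Fin p)} (hμ : μ ∈ Θ) (hμ' : μ' ∈ Θ)
    {ν ν' : EuclideanSpace ℝ (Fin q)} (hν : ν ∈ Θ') (hν' : ν' ∈ Θ')
    {t t' : ℝ} (ht : t ∈ Set.Icc 0 T) (ht' : t' ∈ Set.Icc 0 T) :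
    ‖podCoord G A (u μ ν t) - podCoord G A (u μ' ν' t')‖ ≤
      |L| * (‖μ - μ'‖ + ‖ν - ν'‖ + |t - t'|) := by
  rw [← podCoord_sub, ← gNorm_eq_norm_podCoord hA]
  refine (hu.lipschitz μ hμ μ' hμ' ν hν ν' hν' t ht t' ht').trans ?_
  exact mul_le_mul_of_nonneg_right (le_abs_self L) (by positivity)

/-- As the essential infimum of the norm is `m`, the Lipschitz continuity bounds the norm from
above. -/
theorem norm_podCoord_le (hu : IsSolutionMap Θ Θ' T G u m L) (hA : Aᵀ * G * A = 1)
    (hΘvol : 0 < volume Θ) (hΘ'vol : 0 < volume Θ') (hT : 0 < T)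
    (hΘ : IsCompact Θ) (hΘ' : IsCompact Θ') {R : ℝ}
    (hR : ∀ μ ∈ Θ, ∀ i, |μ i| ≤ R) (hR' : ∀ ν ∈ Θ', ∀ i, |ν i| ≤ R) (hTR : T ≤ R)
    {μ : EuclideanSpace ℝ (Fin p)} (hμ : μ ∈ Θ) {ν : EuclideanSpace ℝ (Fin q)} (hν : ν ∈ Θ')
    {t : ℝ} (ht : t ∈ Set.Icc 0 T) :
    ‖podCoord G A (u μ ν t)‖ ≤ m + 1 + |L| * ((p + q + 1) * (2 * R)) := by
  have hD := measurableSet_domain (T := T) hΘ hΘ'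
  have hdist : ∀ {d : ℕ} {x y : EuclideanSpace ℝ (Fin d)}, (∀ i, |x i| ≤ R) → (∀ i, |y i| ≤ R) →
      ‖x - y‖ ≤ d * (2 * R) := by
    intro d x y hx hy
    refine (norm_le_sum_abs _).trans ?_
    refine (Finset.sum_le_sum fun i _ => (?_ : |(x - y) i| ≤ 2 * R)).trans (le_of_eq (by simp))
    have := abs_sub (x i) (y i)
    exact this.trans (by linarith [hx i, hy i])
  have hosc : ∀ x ∈ Θ ×ˢ Θ' ×ˢ Set.Icc 0 T, ∀ y ∈ Θ ×ˢ Θ' ×ˢ Set.Icc 0 T,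
      gNorm G (u x.1 x.2.1 x.2.2) ≤ gNorm G (u y.1 y.2.1 y.2.2) +
        |L| * ((p + q + 1) * (2 * R)) := by
    intro x hx y hy
    have h1 := hu.norm_podCoord_sub_le hA hx.1 hy.1 hx.2.1 hy.2.1 hx.2.2 hy.2.2
    have h2 : ‖x.1 - y.1‖ + ‖x.2.1 - y.2.1‖ + |x.2.2 - y.2.2| ≤ (p + q + 1) * (2 * R) := by
      have e1 := hdist (hR _ hx.1) (hR _ hy.1)
      have e2 := hdist (hR' _ hx.2.1) (hR' _ hy.2.1)
      have e3 : |x.2.2 - y.2.2| ≤ 2 * R := by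
        rw [abs_le]
        constructor <;> linarith [hx.2.2.1, hx.2.2.2, hy.2.2.1, hy.2.2.2]
      linarith
    have h3 := mul_le_mul_of_nonneg_left h2 (abs_nonneg L)
    rw [gNorm_eq_norm_podCoord hA, gNorm_eq_norm_podCoord hA]
    linarith [norm_le_norm_add_norm_sub' (podCoord G A (u x.1 x.2.1 x.2.2))
      (podCoord G A (u y.1 y.2.1 y.2.2))]
  have hx : (μ, ν, t) ∈ Θ ×ˢ Θ' ×ˢ Set.Icc 0 T := ⟨hμ, hν, ht⟩
  have hex : ∃ y ∈ Θ ×ˢ Θ' ×ˢ Set.Icc 0 T, gNorm G (u y.1 y.2.1 y.2.2) < m + 1 := by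
    by_contra hcon
    push Not at hcon
    have : (ae (domainMeasure Θ Θ' T)).NeBot := ae_neBot.2 (domainMeasure_ne_zero hΘvol hΘ'vol hT)
    have hle := le_essInf_of_ae_le (μ := domainMeasure Θ Θ' T)
      (f := fun x => gNorm G (u x.1 x.2.1 x.2.2)) (m + 1)
      (ae_restrict_of_forall_mem hD hcon) (Filter.IsBoundedUnder.isCoboundedUnder_ge
        ⟨_, Filter.eventually_map.2 (ae_restrict_of_forall_mem hD fun y hy => hosc y hy _ hx)⟩)
    rw [hu.essInf_eq] at hle
    linarith
  obtain ⟨y, hy, hlt⟩ := hex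
  have := hosc _ hx y hy
  rw [gNorm_eq_norm_podCoord hA] at this
  exact this.trans (by linarith)

theorem continuousOn_podCoord (hu : IsSolutionMap Θ Θ' T G u m L) (hA : Aᵀ * G * A = 1) :
    ContinuousOn (fun x : EuclideanSpace ℝ (Fin p) × EuclideanSpace ℝ (Fin q) × ℝ =>
      podCoord G A (u x.1 x.2.1 x.2.2)) (Θ ×ˢ Θ' ×ˢ Set.Icc 0 T) := by
  refine LipschitzOnWith.continuousOn (K := Real.toNNReal (|L| * 3))
    (LipschitzOnWith.of_dist_le_mul fun x hx y hy => ?_)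
  rw [dist_eq_norm, dist_eq_norm, Real.coe_toNNReal _ (by positivity)]
  refine (hu.norm_podCoord_sub_le hA hx.1 hy.1 hx.2.1 hy.2.1 hx.2.2 hy.2.2).trans ?_
  rw [mul_assoc]
  refine mul_le_mul_of_nonneg_left ?_ (abs_nonneg L)
  have h1 : ‖x.1 - y.1‖ ≤ ‖x - y‖ := norm_fst_le (x - y)
  have h2 : ‖x.2.1 - y.2.1‖ ≤ ‖x - y‖ := (norm_fst_le (x - y).2).trans (norm_snd_le (x - y))
  have h3 : |x.2.2 - y.2.2| ≤ ‖x - y‖ := (norm_snd_le (x - y).2).trans (norm_snd_le (x - y))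
  linarith

end IsSolutionMap

theorem IsLipschitzOptimalDOD.norm_sub_le {r N : ℕ} {ν : Fin N → EuclideanSpace ℝ (Fin q)}
    {Lhat : ℝ} {σ : EuclideanSpace ℝ (Fin p) → ℝ → Matrix (Fin Nh) (Fin r) ℝ}
    (hσ : IsLipschitzOptimalDOD Θ Θ' T G u A ν Lhat σ)
    {μ μ' : EuclideanSpace ℝ (Fin p)} (hμ : μ ∈ Θ) (hμ' : μ' ∈ Θ)
    {t t' : ℝ} (ht : t ∈ Set.Icc 0 T) (ht' : t' ∈ Set.Icc 0 T) :
    √(∑ i, ∑ j, (σ μ t - σ μ' t') i j ^ 2) ≤ |Lhat| * (‖μ - μ'‖ + |t - t'|) :=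
  (hσ.lipschitz μ hμ μ' hμ' t ht t' ht').trans
    (mul_le_mul_of_nonneg_right (le_abs_self _) (by positivity))

theorem IsLipschitzOptimalDOD.continuousOn {r N : ℕ} {ν : Fin N → EuclideanSpace ℝ (Fin q)}
    {Lhat : ℝ} {σ : EuclideanSpace ℝ (Fin p) → ℝ → Matrix (Fin Nh) (Fin r) ℝ}
    (hσ : IsLipschitzOptimalDOD Θ Θ' T G u A ν Lhat σ) :
    ContinuousOn (fun x : EuclideanSpace ℝ (Fin p) × EuclideanSpace ℝ (Fin q) × ℝ =>
      σ x.1 x.2.2) (Θ ×ˢ Θ' ×ˢ Set.Icc 0 T) := by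
  refine continuousOn_pi.2 fun i => continuousOn_pi.2 fun j => ?_
  refine LipschitzOnWith.continuousOn (K := Real.toNNReal (|Lhat| * 2))
    (LipschitzOnWith.of_dist_le_mul fun x hx y hy => ?_)
  rw [dist_eq_norm, dist_eq_norm, Real.coe_toNNReal _ (by positivity)]
  have h0 : ‖σ x.1 x.2.2 i j - σ y.1 y.2.2 i j‖ ≤
      √(∑ i, ∑ j, (σ x.1 x.2.2 - σ y.1 y.2.2) i j ^ 2) := by
    refine Real.abs_le_sqrt ?_
    refine le_trans ?_ (Finset.single_le_sum (f := fun i => ∑ j,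
      (σ x.1 x.2.2 - σ y.1 y.2.2) i j ^ 2) (fun i _ => by positivity) (Finset.mem_univ i))
    exact Finset.single_le_sum (f := fun j => (σ x.1 x.2.2 - σ y.1 y.2.2) i j ^ 2)
      (fun i _ => by positivity) (Finset.mem_univ j)
  refine h0.trans ((hσ.norm_sub_le hx.1 hy.1 hx.2.2 hy.2.2).trans ?_)
  rw [mul_assoc]
  refine mul_le_mul_of_nonneg_left ?_ (abs_nonneg _)
  have h1 : ‖x.1 - y.1‖ ≤ ‖x - y‖ := norm_fst_le (x - y)
  have h3 : |x.2.2 - y.2.2| ≤ ‖x - y‖ := (norm_snd_le (x - y).2).trans (norm_snd_le (x - y))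
  linarith

/-! ### Integration over the parameter domain -/

/-- Fubini's theorem for the parameter domain, with the innermost integral over `Θ'`. -/
theorem lintegral_domainMeasure_le (hΘ : IsCompact Θ) (hΘ' : IsCompact Θ') (hT : 0 ≤ T)
    {f : EuclideanSpace ℝ (Fin p) × EuclideanSpace ℝ (Fin q) × ℝ → ℝ}
    (hf : ContinuousOn f (Θ ×ˢ Θ' ×ˢ Set.Icc 0 T)) {c : ℝ} (hc0 : 0 ≤ c)
    (hc : ∀ μ ∈ Θ, ∀ t ∈ Set.Icc 0 T, ∫⁻ ν in Θ', ENNReal.ofReal (f (μ, ν, t)) ≤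
      ENNReal.ofReal c) :
    ∫⁻ x, ENNReal.ofReal (f x) ∂domainMeasure Θ Θ' T ≤
      ENNReal.ofReal (c * (volume.real Θ * T)) := by
  have hD := measurableSet_domain (T := T) hΘ hΘ'
  classical
  set h : EuclideanSpace ℝ (Fin p) × EuclideanSpace ℝ (Fin q) × ℝ → ℝ≥0∞ :=
    (Θ ×ˢ Θ' ×ˢ Set.Icc 0 T).indicator fun x => ENNReal.ofReal (f x) with hh
  have hhm : Measurable h := by
    have : h = fun x => ENNReal.ofReal ((Θ ×ˢ Θ' ×ˢ Set.Icc 0 T).indicator f x) := by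
      funext x
      by_cases hx : x ∈ Θ ×ˢ Θ' ×ˢ Set.Icc 0 T <;> simp [hh, hx]
    rw [this]
    have hpw := hf.measurable_piecewise (g := 0) continuousOn_const hD
    rw [Set.piecewise_eq_indicator] at hpw
    exact hpw.ennreal_ofReal
  have hswap : ∫⁻ x, ENNReal.ofReal (f x) ∂domainMeasure Θ Θ' T =
      ∫⁻ μ, ∫⁻ t, ∫⁻ ν, h (μ, ν, t) := by
    rw [domainMeasure, ← lintegral_indicator hD, Measure.volume_eq_prod,
      lintegral_prod _ hhm.aemeasurable]
    refine lintegral_congr fun μ => ?_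
    rw [Measure.volume_eq_prod]
    exact lintegral_prod_symm' (fun y => h (μ, y)) (hhm.comp measurable_prodMk_left)
  have hin : ∀ μ t, ∫⁻ ν, h (μ, ν, t) ≤
      Θ.indicator (fun _ => (Set.Icc 0 T).indicator (fun _ => ENNReal.ofReal c) t) μ := by
    intro μ t
    by_cases hμ : μ ∈ Θ
    · by_cases ht : t ∈ Set.Icc 0 T
      · rw [Set.indicator_of_mem hμ, Set.indicator_of_mem ht]
        refine le_trans (le_of_eq ?_) (hc μ hμ t ht)
        rw [← lintegral_indicator hΘ'.measurableSet]
        refine lintegral_congr fun ν => ?_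
        by_cases hν : ν ∈ Θ'
        · rw [Set.indicator_of_mem hν]
          exact Set.indicator_of_mem (show (μ, ν, t) ∈ Θ ×ˢ Θ' ×ˢ Set.Icc 0 T from ⟨hμ, hν, ht⟩) _
        · rw [Set.indicator_of_notMem hν]
          exact Set.indicator_of_notMem (fun hx => hν hx.2.1) _
      · have : ∀ ν, h (μ, ν, t) = 0 := fun ν =>
          Set.indicator_of_notMem (fun hx => ht hx.2.2) _
        simp [this]
    · have : ∀ ν, h (μ, ν, t) = 0 := fun ν => Set.indicator_of_notMem (fun hx => hμ hx.1) _
      simp [this]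
  rw [hswap]
  refine (lintegral_mono fun μ => lintegral_mono fun t => hin μ t).trans ?_
  have hin' : ∀ μ, ∫⁻ t, Θ.indicator (fun _ => (Set.Icc 0 T).indicator
      (fun _ => ENNReal.ofReal c) t) μ =
      Θ.indicator (fun _ => ENNReal.ofReal c * ENNReal.ofReal T) μ := by
    intro μ
    by_cases hμ : μ ∈ Θ
    · simp only [Set.indicator_of_mem hμ]
      rw [lintegral_indicator_const measurableSet_Icc, Real.volume_Icc, sub_zero]
    · simp [Set.indicator_of_notMem hμ]
  simp only [hin']
  rw [lintegral_indicator_const hΘ.measurableSet, ← ENNReal.ofReal_mul hc0,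
    ← ENNReal.ofReal_toReal hΘ.measure_lt_top.ne, ← ENNReal.ofReal_mul (by positivity)]
  refine ENNReal.ofReal_le_ofReal (le_of_eq ?_)
  rw [measureReal_def]
  ring

/-- The points at which a finite family of functions takes small negative values form a set of small
measure. -/
theorem exists_measure_Ioo_preimage_le {X J : Type*} [MeasurableSpace X] [Finite J]
    (P : Measure X) [IsFiniteMeasure P] {f : J → X → ℝ} (hf : ∀ j, Measurable (f j)) {η : ℝ≥0∞}
    (hη : 0 < η) :
    ∃ τ : ℝ, 0 < τ ∧ MeasurableSet {x | ∃ j, f j x ∈ Set.Ioo (-τ) 0} ∧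
      P {x | ∃ j, f j x ∈ Set.Ioo (-τ) 0} < η := by
  let s : ℕ → Set X := fun k => {x | ∃ j, f j x ∈ Set.Ioo (-(1 / ((k : ℝ) + 1))) 0}
  have hs : ∀ k, MeasurableSet (s k) := by
    intro k
    have : s k = ⋃ j, f j ⁻¹' Set.Ioo (-(1 / ((k : ℝ) + 1))) 0 := by
      ext x
      simp [s]
    rw [this]
    exact MeasurableSet.iUnion fun j => hf j measurableSet_Ioo
  have hanti : Antitone s := by
    rintro k l hkl x ⟨j, h1, h2⟩
    exact ⟨j, lt_of_le_of_lt (neg_le_neg (Nat.one_div_le_one_div hkl)) h1, h2⟩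
  have hempty : ⋂ k, s k = ∅ := by
    refine Set.eq_empty_of_forall_notMem fun x hx => ?_
    rw [Set.mem_iInter] at hx
    choose j hj using hx
    obtain ⟨i, hi⟩ := Finite.exists_infinite_fiber j
    have hneg : f i x < 0 := by
      obtain ⟨k, hk⟩ := (Set.infinite_coe_iff.1 hi).nonempty
      have := (hj k).2
      rwa [hk] at this
    obtain ⟨K, hK⟩ := exists_nat_one_div_lt (neg_pos.2 hneg)
    obtain ⟨k, hk, hKk⟩ := (Set.infinite_coe_iff.1 hi).exists_gt K
    have h1 := (hj k).1
    rw [hk] at h1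
    have h2 : 1 / ((k : ℝ) + 1) ≤ 1 / ((K : ℝ) + 1) := Nat.one_div_le_one_div hKk.le
    linarith
  have hlim := tendsto_measure_iInter_atTop (μ := P) (fun k => (hs k).nullMeasurableSet) hanti
    ⟨0, measure_ne_top _ _⟩
  rw [hempty, measure_empty] at hlim
  obtain ⟨k, hk⟩ := (hlim.eventually_lt_const hη).exists
  exact ⟨1 / ((k : ℝ) + 1), by positivity, hs k, hk⟩

/-- The relative error is controlled by the projection error, by a uniform error on a good set and
by a crude bound on its complement. -/
theorem relativeError_lt (hu : IsSolutionMap Θ Θ' T G u m L) (hm : 0 < m)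
    (hΘ : IsCompact Θ) (hΘ' : IsCompact Θ') (hT : 0 ≤ T)
    {uhat : EuclideanSpace ℝ (Fin p) → EuclideanSpace ℝ (Fin q) → ℝ → Fin Nh → ℝ}
    {f : EuclideanSpace ℝ (Fin p) × EuclideanSpace ℝ (Fin q) × ℝ → ℝ}
    (hf : ContinuousOn f (Θ ×ˢ Θ' ×ˢ Set.Icc 0 T)) {c β B ε : ℝ}
    (hc0 : 0 ≤ c) (hε : 0 < ε)
    (hc : ∀ μ ∈ Θ, ∀ t ∈ Set.Icc 0 T, ∫⁻ ν in Θ', ENNReal.ofReal (f (μ, ν, t) ^ 2) ≤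
      ENNReal.ofReal c)
    {bad : Set (EuclideanSpace ℝ (Fin p) × EuclideanSpace ℝ (Fin q) × ℝ)}
    (hbad : MeasurableSet bad)
    (hgood : ∀ x ∈ Θ ×ˢ Θ' ×ˢ Set.Icc 0 T, x ∉ bad →
      gNorm G (u x.1 x.2.1 x.2.2 - uhat x.1 x.2.1 x.2.2) ≤ f x + β)
    (hB : ∀ x ∈ Θ ×ˢ Θ' ×ˢ Set.Icc 0 T,
      gNorm G (u x.1 x.2.1 x.2.2 - uhat x.1 x.2.1 x.2.2) ≤ B)
    (hsmall : 2 / m ^ 2 * c * (volume.real Θ * T) +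
      2 * β ^ 2 / m ^ 2 * (domainMeasure Θ Θ' T).real Set.univ ≤ ε ^ 2 / 2)
    (hbadμ : ENNReal.ofReal (B ^ 2 / m ^ 2) * domainMeasure Θ Θ' T bad <
      ENNReal.ofReal (ε ^ 2 / 2)) :
    relativeError Θ Θ' T G u uhat < ENNReal.ofReal ε := by
  have hD := measurableSet_domain (T := T) hΘ hΘ'
  have hfin := isFiniteMeasure_domainMeasure (T := T) hΘ hΘ'
  have hm2 : 0 < m ^ 2 := by positivity
  have hpt : ∀ᵐ x ∂domainMeasure Θ Θ' T,
      ENNReal.ofReal (gNorm G (u x.1 x.2.1 x.2.2 - uhat x.1 x.2.1 x.2.2) ^ 2 /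
        gNorm G (u x.1 x.2.1 x.2.2) ^ 2) ≤
      (ENNReal.ofReal (2 / m ^ 2 * f x ^ 2) + ENNReal.ofReal (2 * β ^ 2 / m ^ 2)) +
        bad.indicator (fun _ => ENNReal.ofReal (B ^ 2 / m ^ 2)) x := by
    filter_upwards [hu.ae_le, ae_restrict_mem hD] with x hx hxD
    have h0 : 0 ≤ gNorm G (u x.1 x.2.1 x.2.2 - uhat x.1 x.2.1 x.2.2) := Real.sqrt_nonneg _
    have hle : gNorm G (u x.1 x.2.1 x.2.2 - uhat x.1 x.2.1 x.2.2) ^ 2 /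
        gNorm G (u x.1 x.2.1 x.2.2) ^ 2 ≤
        gNorm G (u x.1 x.2.1 x.2.2 - uhat x.1 x.2.1 x.2.2) ^ 2 / m ^ 2 := by
      gcongr
    by_cases hxb : x ∈ bad
    · rw [Set.indicator_of_mem hxb]
      refine le_trans (ENNReal.ofReal_le_ofReal (hle.trans ?_)) le_add_self
      have := hB x hxD
      gcongr
    · rw [Set.indicator_of_notMem hxb, add_zero,
        ← ENNReal.ofReal_add (by positivity) (by positivity)]
      refine ENNReal.ofReal_le_ofReal (hle.trans ?_)
      have h1 := hgood x hxD hxb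
      have h2 : gNorm G (u x.1 x.2.1 x.2.2 - uhat x.1 x.2.1 x.2.2) ^ 2 ≤
          2 * f x ^ 2 + 2 * β ^ 2 := by
        have h3 := pow_le_pow_left₀ h0 h1 2
        nlinarith [sq_nonneg (f x - β)]
      calc _ ≤ (2 * f x ^ 2 + 2 * β ^ 2) / m ^ 2 := by gcongr
        _ = _ := by ring
  have hf2 : ContinuousOn (fun x => 2 / m ^ 2 * f x ^ 2) (Θ ×ˢ Θ' ×ˢ Set.Icc 0 T) :=
    continuousOn_const.mul (hf.pow 2)
  have hI : ∫⁻ x, ENNReal.ofReal (2 / m ^ 2 * f x ^ 2) ∂domainMeasure Θ Θ' T ≤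
      ENNReal.ofReal (2 / m ^ 2 * c * (volume.real Θ * T)) := by
    refine lintegral_domainMeasure_le hΘ hΘ' hT hf2 (by positivity) fun μ hμ t ht => ?_
    have hk : (0 : ℝ) ≤ 2 / m ^ 2 := by positivity
    simp only [ENNReal.ofReal_mul hk]
    rw [lintegral_const_mul' _ _ ENNReal.ofReal_ne_top]
    gcongr
    exact hc μ hμ t ht
  have htot : ∫⁻ x, ENNReal.ofReal (gNorm G (u x.1 x.2.1 x.2.2 - uhat x.1 x.2.1 x.2.2) ^ 2 /
        gNorm G (u x.1 x.2.1 x.2.2) ^ 2) ∂domainMeasure Θ Θ' T < ENNReal.ofReal (ε ^ 2) := by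
    refine (lintegral_mono_ae hpt).trans_lt ?_
    rw [lintegral_add_right _ (measurable_const.indicator hbad),
      lintegral_add_right _ measurable_const, lintegral_const, lintegral_indicator_const hbad]
    have hconst : ENNReal.ofReal (2 * β ^ 2 / m ^ 2) * domainMeasure Θ Θ' T Set.univ =
        ENNReal.ofReal (2 * β ^ 2 / m ^ 2 * (domainMeasure Θ Θ' T).real Set.univ) := by
      rw [ENNReal.ofReal_mul (by positivity), measureReal_def,
        ENNReal.ofReal_toReal (measure_ne_top _ _)]
    have hfirst : ∫⁻ x, ENNReal.ofReal (2 / m ^ 2 * f x ^ 2) ∂domainMeasure Θ Θ' T +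
        ENNReal.ofReal (2 * β ^ 2 / m ^ 2) * domainMeasure Θ Θ' T Set.univ ≤
        ENNReal.ofReal (ε ^ 2 / 2) := by
      rw [hconst]
      refine (add_le_add_left hI _).trans ?_
      rw [← ENNReal.ofReal_add (by positivity) (by positivity)]
      exact ENNReal.ofReal_le_ofReal hsmall
    have hhalf : ENNReal.ofReal (ε ^ 2) =
        ENNReal.ofReal (ε ^ 2 / 2) + ENNReal.ofReal (ε ^ 2 / 2) := by
      rw [← ENNReal.ofReal_add (by positivity) (by positivity), add_halves]
    rw [hhalf]
    exact ENNReal.add_lt_add_of_le_of_lt (ne_top_of_le_ne_top ENNReal.ofReal_ne_top hfirst)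
      hfirst hbadμ
  rw [relativeError]
  refine (ENNReal.rpow_lt_rpow htot (by norm_num)).trans_eq ?_
  rw [ENNReal.ofReal_rpow_of_pos (by positivity), ← Real.sqrt_eq_rpow, Real.sqrt_sq hε.le]

end SolutionMap

/-! ### The architectures and their weights -/

/-- An inner DOD module that looks up a matrix for each of the `(K + 1) ^ (p + 1)` cells. The seed
computes the index of the cell. -/
def lookupDOD (p NA r K : ℕ) : DODArch p NA r where
  l := 1
  seed := mlpArch (p + 1) [2 * ((p + 1) * K)] 1
  root _ := mlpArch 1 [2 * (K + 1) ^ (p + 1)] NA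

theorem lookupDOD_layers_le (p NA r K : ℕ) : (lookupDOD p NA r K).layers ≤ 4 :=
  Nat.add_le_add_left (m := 2) (Finset.sup_le fun _ _ => le_rfl) 2

theorem lookupDOD_activeWeights_le (p NA r K : ℕ) :
    (lookupDOD p NA r K).activeWeights ≤ r * (mlpCount (p + 1) [2 * ((p + 1) * K)] 1 +
      mlpCount 1 [2 * (K + 1) ^ (p + 1)] NA) := by
  rw [DODArch.activeWeights]
  refine (Finset.sum_le_card_nsmul _ _ (mlpCount (p + 1) [2 * ((p + 1) * K)] 1 +
      mlpCount 1 [2 * (K + 1) ^ (p + 1)] NA) fun j _ => ?_).trans (le_of_eq (by simp))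
  rw [add_comm]
  exact Nat.add_le_add (mlpArch_activeWeights_le _ _ _) (mlpArch_activeWeights_le _ _ _)

/-- The Gram-Schmidt process does not change the matrices in the table, which are orthonormal; thus
the module is exact wherever the index of the cell is. -/
theorem lookupDOD_exists_weights {p NA r K : ℕ} (R τ : ℝ)
    (S : Fin ((K + 1) ^ (p + 1)) → Matrix (Fin NA) (Fin r) ℝ) :
    ∃ θ : (lookupDOD p NA r K).Weights,
      (∀ x j, ‖WithLp.toLp 2 (fun i => DODArch.realize θ x i j)‖ ≤ 1) ∧
      ∀ x, rampIdx K R τ x = (cellIdx K R x : ℕ) →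
        (S (cellIdx K R x))ᵀ * S (cellIdx K R x) = 1 →
          DODArch.realize θ x = S (cellIdx K R x) := by
  let f : Fin r → ℕ → Fin NA → ℝ := fun j b i =>
    if h : b < (K + 1) ^ (p + 1) then S ⟨b, h⟩ i j else 0
  obtain ⟨θs, hs⟩ := (isMLP_rampIdx (p + 1) K R τ).exists_weights (Equiv.refl _) (Equiv.refl _)
  choose θr hr using fun j => (isMLP_lookup ((K + 1) ^ (p + 1)) (f j)).exists_weights
    (Equiv.refl _) (Equiv.refl _)
  let θ : (lookupDOD p NA r K).Weights := ⟨θs, θr⟩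
  have hcol : ∀ x j, WithLp.toLp 2 (fun i => DODArch.realize θ x i j) =
      InnerProductSpace.gramSchmidtNormed ℝ (fun j : Fin r => WithLp.toLp 2
        (lookup ((K + 1) ^ (p + 1)) (f j) (rampIdx K R τ x))) j := by
    intro x j
    have : ∀ j, ReLUArch.realize (θ.root j) (ReLUArch.realize θ.seed x) =
        lookup ((K + 1) ^ (p + 1)) (f j) (rampIdx K R τ x) := by
      intro j
      funext i
      refine (hr j _ i).trans ?_
      have h0 : ReLUArch.realize θs x 0 = rampIdx K R τ x := hs x 0
      simp only [Equiv.refl_apply]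
      exact congrArg (fun y => lookup ((K + 1) ^ (p + 1)) (f j) y i) h0
    simp only [DODArch.realize, this]
  refine ⟨θ, fun x j => ?_, fun x hx hS => ?_⟩
  · rw [hcol]
    exact norm_gramSchmidtNormed_le _ _
  · have hf : (fun j : Fin r => WithLp.toLp 2
        (lookup ((K + 1) ^ (p + 1)) (f j) (rampIdx K R τ x))) =
        fun j => WithLp.toLp 2 (fun i => S (cellIdx K R x) i j) := by
      funext j
      rw [hx, lookup_natCast _ (cellIdx K R x).2]
      congr 1
      funext i
      exact dif_pos (cellIdx K R x).2
    ext i j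
    have h1 := hcol x j
    rw [hf, gramSchmidtNormed_of_orthonormal (orthonormal_columns hS)] at h1
    exact congrArg (fun v : EuclideanSpace ℝ (Fin NA) => v i) h1

/-- The architecture of the decoder. It has no hidden layer if there is nothing to approximate. -/
noncomputable def decoderArch (n s K Kb r : ℕ) : ReLUArch n r :=
  mlpArch n (if n = 0 ∨ r = 0 then [] else decoderWidths n s K (cellDigits n K) Kb) r

/-- The architecture of the feedforward network: the index of a cell, followed by a table. -/
def feedforwardArch (d K n : ℕ) : ReLUArch d n :=
  mlpArch d (if n = 0 then [] else [2 * (d * K), 1, 2 * (K + 1) ^ d]) n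

/-- The decoder and the feedforward network together map the cell `k` to an approximate value of
`χ` at `z k`, where the points `z k` are arbitrary. The composition factors through the approximate
index of the cell, which carries the only dependence on the width `τ` of the ramps. -/
theorem HasBoundedPartials.exists_reduced_weights {d n r s : ℕ} (hs : 2 ≤ s) {C R R₂ : ℝ}
    (hC : 0 ≤ C) (hR₂ : 0 < R₂) {χ : EuclideanSpace ℝ (Fin n) → EuclideanSpace ℝ (Fin r)}
    (hχ : HasBoundedPartials s C χ) (Kx Kz Kb : ℕ)
    {z : Fin ((Kx + 1) ^ d) → EuclideanSpace ℝ (Fin n)} (hz : ∀ k i, |z k i| ≤ R₂) :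
    ∃ g : ℝ → Fin r → ℝ, Continuous g ∧
      (∀ k : Fin ((Kx + 1) ^ d), ‖χ (z k) - WithLp.toLp 2 (g (k : ℕ))‖ ≤
        C * (n * (2 * R₂ / (Kz + 1))) ^ (s - 1) +
          Fintype.card (MonomialIdx n s) * (C * (1 + 2 * R₂) ^ s / 2 ^ Kb)) ∧
      ∀ τ : ℝ, ∃ (θΨ : (decoderArch n s Kz Kb r).Weights) (θΦ : (feedforwardArch d Kx n).Weights),
        ∀ x, ReLUArch.realize θΨ (ReLUArch.realize θΦ x) = g (rampIdx Kx R τ x) := by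
  by_cases h : n = 0 ∨ r = 0
  · refine ⟨fun _ => (χ 0).ofLp, continuous_const, fun k => ?_, fun τ => ?_⟩
    · have h0 : χ (z k) = χ 0 := by
        rcases h with rfl | rfl
        · exact congrArg χ (Subsingleton.elim _ _)
        · exact Subsingleton.elim _ _
      rw [h0, WithLp.toLp_ofLp, sub_self, norm_zero]
      positivity
    · have hconst : IsMLP [] (fun (_ : Fin n → ℝ) => (χ 0).ofLp) := fun i => .const _
      obtain ⟨θ, hθ⟩ := hconst.exists_weights (Equiv.refl _) (Equiv.refl _)
      have harch : decoderArch n s Kz Kb r = mlpArch n [] r := by rw [decoderArch, if_pos h]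
      rw [harch]
      exact ⟨θ, ⟨fun _ _ => 0, fun _ _ => 0⟩, fun x => funext fun i => hθ _ i⟩
  · push Not at h
    have hn : 0 < n := Nat.pos_of_ne_zero h.1
    obtain ⟨G, hG, hGz⟩ := hχ.exists_decoder hn hs hC hR₂ Kz Kb (pow_le_two_pow_cellDigits n Kz)
    choose t ht using fun k => hGz (z k) (hz k)
    let f : ℕ → Fin n → ℝ := fun b _ => if hb : b < (Kx + 1) ^ d then t ⟨b, hb⟩ else 0
    refine ⟨fun y => G (lookup ((Kx + 1) ^ d) f y), hG.continuous.comp (continuous_lookup _ _),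
      fun k => ?_, fun τ => ?_⟩
    · have hf : lookup ((Kx + 1) ^ d) f (k : ℕ) = fun _ => t k := by
        rw [lookup_natCast _ k.2]
        funext i
        exact dif_pos k.2
      simp only [hf]
      exact ht k
    · have harch : decoderArch n s Kz Kb r =
          mlpArch n (decoderWidths n s Kz (cellDigits n Kz) Kb) r := by
        rw [decoderArch, if_neg (by tauto)]
      have harch' : feedforwardArch d Kx n = mlpArch d [2 * (d * Kx), 1, 2 * (Kx + 1) ^ d] n := by
        rw [feedforwardArch, if_neg h.1]
      obtain ⟨θ, hθ⟩ := hG.exists_weights (Equiv.refl _) (Equiv.refl _)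
      obtain ⟨θ', hθ'⟩ := (isMLP_lookup_rampIdx d Kx R τ ((Kx + 1) ^ d) f).exists_weights
        (Equiv.refl _) (Equiv.refl _)
      rw [harch, harch']
      refine ⟨θ, θ', fun x => ?_⟩
      have h1 : ReLUArch.realize θ' x = lookup ((Kx + 1) ^ d) f (rampIdx Kx R τ x) :=
        funext fun i => hθ' x i
      rw [h1]
      exact funext fun i => hθ _ i

/-! ### The error of the DOD-DL-ROM -/

/-- The error at a point, when the matrix `S` of the point is replaced by `S₁` and the coordinates
`Sᵀ x` by an approximation `y` of the coordinates `S₂ᵀ x₂` of another point. -/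
theorem norm_sub_mulVec_le {a b : ℕ} {S S₁ S₂ : Matrix (Fin a) (Fin b) ℝ}
    (h : Sᵀ * S = 1) (h₁ : S₁ᵀ * S₁ = 1) (h₂ : S₂ᵀ * S₂ = 1) (x x₂ : EuclideanSpace ℝ (Fin a))
    (y : Fin b → ℝ) :
    ‖x - WithLp.toLp 2 (S₁ *ᵥ y)‖ ≤ ‖projResidual S x‖ +
      (√(∑ i, ∑ j, (S - S₁) i j ^ 2) * ‖x‖ + √(∑ i, ∑ j, (S - S₂) i j ^ 2) * ‖x‖ +
        ‖x - x₂‖ + ‖WithLp.toLp 2 (S₂ᵀ *ᵥ x₂.ofLp) - WithLp.toLp 2 y‖) := by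
  have hsplit : x - WithLp.toLp 2 (S₁ *ᵥ y) = projResidual S x +
      (WithLp.toLp 2 ((S - S₁) *ᵥ (Sᵀ *ᵥ x.ofLp)) +
        WithLp.toLp 2 (S₁ *ᵥ ((S - S₂)ᵀ *ᵥ x.ofLp + S₂ᵀ *ᵥ (x - x₂).ofLp +
          (S₂ᵀ *ᵥ x₂.ofLp - y)))) := by
    apply (WithLp.equiv 2 _).injective
    simp only [WithLp.equiv_apply, projResidual, WithLp.ofLp_add, WithLp.ofLp_sub,
      Matrix.transpose_sub, Matrix.sub_mulVec, Matrix.mulVec_add, Matrix.mulVec_sub]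
    abel
  have e1 : ‖WithLp.toLp 2 ((S - S₁) *ᵥ (Sᵀ *ᵥ x.ofLp))‖ ≤
      √(∑ i, ∑ j, (S - S₁) i j ^ 2) * ‖x‖ :=
    (norm_toLp_mulVec_le _ _).trans (mul_le_mul_of_nonneg_left
      (norm_toLp_transpose_mulVec_le_of_orthonormal h x) (Real.sqrt_nonneg _))
  have e2 : ‖WithLp.toLp 2 ((S - S₂)ᵀ *ᵥ x.ofLp)‖ ≤ √(∑ i, ∑ j, (S - S₂) i j ^ 2) * ‖x‖ :=
    norm_toLp_transpose_mulVec_le _ _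
  have e3 : ‖WithLp.toLp 2 (S₂ᵀ *ᵥ (x - x₂).ofLp)‖ ≤ ‖x - x₂‖ :=
    norm_toLp_transpose_mulVec_le_of_orthonormal h₂ _
  rw [hsplit]
  refine (norm_add_le _ _).trans (add_le_add le_rfl ((norm_add_le _ _).trans ?_))
  rw [norm_toLp_mulVec_of_orthonormal h₁, WithLp.toLp_add, WithLp.toLp_add, WithLp.toLp_sub]
  have e4 := norm_add₃_le (a := WithLp.toLp 2 ((S - S₂)ᵀ *ᵥ x.ofLp))
    (b := WithLp.toLp 2 (S₂ᵀ *ᵥ (x - x₂).ofLp))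
    (c := WithLp.toLp 2 (S₂ᵀ *ᵥ x₂.ofLp) - WithLp.toLp 2 y)
  linarith

theorem exists_representatives {X Y : Type*} [Nonempty X] (D : Set X) (idx : X → Y) :
    ∃ rep : Y → X, ∀ x ∈ D, rep (idx x) ∈ D ∧ idx (rep (idx x)) = idx x :=
  ⟨Function.invFunOn idx D, fun x hx =>
    ⟨Function.invFunOn_mem ⟨x, hx, rfl⟩, Function.invFunOn_eq ⟨x, hx, rfl⟩⟩⟩

theorem abs_append_le {a b : ℕ} {f : Fin a → ℝ} {g : Fin b → ℝ} {R : ℝ} (hf : ∀ i, |f i| ≤ R)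
    (hg : ∀ i, |g i| ≤ R) (i : Fin (a + b)) : |Fin.append f g i| ≤ R := by
  refine Fin.addCases (fun i => ?_) (fun i => ?_) i
  · simpa using hf i
  · simpa using hg i

theorem sum_abs_append_sub {a b : ℕ} (f f' : Fin a → ℝ) (g g' : Fin b → ℝ) :
    ∑ i, |Fin.append f g i - Fin.append f' g' i| =
      ∑ i, |f i - f' i| + ∑ i, |g i - g' i| := by
  rw [Fin.sum_univ_add]
  simp

theorem sum_abs_sub_le_of_cellIdx_eq {d K : ℕ} {R : ℝ} (hR : 0 < R) {x y : Fin d → ℝ}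
    (hx : ∀ i, |x i| ≤ R) (hy : ∀ i, |y i| ≤ R) (h : cellIdx K R x = cellIdx K R y) :
    ∑ i, |x i - y i| ≤ d * (2 * R / (K + 1)) :=
  (Finset.sum_le_sum fun i _ => abs_sub_le_of_cellIdx_eq hR hx hy h i).trans (le_of_eq (by simp))

section Rom

variable {p q n Nh N r s s' : ℕ} {Θ : Set (EuclideanSpace ℝ (Fin p))}
  {Θ' : Set (EuclideanSpace ℝ (Fin q))} {T m L Lhat : ℝ} {G A : Matrix (Fin Nh) (Fin Nh) ℝ}
  {u : EuclideanSpace ℝ (Fin p) → EuclideanSpace ℝ (Fin q) → ℝ → Fin Nh → ℝ}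
  {ν : Fin N → EuclideanSpace ℝ (Fin q)}
  {σ : EuclideanSpace ℝ (Fin p) → ℝ → Matrix (Fin Nh) (Fin r) ℝ}

/-- The input of the inner DOD module. -/
abbrev dodInput (μ : EuclideanSpace ℝ (Fin p)) (t : ℝ) : Fin (p + 1) → ℝ :=
  Fin.append (fun i => μ i) ![t]

/-- The input of the feedforward network. -/
abbrev romInput (μ : EuclideanSpace ℝ (Fin p)) (ν : EuclideanSpace ℝ (Fin q)) (t : ℝ) :
    Fin (p + q + 1) → ℝ :=
  Fin.append (Fin.append (fun i => μ i) (fun i => ν i)) ![t]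

theorem dist_le_of_dodInput_cellIdx_eq {K : ℕ} {R : ℝ} (hR : 0 < R)
    {μ μ' : EuclideanSpace ℝ (Fin p)} (hμ : ∀ i, |μ i| ≤ R) (hμ' : ∀ i, |μ' i| ≤ R) {t t' : ℝ}
    (ht : |t| ≤ R) (ht' : |t'| ≤ R)
    (h : cellIdx K R (dodInput μ t) = cellIdx K R (dodInput μ' t')) :
    ‖μ - μ'‖ + |t - t'| ≤ (p + 1) * (2 * R / (K + 1)) := by
  have h1 := sum_abs_sub_le_of_cellIdx_eq hR (abs_append_le hμ fun i => by simpa using ht)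
    (abs_append_le hμ' fun i => by simpa using ht') h
  rw [sum_abs_append_sub] at h1
  have h2 := norm_le_sum_abs (μ - μ')
  simp only [PiLp.sub_apply, Fin.sum_univ_one, Matrix.cons_val_fin_one, Nat.cast_add,
    Nat.cast_one] at h1 h2
  linarith

theorem dist_le_of_romInput_cellIdx_eq {K : ℕ} {R : ℝ} (hR : 0 < R)
    {μ μ' : EuclideanSpace ℝ (Fin p)} (hμ : ∀ i, |μ i| ≤ R) (hμ' : ∀ i, |μ' i| ≤ R)
    {ν ν' : EuclideanSpace ℝ (Fin q)} (hν : ∀ i, |ν i| ≤ R) (hν' : ∀ i, |ν' i| ≤ R) {t t' : ℝ}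
    (ht : |t| ≤ R) (ht' : |t'| ≤ R)
    (h : cellIdx K R (romInput μ ν t) = cellIdx K R (romInput μ' ν' t')) :
    ‖μ - μ'‖ + ‖ν - ν'‖ + |t - t'| ≤ (p + q + 1) * (2 * R / (K + 1)) := by
  have h1 := sum_abs_sub_le_of_cellIdx_eq hR
    (abs_append_le (abs_append_le hμ hν) fun i => by simpa using ht)
    (abs_append_le (abs_append_le hμ' hν') fun i => by simpa using ht') h
  rw [sum_abs_append_sub, sum_abs_append_sub] at h1
  have h2 := norm_le_sum_abs (μ - μ')
  have h3 := norm_le_sum_abs (ν - ν')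
  simp only [PiLp.sub_apply, Fin.sum_univ_one, Matrix.cons_val_fin_one, Nat.cast_add,
    Nat.cast_one] at h1 h2 h3
  linarith

theorem measurable_romInput (i : Fin (p + q + 1)) :
    Measurable fun x : EuclideanSpace ℝ (Fin p) × EuclideanSpace ℝ (Fin q) × ℝ =>
      romInput x.1 x.2.1 x.2.2 i := by
  refine Fin.addCases (fun i => Fin.addCases (fun i => ?_) (fun i => ?_) i) (fun i => ?_) i
  · simp only [romInput]
    fun_prop
  · simp only [romInput, Fin.append_left]
    fun_prop
  · simp only [romInput]
    fun_prop

theorem IsLipschitzOptimalDOD.continuousOn_norm_projResidual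
    (hσ : IsLipschitzOptimalDOD Θ Θ' T G u A ν Lhat σ) (hu : IsSolutionMap Θ Θ' T G u m L)
    (hA : Aᵀ * G * A = 1) :
    ContinuousOn (fun x : EuclideanSpace ℝ (Fin p) × EuclideanSpace ℝ (Fin q) × ℝ =>
      ‖projResidual (σ x.1 x.2.2) (podCoord G A (u x.1 x.2.1 x.2.2))‖)
      (Θ ×ˢ Θ' ×ˢ Set.Icc 0 T) := by
  have hw := hu.continuousOn_podCoord hA
  have hw' : ContinuousOn (fun x : EuclideanSpace ℝ (Fin p) × EuclideanSpace ℝ (Fin q) × ℝ =>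
      (podCoord G A (u x.1 x.2.1 x.2.2)).ofLp) (Θ ×ˢ Θ' ×ˢ Set.Icc 0 T) :=
    (PiLp.continuous_ofLp 2 _).comp_continuousOn hw
  have h : Continuous fun y : Matrix (Fin Nh) (Fin r) ℝ × (Fin Nh → ℝ) =>
      y.2 - y.1 *ᵥ (y.1ᵀ *ᵥ y.2) := by
    fun_prop
  have h1 : Continuous (WithLp.toLp 2 : (Fin Nh → ℝ) → EuclideanSpace ℝ (Fin Nh)) :=
    PiLp.continuous_toLp 2 _
  exact (h1.comp_continuousOn (h.comp_continuousOn (hσ.continuousOn.prodMk hw'))).norm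

/-- On the event of the sampling lemma, the integral over `Θ'` of the squared residual of an
optimal DOD is controlled by the bound for its empirical mean. -/
theorem IsLipschitzOptimalDOD.lintegral_projResidual_le
    (hσ : IsLipschitzOptimalDOD Θ Θ' T G u A ν Lhat σ) (hu : IsSolutionMap Θ Θ' T G u m L)
    (hA : Aᵀ * G * A = 1) {M : ℝ}
    (hM : ∀ μ ∈ Θ, ∀ ν ∈ Θ', ∀ t ∈ Set.Icc 0 T, ‖podCoord G A (u μ ν t)‖ ≤ M) {b η : ℝ}
    (hsample : ∀ f : EuclideanSpace ℝ (Fin q) → ℝ,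
        (∀ x ∈ Θ', 0 ≤ f x) → (∀ x ∈ Θ', f x ≤ M ^ 2) →
        (∀ x ∈ Θ', ∀ y ∈ Θ', f x - f y ≤ 2 * M * |L| * ‖x - y‖) →
        ∫⁻ x in Θ', ENNReal.ofReal (f x) ≤
          ENNReal.ofReal (volume.real Θ' / N * ∑ j, f (ν j) + η))
    {μ : EuclideanSpace ℝ (Fin p)} (hμ : μ ∈ Θ) {t : ℝ} (ht : t ∈ Set.Icc 0 T)
    (hb : volume.real Θ' / N * ∑ j, ‖projResidual (σ μ t) (podCoord G A (u μ (ν j) t))‖ ^ 2 ≤ b) :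
    ∫⁻ x in Θ', ENNReal.ofReal (‖projResidual (σ μ t) (podCoord G A (u μ x t))‖ ^ 2) ≤
      ENNReal.ofReal (b + η) := by
  have hS := transpose_mul_self_of_orthonormal hA (hσ.orthonormal μ hμ t ht)
  have hres : ∀ x ∈ Θ', ‖projResidual (σ μ t) (podCoord G A (u μ x t))‖ ≤ M := fun x hx =>
    (norm_projResidual_le hS _).trans (hM μ hμ x hx t ht)
  refine (hsample _ (fun x hx => by positivity) (fun x hx => ?_) fun x hx y hy => ?_).trans
    (ENNReal.ofReal_le_ofReal (by linarith))
  · exact pow_le_pow_left₀ (norm_nonneg _) (hres x hx) 2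
  · have h1 : ‖projResidual (σ μ t) (podCoord G A (u μ x t))‖ -
        ‖projResidual (σ μ t) (podCoord G A (u μ y t))‖ ≤ |L| * ‖x - y‖ := by
      refine (norm_sub_norm_le _ _).trans ?_
      rw [← projResidual_sub]
      refine (norm_projResidual_le hS _).trans
        ((hu.norm_podCoord_sub_le hA hμ hμ hx hy ht ht).trans (le_of_eq (by simp)))
    have hM0 : 0 ≤ M := (norm_nonneg _).trans (hres x hx)
    have h2 := hres x hx
    have h3 := hres y hy
    have h4 := norm_nonneg (projResidual (σ μ t) (podCoord G A (u μ x t)))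
    have h5 := norm_nonneg (projResidual (σ μ t) (podCoord G A (u μ y t)))
    set a := ‖projResidual (σ μ t) (podCoord G A (u μ x t))‖
    set b := ‖projResidual (σ μ t) (podCoord G A (u μ y t))‖
    have h6 : 0 ≤ |L| * ‖x - y‖ := by positivity
    calc a ^ 2 - b ^ 2 = (a + b) * (a - b) := by ring
      _ ≤ (a + b) * (|L| * ‖x - y‖) := mul_le_mul_of_nonneg_left h1 (by positivity)
      _ ≤ (2 * M) * (|L| * ‖x - y‖) := mul_le_mul_of_nonneg_right (by linarith) h6
      _ = 2 * M * |L| * ‖x - y‖ := by ring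

theorem HasBoundedPartials.mono {a b k : ℕ} {C C' : ℝ}
    {f : EuclideanSpace ℝ (Fin a) → EuclideanSpace ℝ (Fin b)} (hf : HasBoundedPartials k C f)
    (h : C ≤ C') : HasBoundedPartials k C' f :=
  ⟨hf.1, fun i hi α v => (hf.2 i hi α v).trans h⟩

theorem HasBoundedPartials.norm_le {a b k : ℕ} {C : ℝ}
    {f : EuclideanSpace ℝ (Fin a) → EuclideanSpace ℝ (Fin b)} (hf : HasBoundedPartials k C f)
    (v : EuclideanSpace ℝ (Fin a)) : ‖f v‖ ≤ C := by
  simpa using hf.2 0 (Nat.zero_le k) Fin.elim0 v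

/-- The error at a point whose cells in the tables of the inner DOD module and of the feedforward
network are represented by `(μ₁, t₁)` and `(μ₂, ν₂, t₂)`. -/
theorem IsLipschitzOptimalDOD.norm_sub_mulVec_le
    (hσ : IsLipschitzOptimalDOD Θ Θ' T G u A ν Lhat σ) (hu : IsSolutionMap Θ Θ' T G u m L)
    (hA : Aᵀ * G * A = 1) {M ρ κ : ℝ}
    (hM : ∀ μ ∈ Θ, ∀ ν ∈ Θ', ∀ t ∈ Set.Icc 0 T, ‖podCoord G A (u μ ν t)‖ ≤ M)
    {μ μ₁ μ₂ : EuclideanSpace ℝ (Fin p)} (hμ : μ ∈ Θ) (hμ₁ : μ₁ ∈ Θ) (hμ₂ : μ₂ ∈ Θ)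
    {ν₀ ν₂ : EuclideanSpace ℝ (Fin q)} (hν : ν₀ ∈ Θ') (hν₂ : ν₂ ∈ Θ') {t t₁ t₂ : ℝ}
    (ht : t ∈ Set.Icc 0 T) (ht₁ : t₁ ∈ Set.Icc 0 T) (ht₂ : t₂ ∈ Set.Icc 0 T)
    (h₁ : ‖μ - μ₁‖ + |t - t₁| ≤ ρ) (h₂ : ‖μ - μ₂‖ + ‖ν₀ - ν₂‖ + |t - t₂| ≤ ρ) {y : Fin r → ℝ}
    (hy : ‖WithLp.toLp 2 ((σ μ₂ t₂)ᵀ *ᵥ (podCoord G A (u μ₂ ν₂ t₂)).ofLp) - WithLp.toLp 2 y‖ ≤ κ) :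
    ‖podCoord G A (u μ ν₀ t) - WithLp.toLp 2 (σ μ₁ t₁ *ᵥ y)‖ ≤
      ‖projResidual (σ μ t) (podCoord G A (u μ ν₀ t))‖ + ((2 * |Lhat| * M + |L|) * ρ + κ) := by
  have hS := fun {μ t} hμ ht => transpose_mul_self_of_orthonormal hA (hσ.orthonormal μ hμ t ht)
  refine (_root_.norm_sub_mulVec_le (hS hμ ht) (hS hμ₁ ht₁) (hS hμ₂ ht₂) _
    (podCoord G A (u μ₂ ν₂ t₂)) y).trans (add_le_add le_rfl ?_)
  have hw := hM μ hμ ν₀ hν t ht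
  have e1 := (hσ.norm_sub_le hμ hμ₁ ht ht₁).trans (mul_le_mul_of_nonneg_left h₁ (abs_nonneg _))
  have h₂' : ‖μ - μ₂‖ + |t - t₂| ≤ ρ := by linarith [norm_nonneg (ν₀ - ν₂)]
  have e2 := (hσ.norm_sub_le hμ hμ₂ ht ht₂).trans (mul_le_mul_of_nonneg_left h₂' (abs_nonneg _))
  have e3 := (hu.norm_podCoord_sub_le hA hμ hμ₂ hν hν₂ ht ht₂).trans
    (mul_le_mul_of_nonneg_left h₂ (abs_nonneg L))
  have hρ : 0 ≤ ρ := le_trans (by positivity) h₁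
  have e4 := mul_le_mul e1 hw (norm_nonneg _) (by positivity)
  have e5 := mul_le_mul e2 hw (norm_nonneg _) (by positivity)
  calc _ ≤ |Lhat| * ρ * M + |Lhat| * ρ * M + |L| * ρ + κ :=
        add_le_add (add_le_add (add_le_add e4 e5) e3) hy
    _ = _ := by ring

/-- The weights for a sample whose optimal DOD has small residuals. The tables are indexed by the
cells of width `2 * R / (Kx + 1)`, and the networks read them correctly outside of a set of small
measure, on which the error is only bounded. -/
theorem IsLipschitzOptimalDOD.exists_weights
    (hσ : IsLipschitzOptimalDOD Θ Θ' T G u A ν Lhat σ) (hu : IsSolutionMap Θ Θ' T G u m L)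
    (hA : Aᵀ * G * A = 1) (hm : 0 < m) (hΘ : IsCompact Θ) (hΘ' : IsCompact Θ') (hT : 0 ≤ T)
    {R : ℝ} (hR : 0 < R) (hΘR : ∀ μ ∈ Θ, ∀ i, |μ i| ≤ R) (hΘR' : ∀ ν ∈ Θ', ∀ i, |ν i| ≤ R)
    (hTR : T ≤ R) {M : ℝ}
    (hM : ∀ μ ∈ Θ, ∀ ν ∈ Θ', ∀ t ∈ Set.Icc 0 T, ‖podCoord G A (u μ ν t)‖ ≤ M)
    (hs : 2 ≤ s) {C₁ C₂ : ℝ}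
    {χ : EuclideanSpace ℝ (Fin n) → EuclideanSpace ℝ (Fin r)}
    {χ' : EuclideanSpace ℝ (Fin r) → EuclideanSpace ℝ (Fin n)}
    (hχ : HasBoundedPartials s C₁ χ) (hχ' : HasBoundedPartials s' C₂ χ')
    (hemb : IsPerfectEmbedding Θ Θ' T G u A σ χ χ') {Kx Kz Kb : ℕ} {c β ε : ℝ}
    (hc0 : 0 ≤ c) (hε : 0 < ε)
    (hc : ∀ μ ∈ Θ, ∀ t ∈ Set.Icc 0 T,
      ∫⁻ x in Θ', ENNReal.ofReal (‖projResidual (σ μ t) (podCoord G A (u μ x t))‖ ^ 2) ≤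
        ENNReal.ofReal c)
    (hnet : (2 * |Lhat| * M + |L|) * ((p + q + 1) * (2 * R / (Kx + 1))) ≤ β / 2)
    (hdec : |C₁| * (n * (2 * (|C₂| + 1) / (Kz + 1))) ^ (s - 1) +
      Fintype.card (MonomialIdx n s) * (|C₁| * (1 + 2 * (|C₂| + 1)) ^ s / 2 ^ Kb) ≤ β / 2)
    (hsmall : 2 / m ^ 2 * c * (volume.real Θ * T) +
      2 * β ^ 2 / m ^ 2 * (domainMeasure Θ Θ' T).real Set.univ ≤ ε ^ 2 / 2) :
    ∃ (θV : (lookupDOD p Nh r Kx).Weights) (θΨ : (decoderArch n s Kz Kb r).Weights)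
      (θΦ : (feedforwardArch (p + q + 1) Kx n).Weights),
      relativeError Θ Θ' T G u (dodDlRom A θV θΨ θΦ) < ENNReal.ofReal ε := by
  have habs : ∀ t ∈ Set.Icc 0 T, |t| ≤ R := fun t ht => by
    rw [abs_of_nonneg ht.1]
    exact ht.2.trans hTR
  have hS := fun {μ t} hμ ht => transpose_mul_self_of_orthonormal hA (hσ.orthonormal μ hμ t ht)
  obtain ⟨rep₁, hrep₁⟩ := exists_representatives (Θ ×ˢ Set.Icc 0 T)
    (fun x : EuclideanSpace ℝ (Fin p) × ℝ => cellIdx Kx R (dodInput x.1 x.2))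
  obtain ⟨rep₂, hrep₂⟩ := exists_representatives (Θ ×ˢ Θ' ×ˢ Set.Icc 0 T)
    (fun x : EuclideanSpace ℝ (Fin p) × EuclideanSpace ℝ (Fin q) × ℝ =>
      cellIdx Kx R (romInput x.1 x.2.1 x.2.2))
  let coord : EuclideanSpace ℝ (Fin p) × EuclideanSpace ℝ (Fin q) × ℝ → EuclideanSpace ℝ (Fin r) :=
    fun x => WithLp.toLp 2 ((A * σ x.1 x.2.2)ᵀ *ᵥ (G *ᵥ u x.1 x.2.1 x.2.2))
  obtain ⟨g, hg, hgχ, hgθ⟩ := (hχ.mono (le_abs_self C₁)).exists_reduced_weights (R := R) hs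
    (abs_nonneg C₁) (R₂ := |C₂| + 1) (by positivity) Kx Kz Kb
    (z := fun k => χ' (coord (rep₂ k)))
    (fun k i => (PiLp.norm_apply_le _ i).trans
      ((hχ'.norm_le _).trans ((le_abs_self C₂).trans (by linarith))))
  -- The outputs of the reduced networks are bounded independently of the width of the ramps.
  obtain ⟨B₀, hB₀⟩ := (isCompact_Icc (a := (0 : ℝ))
    (b := ∑ i : Fin (p + q + 1), (Kx : ℝ) * ((Kx : ℝ) + 1) ^ (i : ℕ))).exists_bound_of_continuousOn
    (f := fun y => ∑ j, |g y j|) (by fun_prop)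
  have hgB : ∀ (τ : ℝ) x, ∑ j, |g (rampIdx Kx R τ x) j| ≤ B₀ := fun τ x =>
    (le_abs_self _).trans (hB₀ _ ⟨rampIdx_nonneg _ _ _ _, rampIdx_le _ _ _ _⟩)
  have := isFiniteMeasure_domainMeasure (T := T) hΘ hΘ'
  set B := M + B₀ with hB
  obtain ⟨τ, hτ, hbad, hbadμ⟩ := exists_measure_Ioo_preimage_le (domainMeasure Θ Θ' T)
    (f := fun (j : Fin (p + q + 1) × Fin Kx)
      (x : EuclideanSpace ℝ (Fin p) × EuclideanSpace ℝ (Fin q) × ℝ) =>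
        gridPos Kx R (romInput x.1 x.2.1 x.2.2 j.1) - (j.2 + 1))
    (fun j => by
      have := measurable_romInput (p := p) (q := q) j.1
      simp only [gridPos]
      fun_prop)
    (η := ENNReal.ofReal (ε ^ 2 / 2 / (B ^ 2 / m ^ 2 + 1)))
    (ENNReal.ofReal_pos.2 (by positivity))
  set bad := {x : EuclideanSpace ℝ (Fin p) × EuclideanSpace ℝ (Fin q) × ℝ |
    ∃ j : Fin (p + q + 1) × Fin Kx,
      gridPos Kx R (romInput x.1 x.2.1 x.2.2 j.1) - (j.2 + 1) ∈ Set.Ioo (-τ) 0} with hbad_def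
  obtain ⟨θV, hV1, hV⟩ := lookupDOD_exists_weights R τ fun k => σ (rep₁ k).1 (rep₁ k).2
  obtain ⟨θΨ, θΦ, hθ⟩ := hgθ τ
  have herr : ∀ (μ : EuclideanSpace ℝ (Fin p)) (ν₀ : EuclideanSpace ℝ (Fin q)) (t : ℝ),
      gNorm G (u μ ν₀ t - dodDlRom A θV θΨ θΦ μ ν₀ t) = ‖podCoord G A (u μ ν₀ t) -
        WithLp.toLp 2 (DODArch.realize θV (dodInput μ t) *ᵥ
          g (rampIdx Kx R τ (romInput μ ν₀ t)))‖ := by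
    intro μ ν₀ t
    rw [dodDlRom, hθ, ← Matrix.mulVec_mulVec]
    conv_lhs => rw [← mulVec_podCoord hA (u μ ν₀ t)]
    rw [← Matrix.mulVec_sub, gNorm_mulVec hA]
    rfl
  refine ⟨θV, θΨ, θΦ, relativeError_lt hu hm hΘ hΘ' hT
    (hσ.continuousOn_norm_projResidual hu hA) (B := B) hc0 hε hc hbad
    ?_ ?_ hsmall ?_⟩
  · rintro ⟨μ, ν₀, t⟩ ⟨hμ, hν, ht⟩ hx
    have hgrid : ∀ (i : Fin (p + q + 1)) (k : Fin Kx),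
        gridPos Kx R (romInput μ ν₀ t i) - (k + 1) ∉ Set.Ioo (-τ) 0 :=
      fun i k h => hx ⟨(i, k), h⟩
    have hidx₂ := rampIdx_eq_cellIdx hτ hgrid
    have hidx₁ : rampIdx Kx R τ (dodInput μ t) = (cellIdx Kx R (dodInput μ t) : ℕ) := by
      refine rampIdx_eq_cellIdx hτ fun i k => ?_
      refine Fin.addCases (fun i => ?_) (fun i => ?_) i
      · simpa using hgrid (Fin.castAdd 1 (Fin.castAdd q i)) k
      · simpa using hgrid (Fin.natAdd (p + q) i) k
    obtain ⟨hm₁, hr₁⟩ := hrep₁ (μ, t) ⟨hμ, ht⟩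
    obtain ⟨hm₂, hr₂⟩ := hrep₂ (μ, ν₀, t) ⟨hμ, hν, ht⟩
    have hd₁ := dist_le_of_dodInput_cellIdx_eq hR (hΘR _ hμ) (hΘR _ hm₁.1) (habs _ ht)
      (habs _ hm₁.2) hr₁.symm
    have hd₂ := dist_le_of_romInput_cellIdx_eq hR (hΘR _ hμ) (hΘR _ hm₂.1) (hΘR' _ hν)
      (hΘR' _ hm₂.2.1) (habs _ ht) (habs _ hm₂.2.2) hr₂.symm
    have hd₁' : ((p : ℝ) + 1) * (2 * R / (Kx + 1)) ≤ (p + q + 1) * (2 * R / (Kx + 1)) :=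
      mul_le_mul_of_nonneg_right (by linarith [Nat.cast_nonneg (α := ℝ) q]) (by positivity)
    have hy := hgχ (cellIdx Kx R (romInput μ ν₀ t))
    have hemb₂ : χ (χ' (coord (rep₂ (cellIdx Kx R (romInput μ ν₀ t))))) = _ :=
      hemb _ hm₂.1 _ hm₂.2.1 _ hm₂.2.2
    rw [hemb₂, transpose_mul_mulVec] at hy
    rw [herr, hV _ hidx₁ (hS hm₁.1 hm₁.2), hidx₂]
    refine (hσ.norm_sub_mulVec_le hu hA hM hμ hm₁.1 hm₂.1 hν hm₂.2.1 ht hm₁.2 hm₂.2.2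
      (hd₁.trans hd₁') hd₂ (hy.trans hdec)).trans ?_
    simp only
    linarith
  · rintro ⟨μ, ν₀, t⟩ ⟨hμ, hν, ht⟩
    rw [herr]
    refine (_root_.norm_sub_le _ _).trans (add_le_add (hM μ hμ ν₀ hν t ht) ?_)
    exact (norm_toLp_mulVec_le_of_columns (hV1 _) _).trans (hgB _ _)
  · refine (mul_le_mul_right hbadμ.le _).trans_lt ?_
    rw [← ENNReal.ofReal_mul (by positivity)]
    refine ENNReal.ofReal_lt_ofReal_iff (by positivity) |>.2 ?_
    rw [mul_div_assoc', div_lt_iff₀ (by positivity)]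
    have : 0 < ε ^ 2 / 2 := by positivity
    nlinarith

end Rom

/-! ### The choice of the numbers of cells and digits -/

/-- The grid of width `O(ε)` makes the error of replacing a point by the representative of its
cell at most `κ * ε / 2`. -/
theorem mul_div_ceil_le {H κ ε : ℝ} (hκ : 0 < κ) (hε : 0 < ε) :
    H / ((⌈2 * H / κ * ε⁻¹⌉₊ : ℝ) + 1) ≤ κ * ε / 2 := by
  have h := Nat.le_ceil (2 * H / κ * ε⁻¹)
  rw [div_le_iff₀ (by positivity)]
  have h1 : H = κ * ε / 2 * (2 * H / κ * ε⁻¹) := by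
    field_simp
  calc H = κ * ε / 2 * (2 * H / κ * ε⁻¹) := h1
    _ ≤ _ := mul_le_mul_of_nonneg_left (by linarith) (by positivity)

theorem mul_div_ceil_pow_le {a b κ ε : ℝ} {s : ℕ} (hs : 2 ≤ s) (ha : 0 ≤ a) (hb : 0 ≤ b)
    (hκ : 0 < κ) (hε : 0 < ε) :
    a * (b / ((⌈b * (4 * a / κ + 1) * ε ^ (-(1 / ((s : ℝ) - 1)))⌉₊ : ℝ) + 1)) ^ (s - 1) ≤
      κ * ε / 4 := by
  have hs1 : (((s - 1 : ℕ) : ℝ)) = (s : ℝ) - 1 := by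
    rw [Nat.cast_sub (by omega), Nat.cast_one]
  have hs0 : (s : ℝ) - 1 ≠ 0 := by
    rw [← hs1]
    exact_mod_cast (by omega : s - 1 ≠ 0)
  set K := ⌈b * (4 * a / κ + 1) * ε ^ (-(1 / ((s : ℝ) - 1)))⌉₊ with hK
  set x := 4 * a / κ + 1 with hx
  have hx1 : 1 ≤ x := by
    have : 0 ≤ 4 * a / κ := by positivity
    linarith
  set e := ε ^ (1 / ((s : ℝ) - 1)) with he
  have he0 : 0 < e := Real.rpow_pos_of_pos hε _
  have hes : e ^ (s - 1) = ε := by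
    rw [he, ← Real.rpow_natCast, ← Real.rpow_mul hε.le, hs1, one_div_mul_cancel hs0,
      Real.rpow_one]
  have hKe : b * x * e⁻¹ ≤ K := by
    rw [he, ← Real.rpow_neg hε.le]
    exact Nat.le_ceil _
  have h1 : b / ((K : ℝ) + 1) ≤ e / x := by
    rw [div_le_div_iff₀ (by positivity) (by positivity)]
    calc b * x = e * (b * x * e⁻¹) := by field_simp
      _ ≤ _ := mul_le_mul_of_nonneg_left (by linarith) he0.le
  have h2 : (b / ((K : ℝ) + 1)) ^ (s - 1) ≤ ε / x := by
    refine (pow_le_pow_left₀ (by positivity) h1 _).trans ?_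
    rw [div_pow, hes]
    exact div_le_div_of_nonneg_left hε.le (by positivity) (le_self_pow₀ hx1 (by omega))
  refine (mul_le_mul_of_nonneg_left h2 ha).trans ?_
  rw [mul_div_assoc', div_le_iff₀ (by positivity)]
  have h3 : κ * ε / 4 * x = a * ε + κ * ε / 4 := by
    rw [hx]
    field_simp
  rw [h3]
  have : 0 < κ * ε := by positivity
  linarith

theorem div_two_pow_clog_le {a κ ε : ℝ} (hκ : 0 < κ) (hε : 0 < ε) :
    a / 2 ^ Nat.clog 2 (⌈4 * a / κ * ε⁻¹⌉₊ + 1) ≤ κ * ε / 4 := by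
  have h : ((⌈4 * a / κ * ε⁻¹⌉₊ + 1 : ℕ) : ℝ) ≤ 2 ^ Nat.clog 2 (⌈4 * a / κ * ε⁻¹⌉₊ + 1) := by
    exact_mod_cast Nat.le_pow_clog one_lt_two _
  have h' := Nat.le_ceil (4 * a / κ * ε⁻¹)
  rw [div_le_iff₀ (by positivity)]
  push_cast at h
  calc a = κ * ε / 4 * (4 * a / κ * ε⁻¹) := by field_simp
    _ ≤ _ := mul_le_mul_of_nonneg_left (by linarith) (by positivity)

/-- The logarithm absorbs all depths and constants, as `ε` is bounded away from `1`. -/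
theorem exists_architecture_size {ε₀ : ℝ} (h0 : 0 < ε₀) (h1 : ε₀ < 1) (p q n : ℕ) {s : ℕ}
    (hs : 2 ≤ s) {c₁ c₂ c₃ : ℝ} (hc₁ : 0 ≤ c₁) (hc₂ : 0 ≤ c₂) (hc₃ : 0 ≤ c₃) :
    ∃ c : ℝ, 0 < c ∧ ∀ ε : ℝ, 0 < ε → ε ≤ ε₀ → ∀ Kx Kz Kb : ℕ, Kx = ⌈c₁ * ε⁻¹⌉₊ →
      Kz = ⌈c₂ * ε ^ (-(1 / ((s : ℝ) - 1)))⌉₊ → Kb = Nat.clog 2 (⌈c₃ * ε⁻¹⌉₊ + 1) →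
      ∀ NA : ℕ, 1 ≤ NA →
      (∀ r : ℕ, ((lookupDOD p NA r Kx).layers : ℝ) ≤ c * Real.log ε⁻¹ ∧
        ((lookupDOD p NA r Kx).activeWeights : ℝ) ≤
          c * NA * r * ε ^ (-((p : ℝ) + 1)) * Real.log ε⁻¹ ∧
        ((decoderArch n s Kz Kb r).depth : ℝ) ≤ c * Real.log ε⁻¹ ∧
        ((decoderArch n s Kz Kb r).activeWeights : ℝ) ≤
          c * r * ε ^ (-((n : ℝ) / ((s : ℝ) - 1))) * Real.log ε⁻¹) ∧
      ((feedforwardArch (p + q + 1) Kx n).depth : ℝ) ≤ c * Real.log ε⁻¹ ∧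
      ((feedforwardArch (p + q + 1) Kx n).activeWeights : ℝ) ≤
        c * n * ε ^ (-((p : ℝ) + q + 1)) * Real.log ε⁻¹ := by
  obtain ⟨a₁, ha₁, H₁⟩ := exists_const_le_log h0 h1 (a := 4) (by norm_num)
  obtain ⟨a₂, ha₂, H₂⟩ := exists_lookup_size h0 h1 (d := p + 1) (by omega) hc₁
  obtain ⟨a₃, ha₃, H₃⟩ := exists_lookup_size h0 h1 (d := p + q + 1) (by omega) hc₁
  obtain ⟨a₄, ha₄, H₄⟩ := exists_decoder_size h0 h1 n hs hc₂ hc₃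
  set c := a₁ + a₂ + a₃ + a₄ + 1 with hc
  have hc0 : 0 < c := by positivity
  refine ⟨c, hc0, ?_⟩
  rintro ε hε hε₀ Kx Kz Kb rfl rfl rfl NA hNA
  have hlog : 0 ≤ Real.log ε⁻¹ := Real.log_nonneg ((one_le_inv₀ hε).2 (hε₀.trans h1.le))
  have hK₁ := H₁ ε hε hε₀
  have hmono : ∀ {a b : ℝ}, a ≤ c → 0 ≤ b → a * b ≤ c * b := fun h hb =>
    mul_le_mul_of_nonneg_right h hb
  have hfour : 4 ≤ c * Real.log ε⁻¹ := hK₁.trans (hmono (by linarith) hlog)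
  obtain ⟨hdepth, hcount⟩ := H₄ ε hε hε₀ _ _ rfl rfl
  refine ⟨fun r => ⟨?_, ?_, ?_, ?_⟩, ?_, ?_⟩
  · exact le_trans (by exact_mod_cast lookupDOD_layers_le p NA r _) hfour
  · have h2 := H₂ ε hε hε₀ NA hNA
    have h3 : ((lookupDOD p NA r ⌈c₁ * ε⁻¹⌉₊).activeWeights : ℝ) ≤ r * _ :=
      (Nat.cast_le.2 (lookupDOD_activeWeights_le p NA r _)).trans (le_of_eq (Nat.cast_mul _ _))
    refine h3.trans ((mul_le_mul_of_nonneg_left h2 (Nat.cast_nonneg r)).trans ?_)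
    have h4 := hmono (a := a₂) (b := NA * r * ε ^ (-((p : ℝ) + 1)) * Real.log ε⁻¹)
      (by linarith) (by positivity)
    push_cast
    linarith
  · rw [decoderArch]
    split_ifs
    · refine le_trans ?_ hfour
      norm_num
    · exact hdepth.trans (hmono (by linarith) hlog)
  · rw [decoderArch]
    refine (Nat.cast_le.2 (mlpArch_activeWeights_le _ _ _)).trans ?_
    split_ifs with h
    · have h5 : mlpCount n [] r ≤ r := by
        rcases h with rfl | rfl <;> simp [mlpCount]
      refine (Nat.cast_le.2 h5).trans ?_
      rcases h with rfl | rfl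
      · have : (r : ℝ) * 1 ≤ r * (c * Real.log ε⁻¹) :=
          mul_le_mul_of_nonneg_left (by linarith) (Nat.cast_nonneg r)
        simp only [Nat.cast_zero, zero_div, neg_zero, Real.rpow_zero]
        linarith
      · simp
    · have h5 := hcount r (by omega)
      refine h5.trans ?_
      have h4 := hmono (a := a₄) (b := r * ε ^ (-((n : ℝ) / ((s : ℝ) - 1))) * Real.log ε⁻¹)
        (by linarith) (by positivity)
      linarith
  · refine le_trans ?_ hfour
    rw [feedforwardArch]
    split_ifs <;> norm_num
  · rw [feedforwardArch]
    refine (Nat.cast_le.2 (mlpArch_activeWeights_le _ _ _)).trans ?_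
    split_ifs with h
    · subst h
      simp [mlpCount]
    · rw [mlpCount_three]
      refine (H₃ ε hε hε₀ n (by omega)).trans ?_
      have h4 := hmono (a := a₃) (b := n * ε ^ (-((p : ℝ) + q + 1)) * Real.log ε⁻¹)
        (by linarith) (by positivity)
      push_cast
      linarith

/-! ### Approximation of the solution map -/

theorem mainTheorem1 (p q n s s' : ℕ) (hs' : 2 ≤ s') (hs : s' ≤ s)
    (Θ : Set (EuclideanSpace ℝ (Fin p))) (Θ' : Set (EuclideanSpace ℝ (Fin q)))
    (hΘ : IsCompact Θ) (hΘ' : IsCompact Θ') (hΘvol : 0 < volume Θ) (hΘ'vol : 0 < volume Θ')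
    (T : ℝ) (hT : 0 < T) (L Lhat C₁ C₂ m ε₀ : ℝ) (hm : 0 < m) (hε₀ : ε₀ < 1) :
    ∃ c : ℝ, 0 < c ∧
      ∀ (Nh : ℕ) (G : Matrix (Fin Nh) (Fin Nh) ℝ), G.PosDef →
      ∀ u : EuclideanSpace ℝ (Fin p) → EuclideanSpace ℝ (Fin q) → ℝ → Fin Nh → ℝ,
        IsSolutionMap Θ Θ' T G u m L →
      ∀ ε δ : ℝ, 0 < ε → ε ≤ ε₀ → 0 < δ → δ < 1 →
      ∃ N₀ : ℕ, ∀ N ≥ N₀,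
      ∃ (ΦV : (r : ℕ) → DODArch p Nh r) (Ψ : (r : ℕ) → ReLUArch n r)
        (Φ : ReLUArch (p + q + 1) n),
        (∀ r : ℕ,
          ((ΦV r).layers : ℝ) ≤ c * Real.log ε⁻¹ ∧
          ((ΦV r).activeWeights : ℝ) ≤ c * Nh * r * ε ^ (-((p : ℝ) + 1)) * Real.log ε⁻¹ ∧
          ((Ψ r).depth : ℝ) ≤ c * Real.log ε⁻¹ ∧
          ((Ψ r).activeWeights : ℝ) ≤ c * r * ε ^ (-((n : ℝ) / ((s : ℝ) - 1))) * Real.log ε⁻¹) ∧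
        (Φ.depth : ℝ) ≤ c * Real.log ε⁻¹ ∧
        (Φ.activeWeights : ℝ) ≤ c * n * ε ^ (-((p : ℝ) + q + 1)) * Real.log ε⁻¹ ∧
        ∃ E : Set (Fin N → EuclideanSpace ℝ (Fin q)),
          MeasurableSet E ∧ 1 - δ < (sampleLaw Θ' N).real E ∧
          ∀ ν ∈ E, ∀ A : Matrix (Fin Nh) (Fin Nh) ℝ, Aᵀ * G * A = 1 →
          ∀ (σ : EuclideanSpace ℝ (Fin p) → ℝ →
              Matrix (Fin Nh) (Fin (dodDim Θ Θ' T G u m ε A ν)) ℝ)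
            (χ : EuclideanSpace ℝ (Fin n) →
              EuclideanSpace ℝ (Fin (dodDim Θ Θ' T G u m ε A ν)))
            (χ' : EuclideanSpace ℝ (Fin (dodDim Θ Θ' T G u m ε A ν)) →
              EuclideanSpace ℝ (Fin n)),
            IsLipschitzOptimalDOD Θ Θ' T G u A ν Lhat σ →
            HasBoundedPartials s C₁ χ → HasBoundedPartials s' C₂ χ' →
            IsPerfectEmbedding Θ Θ' T G u A σ χ χ' →
            ∃ (θV : (ΦV (dodDim Θ Θ' T G u m ε A ν)).Weights)
              (θΨ : (Ψ (dodDim Θ Θ' T G u m ε A ν)).Weights) (θΦ : Φ.Weights),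
              relativeError Θ Θ' T G u (dodDlRom A θV θΨ θΦ) < ENNReal.ofReal ε := by
  have hs2 : 2 ≤ s := hs'.trans hs
  rcases le_or_gt ε₀ 0 with hε₀' | hε₀'
  · exact ⟨1, one_pos, fun _ _ _ _ _ ε _ hε hεε => absurd (hε.trans_le hεε) hε₀'.not_gt⟩
  obtain ⟨R₁, hR₁, hΘR₁⟩ := exists_forall_abs_coord_le hΘ
  obtain ⟨R₂, hR₂, hΘR₂⟩ := exists_forall_abs_coord_le hΘ'
  set R := R₁ + R₂ + T with hR
  have hR0 : 0 < R := by positivity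
  have hΘR : ∀ μ ∈ Θ, ∀ i, |μ i| ≤ R := fun μ hμ i => (hΘR₁ μ hμ i).trans (by linarith)
  have hΘR' : ∀ ν ∈ Θ', ∀ i, |ν i| ≤ R := fun ν hν i => (hΘR₂ ν hν i).trans (by linarith)
  have hTR : T ≤ R := by linarith
  set v := (domainMeasure Θ Θ' T).real Set.univ with hv
  have hv0 : 0 ≤ v := measureReal_nonneg
  set V := volume.real Θ * T with hV
  have hV0 : 0 < V :=
    mul_pos (ENNReal.toReal_pos hΘvol.ne' hΘ.measure_lt_top.ne) hT
  set M := m + 1 + |L| * ((p + q + 1) * (2 * R)) with hM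
  have hM0 : 0 ≤ M := by positivity
  -- The error away from the residual is at most `β = κ * ε`; half of it comes from the cells, and a
  -- quarter from each of the two errors of the decoder.
  set κ := m / (4 * (1 + v)) with hκ
  have hκ0 : 0 < κ := by positivity
  set H := (2 * |Lhat| * M + |L|) * ((p + q + 1) * (2 * R)) with hH
  set b := (n : ℝ) * (2 * (|C₂| + 1)) with hb
  set a := (Fintype.card (MonomialIdx n s) : ℝ) * (|C₁| * (1 + 2 * (|C₂| + 1)) ^ s) with ha
  obtain ⟨c, hc0, hc⟩ := exists_architecture_size hε₀' hε₀ p q n hs2 (c₁ := 2 * H / κ)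
    (c₂ := b * (4 * |C₁| / κ + 1)) (c₃ := 4 * a / κ) (by positivity) (by positivity)
    (by positivity)
  refine ⟨c, hc0, fun Nh G _ u hu ε δ hε hεε hδ _ => ?_⟩
  have hNh : 1 ≤ Nh := by
    by_contra hcon
    obtain rfl : Nh = 0 := by omega
    have : (ae (domainMeasure Θ Θ' T)).NeBot := ae_neBot.2 (domainMeasure_ne_zero hΘvol hΘ'vol hT)
    obtain ⟨x, hx⟩ := hu.ae_le.exists
    have h0 : gNorm G (u x.1 x.2.1 x.2.2) = 0 := by simp [gNorm]
    linarith
  obtain ⟨N₀, hN₀⟩ := exists_sample_event hΘ' hΘ'vol (Λ := 2 * M * |L|) (B := M ^ 2)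
    (η := m ^ 2 / (16 * V) * ε ^ 2) (by positivity) (by positivity) (by positivity) hδ
  refine ⟨N₀, fun N hN => ?_⟩
  obtain ⟨E, hE, hEδ, hsample⟩ := hN₀ N hN
  obtain ⟨hsize, hdepth, hweights⟩ := hc ε hε hεε _ _ _ rfl rfl rfl Nh hNh
  refine ⟨fun r => lookupDOD p Nh r _, fun r => decoderArch n s _ _ r, feedforwardArch _ _ n,
    hsize, hdepth, hweights, E, hE, hEδ, ?_⟩
  intro ν hν A hA σ χ χ' hσ hχ hχ' hemb
  have hMu : ∀ μ ∈ Θ, ∀ ν ∈ Θ', ∀ t ∈ Set.Icc 0 T, ‖podCoord G A (u μ ν t)‖ ≤ M :=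
    fun μ hμ ν hν t ht =>
      hu.norm_podCoord_le hA hΘvol hΘ'vol hT hΘ hΘ' hΘR hΘR' hTR hμ hν ht
  refine hσ.exists_weights hu hA hm hΘ hΘ' hT.le hR0 hΘR hΘR' hTR hMu hs2 hχ hχ' hemb
    (β := κ * ε) (by positivity) hε (fun μ hμ t ht => hσ.lintegral_projResidual_le hu hA hMu
      (hsample ν hν) hμ ht (hσ.mean_projResidual_le hT.le hA hμ ht)) ?_ ?_ ?_
  · refine le_trans (le_of_eq ?_) (mul_div_ceil_le (H := H) hκ0 hε)
    rw [hH]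
    ring
  · have h1 := mul_div_ceil_pow_le hs2 (abs_nonneg C₁) (b := b) (by positivity) hκ0 hε
    have h2 := div_two_pow_clog_le (a := a) hκ0 hε
    rw [mul_div_assoc', mul_div_assoc']
    linarith
  · have h1 : 2 * (κ * ε) ^ 2 / m ^ 2 * v ≤ ε ^ 2 / 8 := by
      have h2 : v ≤ (1 + v) ^ 2 := by nlinarith
      have h3 : 2 * (κ * ε) ^ 2 / m ^ 2 * v = ε ^ 2 / 8 * (v / (1 + v) ^ 2) := by
        rw [hκ]
        field_simp
        ring
      rw [h3]
      exact mul_le_of_le_one_right (by positivity) ((div_le_one (by positivity)).2 h2)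
    have h4 : 2 / m ^ 2 * (m ^ 2 / (16 * V) * ε ^ 2 + m ^ 2 / (16 * V) * ε ^ 2) * V =
        ε ^ 2 / 4 := by
      field_simp
      ring
    have : 0 ≤ ε ^ 2 := by positivity
    rw [h4]
    linarith
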